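/- Let $p$ be a prime, let $(K,\mathcal O,k)$ be a $p$-modular system ($\mathcal O$ a complete discrete valuation ring with residue field $k$ of characteristic $p$ and fraction field $K$ of characteristic $0$), let $R=\mathcal O$ or $R=k$, and let $G$ be a finite group. Let $Comack_R(G)$ be the category of cohomological Mackey functors for $G$ over $R$ in the sense of Dress, i.e. bivariant functors $M=(M^*,M_*)$ from finite $G$-sets to $R$-modules that are additive on disjoint unions, satisfy the pullback axiom, and satisfy $M_*(\pi)M^*(\pi)=|H:K|$ for every projection $\pi:G/K\to G/H$ with $K\le H\le G$. The module $M(G/1)$ is an $RG$-module by $x\cdot m=M^*(\gamma_x)(m)$, where $\gamma_x:G/1\to G/1$, $g\mapsto gx$. For $z\in Z(RG)$ and a finite $G$-set $X$, write multiplication by $z$ on the permutation module $RX$ as $\sum_i r_i\,(a_i)_*(b_i)^*$ for finitely many $r_i\in R$ and maps of finite $G$-sets $X\xleftarrow{b_i}U_i\xrightarrow{a_i}X$ (where $f_*(x)=f(x)$ and $f^*(y)=\sum_{f(x)=y}x$), and let $\rho(z)_M(X)=\sum_i r_i\,M_*(b_i)M^*(a_i)$, which does not depend on the choices. For a block $b$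 of $RG$ (a primitive idempotent of $Z(RG)$) let $Comack_R(b)$ be the full subcategory of those $M$ in $Comack_R(G)$ on which $\rho(b)$ is the identity. A $p$-permutation $RG$-module is a direct summand of $RX$ for some finite $G$-set $X$. (1) Let $P$ be a projective indecomposable object of $Comack_R(G)$ and let $b$ be a block of $RG$. Then $P$ lies in $Comack_R(b)$ if and only if $P(G/1)$ is an indecomposable $p$-permutation $RG$-module lying in the block $RGb$ (i.e. $b$ acts on it as the identity). (2) Define the Thévenaz–Webb blocks of $Comack_R(G)$ as the classes of simple cohomological Mackey functors under the equivalence relation generated by isomorphism and by $S\sim T$ whenever there is a non-split short exact sequence $0\to S\to M\to T\to 0$ in $Comack_R(G)$; an object $M$ belongs to such a block if all its simple subquotients lie in it. Then there is a bijection $\Phi$ from the set of blocks of $RG$ to the set of Thévenaz–Webb blocks such that, for every block $b$ of $RG$, a simple cohomological Mackey functor lies in $Comack_R(b)$ if and only if its class is $\Phi(b)$, and an arbitrary cohomological Mackey functor lies in $Comack_R(b)$ if and only if it belongs to $\Phi(b)$. -/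

import Mathlib

universe u

noncomputable section

/-! ### Coefficient rings, blocks of group algebras, permutation projective modules -/

/-- `R = 𝒪` or `R = k` for a `p`-modular system `(K, 𝒪, k)`: either `R` is a complete discrete
valuation ring of characteristic zero whose residue field has characteristic `p`
(then `K` is its fraction field), or `R` is a field of characteristic `p`. -/
def IsModularCoefficientRing (p : ℕ) (R : Type u) [CommRing R] : Prop :=
  (∃ (_ : IsDomain R) (_ : IsDiscreteValuationRing R),
      IsAdicComplete (IsLocalRing.maximalIdeal R) R ∧ CharZero R ∧
        CharP (IsLocalRing.ResidueField R) p) ∨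
    (IsField R ∧ CharP R p)

/-- A block (idempotent) of a ring `A`: a primitive idempotent of the centre of `A`. -/
def IsBlockIdempotent {A : Type u} [Ring A] (b : A) : Prop :=
  b ∈ Subring.center A ∧ IsIdempotentElem b ∧ b ≠ 0 ∧
    ∀ c d : A, c ∈ Subring.center A → d ∈ Subring.center A → IsIdempotentElem c →
      IsIdempotentElem d → c * d = 0 → b = c + d → c = 0 ∨ d = 0

/-- An indecomposable module: nonzero, and not the direct sum of two nonzero submodules. -/
def IsIndecomposableModule (A V : Type u) [Ring A] [AddCommGroup V] [Module A V] : Prop :=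
  Nontrivial V ∧ ∀ V₁ V₂ : Submodule A V, IsCompl V₁ V₂ → V₁ = ⊥ ∨ V₂ = ⊥

/-! ### Finite `G`-sets -/

/-- Finite (left) `G`-sets. Morphisms are the equivariant maps `X →[G] Y`. -/
structure FinGSet (G : Type u) [Group G] where
  carrier : Type u
  [finite : Finite carrier]
  [action : MulAction G carrier]

namespace FinGSet

variable {G : Type u} [Group G]

instance : CoeSort (FinGSet G) (Type u) := ⟨FinGSet.carrier⟩

attribute [instance] FinGSet.finite FinGSet.action

/-- The disjoint union of two finite `G`-sets. -/
def sum (X Y : FinGSet G) : FinGSet G := ⟨X ⊕ Y⟩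

def inl (X Y : FinGSet G) : X →[G] (sum X Y) where
  toFun := Sum.inl
  map_smul' _ _ := rfl

def inr (X Y : FinGSet G) : Y →[G] (sum X Y) where
  toFun := Sum.inr
  map_smul' _ _ := rfl

/-- The square with `a : P → X`, `b : P → Y`, `c : X → Z`, `d : Y → Z` is a pullback square. -/
def IsPullbackSquare {P X Y Z : FinGSet G} (a : P →[G] X) (b : P →[G] Y)
    (c : X →[G] Z) (d : Y →[G] Z) : Prop :=
  (∀ w, c (a w) = d (b w)) ∧ ∀ x y, c x = d y → ∃! w, a w = x ∧ b w = y

/-- The transitive `G`-set `G/H`. -/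
def quot [Finite G] (H : Subgroup G) : FinGSet G := ⟨G ⧸ H⟩

/-- The projection `G/K → G/H`, `gK ↦ gH`, for `K ≤ H`. -/
def proj [Finite G] {K H : Subgroup G} (h : K ≤ H) : quot K →[G] quot H where
  toFun := Subgroup.quotientMapOfLE h
  map_smul' g x := by
    induction x using QuotientGroup.induction_on with
    | H x => rfl

/-- The endomorphism `γ_x : G/1 → G/1`, `g ↦ g x`. -/
def rightMul [Finite G] (x : G) :
    quot (⊥ : Subgroup G) →[G] quot (⊥ : Subgroup G) where
  toFun := Quotient.map' (fun g => g * x) (by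
    intro a b h
    rw [QuotientGroup.leftRel_apply, Subgroup.mem_bot] at h ⊢
    rw [mul_inv_rev, mul_assoc, ← mul_assoc a⁻¹, h, one_mul, inv_mul_cancel])
  map_smul' g y := by
    induction y using QuotientGroup.induction_on with
    | H y => exact congrArg (QuotientGroup.mk (s := (⊥ : Subgroup G))) (mul_assoc g y x)

/-- The set of `G`-orbits on `X × X`. -/
abbrev PairOrbits (X : FinGSet G) : Type u := MulAction.orbitRel.Quotient G (X × X)

/-- A `G`-orbit on `X × X`, as a `G`-set over `X × X`. -/
def ofOrbit (X : FinGSet G) (O : PairOrbits X) : FinGSet G := ⟨O.orbit⟩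

def ofOrbitFst (X : FinGSet G) (O : PairOrbits X) : ofOrbit X O →[G] X where
  toFun u := u.1.1
  map_smul' _ _ := rfl

def ofOrbitSnd (X : FinGSet G) (O : PairOrbits X) : ofOrbit X O →[G] X where
  toFun u := u.1.2
  map_smul' _ _ := rfl

end FinGSet

/-! ### Permutation modules -/

section Permutation

variable (R : Type u) [CommRing R] {G : Type u} [Group G]

/-- The permutation representation `RX` of `G` on the free `R`-module with basis `X`. -/
abbrev permRep (X : FinGSet G) : Representation R G (MonoidAlgebra R X) :=
  Representation.ofMulAction R G X

/-- A representation is permutation projective (for `R = 𝒪` or `k`: a `p`-permutation module) if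
the corresponding `RG`-module is a direct summand of a permutation module `RX`, for some
finite `G`-set `X`. -/
def IsPermutationProjective {R} [CommRing R] {V : Type u} [AddCommGroup V] [Module R V]
    (ρ : Representation R G V) : Prop :=
  ∃ (X : FinGSet G) (i : ρ.asModule →ₗ[MonoidAlgebra R G] (permRep R X).asModule)
    (q : (permRep R X).asModule →ₗ[MonoidAlgebra R G] ρ.asModule), q ∘ₗ i = LinearMap.id

/-- The coefficient of the basis element `y` in `z · x ∈ RX`, for `z ∈ RG` and `x, y ∈ X`. -/
def permCoeff {R} [CommRing R] (z : MonoidAlgebra R G) (X : FinGSet G) (x y : X) : R :=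
  ((permRep R X).asAlgebraHom z (MonoidAlgebra.single x 1)).coeff y

/-- `f_* : RX → RY`, `x ↦ f(x)`. -/
def linPush {X Y : FinGSet G} (f : X →[G] Y) : MonoidAlgebra R X →ₗ[R] MonoidAlgebra R Y :=
  (MonoidAlgebra.coeffLinearEquiv R).symm.toLinearMap ∘ₗ Finsupp.lmapDomain R R f ∘ₗ
    (MonoidAlgebra.coeffLinearEquiv R).toLinearMap

/-- `f^* : RY → RX`, `∑ r_y y ↦ ∑ r_{f(x)} x`. -/
def linPull {X Y : FinGSet G} (f : X →[G] Y) : MonoidAlgebra R Y →ₗ[R] MonoidAlgebra R X where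
  toFun r := MonoidAlgebra.ofCoeff (Finsupp.equivFunOnFinite.symm fun x => r.coeff (f x))
  map_add' r s := by ext; simp
  map_smul' c r := by ext; simp

theorem permCoeff_smul_smul {R} [CommRing R] {z : MonoidAlgebra R G}
    (hz : z ∈ Subring.center (MonoidAlgebra R G)) (X : FinGSet G) (g : G) (x y : X) :
    permCoeff z X (g • x) (g • y) = permCoeff z X x y := by
  have h := congrArg (permRep R X).asAlgebraHom
    (Subring.mem_center_iff.mp hz (MonoidAlgebra.single g 1))
  rw [map_mul, map_mul, Representation.asAlgebraHom_single_one] at h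
  have h' := LinearMap.congr_fun h (MonoidAlgebra.single x 1)
  simp only [Module.End.mul_apply, Representation.ofMulAction_single] at h'
  unfold permCoeff
  rw [← h', Representation.ofMulAction_def]
  simp only [LinearMap.comp_apply, LinearEquiv.coe_coe, Finsupp.lmapDomain_apply]
  exact Finsupp.mapDomain_apply (MulAction.injective g) _ y

theorem linPush_linPull_orbit_coeff (X : FinGSet G) (O : X.PairOrbits) (x y : X)
    [Decidable ((x, y) ∈ O.orbit)] :
    (linPush R (X.ofOrbitSnd O) (linPull R (X.ofOrbitFst O) (MonoidAlgebra.single x 1))).coeff y =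
      if (x, y) ∈ O.orbit then 1 else 0 := by
  classical
  change Finsupp.mapDomain (X.ofOrbitSnd O) (Finsupp.equivFunOnFinite.symm fun u =>
    (MonoidAlgebra.single x (1 : R)).coeff (X.ofOrbitFst O u)) y = _
  have : Fintype (X.ofOrbit O) := Fintype.ofFinite _
  rw [Finsupp.mapDomain, Finsupp.sum_fintype _ _ (by simp), Finsupp.finsetSum_apply]
  simp only [Finsupp.equivFunOnFinite_symm_apply_apply, MonoidAlgebra.coeff_single,
    Finsupp.single_apply]
  split_ifs with h
  · rw [Finset.sum_eq_single (show X.ofOrbit O from ⟨(x, y), h⟩)]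
    · change (if y = y then (if x = x then (1 : R) else 0) else 0) = 1
      simp
    · rintro ⟨⟨a, b⟩, hu⟩ - hne
      by_cases ha : x = a
      · by_cases hb : b = y
        · subst ha hb; exact absurd rfl hne
        · exact if_neg hb
      · change (if b = y then (if x = a then (1 : R) else 0) else 0) = 0
        simp [ha]
    · intro hn
      exact absurd (Finset.mem_univ _) hn
  · refine Finset.sum_eq_zero ?_
    rintro ⟨⟨a, b⟩, hu⟩ -
    change (if b = y then (if x = a then (1 : R) else 0) else 0) = 0
    by_cases ha : x = a
    · by_cases hb : b = y
      · subst ha hb; exact absurd hu h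
      · simp [hb]
    · simp [ha]

/-- For central `z`, multiplication by `z` on `RX` is the linearization
`∑_O m_O · (pr₂)_* (pr₁)^*` of a linear combination of `G`-sets over `X × X`, namely of the orbits
`O` on `X × X`, with `m_O` the coefficient of `y` in `z · x` for `(x, y) ∈ O`. -/
theorem mul_eq_sum_orbits (z : MonoidAlgebra R G) (hz : z ∈ Subring.center (MonoidAlgebra R G))
    (X : FinGSet G) :
    (permRep R X).asAlgebraHom z = ∑ᶠ O : X.PairOrbits, permCoeff z X O.out.1 O.out.2 •
      (linPush R (X.ofOrbitSnd O) ∘ₗ linPull R (X.ofOrbitFst O)) := by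
  classical
  have : Fintype X.PairOrbits := Fintype.ofFinite _
  rw [finsum_eq_sum_of_fintype]
  refine MonoidAlgebra.lhom_ext' fun x => LinearMap.ext_ring ?_
  ext y
  simp only [LinearMap.comp_apply, MonoidAlgebra.lsingle_apply, LinearMap.sum_apply,
    LinearMap.smul_apply, MonoidAlgebra.coeff_sum, MonoidAlgebra.coeff_smul,
    Finsupp.finsetSum_apply, Finsupp.smul_apply, linPush_linPull_orbit_coeff]
  rw [Finset.sum_eq_single (Quotient.mk'' (x, y) : X.PairOrbits)]
  · rw [if_pos (by rw [MulAction.orbitRel.Quotient.orbit_mk]; exact MulAction.mem_orbit_self _),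
      smul_eq_mul, mul_one]
    have hout : (Quotient.mk'' (Quotient.mk'' (x, y) : X.PairOrbits).out : X.PairOrbits) =
      Quotient.mk'' (x, y) := Quotient.out_eq' _
    obtain ⟨g, hg⟩ := MulAction.orbitRel_apply.mp (Quotient.exact' hout)
    rw [← hg]
    exact (permCoeff_smul_smul hz X g x y).symm
  · intro O _ hO
    rw [if_neg, smul_zero]
    intro hmem
    exact hO (MulAction.orbitRel.Quotient.mem_orbit.mp hmem).symm
  · intro hn
    exact absurd (Finset.mem_univ _) hn

end Permutation

/-! ### Mackey functors in the sense of Dress -/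

/-- A Mackey functor for `G` over `R`: a bivariant functor `M = (M^*, M_*)` from finite `G`-sets to
`R`-modules that is additive on disjoint unions and satisfies the pullback axiom. -/
structure MackeyFunctor (R : Type u) [CommRing R] (G : Type u) [Group G] where
  obj : FinGSet G → ModuleCat.{u} R
  /-- The contravariant part `M^*`. -/
  contra {X Y : FinGSet G} (f : X →[G] Y) : obj Y →ₗ[R] obj X
  /-- The covariant part `M_*`. -/
  co {X Y : FinGSet G} (f : X →[G] Y) : obj X →ₗ[R] obj Y
  contra_id (X : FinGSet G) : contra (MulActionHom.id G (X := X)) = LinearMap.id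
  co_id (X : FinGSet G) : co (MulActionHom.id G (X := X)) = LinearMap.id
  contra_comp {X Y Z : FinGSet G} (f : X →[G] Y) (g : Y →[G] Z) :
    contra (g.comp f : X →[G] Z) = contra f ∘ₗ contra g
  co_comp {X Y Z : FinGSet G} (f : X →[G] Y) (g : Y →[G] Z) :
    co (g.comp f : X →[G] Z) = co g ∘ₗ co f
  /-- `M(X ⊔ Y) → M(X) ⊕ M(Y)` is an isomorphism. (By the pullback axiom its inverse is
  `(M_*(i_X), M_*(i_Y))`; the case of empty `X` and `Y` gives `M(∅) = 0`.) -/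
  additive (X Y : FinGSet G) :
    Function.Bijective ((contra (FinGSet.inl X Y)).prod (contra (FinGSet.inr X Y)))
  pullback {P X Y Z : FinGSet G} (a : P →[G] X) (b : P →[G] Y) (c : X →[G] Z) (d : Y →[G] Z) :
    FinGSet.IsPullbackSquare a b c d → contra d ∘ₗ co c = co b ∘ₗ contra a

namespace MackeyFunctor

variable {R : Type u} [CommRing R] {G : Type u} [Group G]

/-- `M` is cohomological: `t_K^H r_K^H = |H : K|` for all `K ≤ H ≤ G`, where `t_K^H` and `r_K^H`
are the covariant and the contravariant map induced by `G/K → G/H`. -/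
def IsCohomological [Finite G] (M : MackeyFunctor R G) : Prop :=
  ∀ (K H : Subgroup G) (h : K ≤ H) (m : M.obj (FinGSet.quot H)),
    M.co (FinGSet.proj h) (M.contra (FinGSet.proj h) m) = K.relIndex H • m

/-- Morphisms of Mackey functors. -/
structure Hom (M N : MackeyFunctor R G) where
  app (X : FinGSet G) : M.obj X →ₗ[R] N.obj X
  contra_comm {X Y : FinGSet G} (f : X →[G] Y) : app X ∘ₗ M.contra f = N.contra f ∘ₗ app Y
  co_comm {X Y : FinGSet G} (f : X →[G] Y) : app Y ∘ₗ M.co f = N.co f ∘ₗ app X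

/-- Monomorphisms, epimorphisms and isomorphisms of Mackey functors are detected pointwise. -/
def Hom.IsInjective {M N : MackeyFunctor R G} (f : Hom M N) : Prop :=
  ∀ X, Function.Injective (f.app X)

def Hom.IsSurjective {M N : MackeyFunctor R G} (f : Hom M N) : Prop :=
  ∀ X, Function.Surjective (f.app X)

def IsIsomorphic (M N : MackeyFunctor R G) : Prop :=
  ∃ f : Hom M N, f.IsInjective ∧ f.IsSurjective

/-- Subfunctors of a Mackey functor. (They are again Mackey functors, and are cohomological if the
Mackey functor is.) -/
structure Sub (M : MackeyFunctor R G) where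
  obj (X : FinGSet G) : Submodule R (M.obj X)
  contra_mem {X Y : FinGSet G} (f : X →[G] Y) (m) : m ∈ obj Y → M.contra f m ∈ obj X
  co_mem {X Y : FinGSet G} (f : X →[G] Y) (m) : m ∈ obj X → M.co f m ∈ obj Y

def IsZero (M : MackeyFunctor R G) : Prop := ∀ X, Subsingleton (M.obj X)

def IsSimple (M : MackeyFunctor R G) : Prop :=
  ¬ M.IsZero ∧ ∀ L : Sub M, (∀ X, L.obj X = ⊥) ∨ (∀ X, L.obj X = ⊤)

/-- `M` is nonzero, and not the direct sum of two nonzero subfunctors. -/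
def IsIndecomposable (M : MackeyFunctor R G) : Prop :=
  ¬ M.IsZero ∧ ∀ L₁ L₂ : Sub M, (∀ X, IsCompl (L₁.obj X) (L₂.obj X)) →
    (∀ X, L₁.obj X = ⊥) ∨ (∀ X, L₂.obj X = ⊥)

/-- `0 → S → M → T → 0` (with maps `i` and `q`) is a short exact sequence. -/
def IsShortExact {S M T : MackeyFunctor R G} (i : Hom S M) (q : Hom M T) : Prop :=
  i.IsInjective ∧ (∀ X, Function.Exact (i.app X) (q.app X)) ∧ q.IsSurjective

/-- The epimorphism `q : M → T` splits. -/
def Hom.Splits {M T : MackeyFunctor R G} (q : Hom M T) : Prop :=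
  ∃ s : Hom T M, ∀ X, q.app X ∘ₗ s.app X = LinearMap.id

/-- The representation of `G` on `M(G/1)`, where `x ∈ G` acts as `M^*(γ_x)`. -/
def evalOne [Finite G] (M : MackeyFunctor R G) :
    Representation R G (M.obj (FinGSet.quot (⊥ : Subgroup G))) where
  toFun x := M.contra (FinGSet.rightMul x)
  map_one' := by
    have : FinGSet.rightMul (1 : G) = MulActionHom.id G := by
      ext y
      induction y using QuotientGroup.induction_on with
      | H y => exact congrArg (QuotientGroup.mk (s := (⊥ : Subgroup G))) (mul_one y)
    rw [this, M.contra_id]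
    rfl
  map_mul' x y := by
    have : FinGSet.rightMul (x * y) = (FinGSet.rightMul y).comp (FinGSet.rightMul x) := by
      ext w
      induction w using QuotientGroup.induction_on with
      | H w => exact congrArg (QuotientGroup.mk (s := (⊥ : Subgroup G))) (mul_assoc w x y).symm
    rw [this, M.contra_comp]
    rfl

/-- The action `ρ(z)_M` on `M` of a central element `z ∈ Z(RG)`. If multiplication by `z` on `RX` is
the linearization of a linear combination `∑ r_i (X ←b_i U_i →a_i X)` of `G`-sets over `X × X`, then
`ρ(z)_M(X) = ∑ r_i M_*(b_i) M^*(a_i)`. For cohomological `M` this does not depend on the choice of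
the combination; here it is the one of `mul_eq_sum_orbits`. -/
def rho (M : MackeyFunctor R G) (z : MonoidAlgebra R G) (X : FinGSet G) : M.obj X →ₗ[R] M.obj X :=
  ∑ᶠ O : X.PairOrbits, permCoeff z X O.out.1 O.out.2 •
    (M.co (X.ofOrbitFst O) ∘ₗ M.contra (X.ofOrbitSnd O))

end MackeyFunctor

/-! ### Cohomological Mackey functors and their blocks -/

/-- Cohomological Mackey functors: the objects of `Comack_R(G)`, a full subcategory of the category
of Mackey functors. -/
structure CohomologicalMackeyFunctor (R : Type u) [CommRing R] (G : Type u) [Group G] [Finite G]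
    extends MackeyFunctor R G where
  cohomological : toMackeyFunctor.IsCohomological

namespace CohomologicalMackeyFunctor

variable {R : Type u} [CommRing R] {G : Type u} [Group G] [Finite G]

/-- `P` is a projective object of `Comack_R(G)`. -/
def IsProjective (P : CohomologicalMackeyFunctor R G) : Prop :=
  ∀ (M N : CohomologicalMackeyFunctor R G)
    (q : MackeyFunctor.Hom M.toMackeyFunctor N.toMackeyFunctor)
    (f : MackeyFunctor.Hom P.toMackeyFunctor N.toMackeyFunctor), q.IsSurjective →
    ∃ g : MackeyFunctor.Hom P.toMackeyFunctor M.toMackeyFunctor,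
      ∀ X, q.app X ∘ₗ g.app X = f.app X

/-- `M` lies in `Comack_R(b) = ρ(b) Comack_R(G)`, that is, `ρ(b)` is the identity on `M`. -/
def MemBlock (M : CohomologicalMackeyFunctor R G) (b : MonoidAlgebra R G) : Prop :=
  ∀ X, M.rho b X = LinearMap.id

/-- `S` is isomorphic to a subquotient of `M`, that is, to a quotient of a subfunctor. -/
def IsSubquotientOf (S M : CohomologicalMackeyFunctor R G) : Prop :=
  ∃ (L : CohomologicalMackeyFunctor R G)
    (i : MackeyFunctor.Hom L.toMackeyFunctor M.toMackeyFunctor)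
    (q : MackeyFunctor.Hom L.toMackeyFunctor S.toMackeyFunctor), i.IsInjective ∧ q.IsSurjective

end CohomologicalMackeyFunctor

/-- The simple cohomological Mackey functors. -/
def SimpleCohomologicalMackeyFunctor (R : Type u) [CommRing R] (G : Type u) [Group G] [Finite G] :
    Type (u + 1) :=
  {S : CohomologicalMackeyFunctor R G // S.IsSimple}

namespace SimpleCohomologicalMackeyFunctor

variable {R : Type u} [CommRing R] {G : Type u} [Group G] [Finite G]

/-- `S` and `T` are isomorphic, or there is a non-split short exact sequence `0 → S → M → T → 0`
of cohomological Mackey functors. -/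
def Adjacent (S T : SimpleCohomologicalMackeyFunctor R G) : Prop :=
  S.1.IsIsomorphic T.1.toMackeyFunctor ∨
    ∃ (M : CohomologicalMackeyFunctor R G)
      (i : MackeyFunctor.Hom S.1.toMackeyFunctor M.toMackeyFunctor)
      (q : MackeyFunctor.Hom M.toMackeyFunctor T.1.toMackeyFunctor),
      MackeyFunctor.IsShortExact i q ∧ ¬ q.Splits

end SimpleCohomologicalMackeyFunctor

/-- The blocks of `Comack_R(G)` in the sense of Thévenaz and Webb: the classes of simple
cohomological Mackey functors under the equivalence relation generated by isomorphism and by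
non-split extensions. -/
def ThevenazWebbBlock (R : Type u) [CommRing R] (G : Type u) [Group G] [Finite G] :
    Type (u + 1) :=
  Quotient (Relation.EqvGen.setoid
    (SimpleCohomologicalMackeyFunctor.Adjacent (R := R) (G := G)))

/-- The Thévenaz–Webb block of a simple cohomological Mackey functor. -/
def ThevenazWebbBlock.of {R : Type u} [CommRing R] {G : Type u} [Group G] [Finite G]
    (S : CohomologicalMackeyFunctor R G) (hS : S.IsSimple) : ThevenazWebbBlock R G :=
  Quotient.mk _ (⟨S, hS⟩ : SimpleCohomologicalMackeyFunctor R G)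

/-- `M` belongs to the Thévenaz–Webb block `B`: every simple subquotient of `M` lies in `B`. -/
def CohomologicalMackeyFunctor.MemThevenazWebbBlock {R : Type u} [CommRing R] {G : Type u}
    [Group G] [Finite G] (M : CohomologicalMackeyFunctor R G) (B : ThevenazWebbBlock R G) : Prop :=
  ∀ (S : CohomologicalMackeyFunctor R G) (hS : S.IsSimple), S.IsSubquotientOf M →
    ThevenazWebbBlock.of S hS = B

end

/-! The engine is Yoshida's theorem: a cohomological Mackey functor is the same thing as an
`R`-linear functor on the category of permutation `RG`-modules. Homomorphisms between `RZ` and `RX`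
are written as matrices constant on the orbits of `Z × X`. Such a matrix acts by `act : M(X) →
M(Z)`, and the cohomological relation turns matrix products into composites
(`IsCohomological.act_mul`). The functors `permFunctor R X` are then the representable ones, with a
Yoneda lemma (`IsCohomological.yoneda`). Moreover `rho z` is the action of the matrix of `z`, which
commutes with every invariant matrix, so a central `z` gives a natural endomorphism of every
cohomological functor.

For part (1), a nonzero projective `P` has a maximal subfunctor, because it embeds in a direct sum
of representable functors, each noetherian. If `P` is indecomposable, lifting along a representable
cover of the simple quotient and taking a Fitting idempotent in a finite algebra over the complete
ring `R` shows that `P` is a retract of some `permFunctor R X` (`IsProjective.exists_retraction`).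
Evaluation at `G/1` is full and faithful on representable functors, so `P(G/1)` is an indecomposable
summand of `RX`. There `rho b` is multiplication by `b` (`asAlgebraHom_evalOne`). Since `rho b` is
the identity or zero on `P`, its value at `G/1` decides which.

For part (2), a central idempotent acts on a simple functor as the identity or as zero, so each
simple functor lies in exactly one block of `RG`, and each block contains a simple functor. If a
central idempotent acts differently on the ends of an extension, it splits the extension, so a
Thévenaz–Webb block lies inside a single block of `RG`.

The converse needs central idempotents: for every predicate `p` on Thévenaz–Webb blocks there is a
central idempotent of `RG` acting as one on the simple functors satisfying `p` and as zero on the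
others (`exists_central_idempotent`). Modulo a power of the maximal ideal a representable functor
has finite length. Its subfunctor lattice is modular with covers coloured by `p`, and adjacent
covers of different colours can be exchanged because the corresponding extension splits; so it is
the direct sum of its two coloured parts (`exists_isCompl_coversBelow`). No nonzero morphism joins
parts of different colours, hence the projections are natural and compatible with reduction. By
completeness they have a limit, a natural idempotent endomorphism of all `RX`, and this is
multiplication by an element of `Z(RG)`. Primitivity of `b` then prevents two Thévenaz–Webb blocks
from lying in the same block.

For arbitrary `M`, a nonzero image of `rho (1 - b)` would have a simple subquotient, so membership
in a block can be tested on simple subquotients. -/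

noncomputable section

/-! ### Finite `G`-sets, orbits, and the operators `f_* f^*`. -/

namespace FinGSet

variable {G : Type u} [Group G]

/-- The product of two finite `G`-sets. -/
def prod (X Y : FinGSet G) : FinGSet G := ⟨X × Y⟩

def fst (X Y : FinGSet G) : prod X Y →[G] X where
  toFun := Prod.fst
  map_smul' _ _ := rfl

def snd (X Y : FinGSet G) : prod X Y →[G] Y where
  toFun := Prod.snd
  map_smul' _ _ := rfl

/-- The map to a product with given components. -/
def pair {U X Y : FinGSet G} (a : U →[G] X) (b : U →[G] Y) : U →[G] prod X Y where
  toFun u := (a u, b u)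
  map_smul' g u := by
    rw [map_smul, map_smul]
    rfl

/-- The map from a disjoint union with given components. -/
def desc {X Y V : FinGSet G} (a : X →[G] V) (b : Y →[G] V) : sum X Y →[G] V where
  toFun := Sum.elim a b
  map_smul' g u := by
    rcases u with u | u
    · exact map_smul a g u
    · exact map_smul b g u

/-- The set of orbits of a finite `G`-set. -/
abbrev Orbits (V : FinGSet G) : Type u := MulAction.orbitRel.Quotient G V

/-- The orbit of a point. -/
abbrev orbitOf (V : FinGSet G) (v : V) : Orbits V := Quotient.mk'' v

/-- An orbit as a `G`-set. -/
def orb (V : FinGSet G) (O : Orbits V) : FinGSet G := ⟨O.orbit⟩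

def inc (V : FinGSet G) (O : Orbits V) : orb V O →[G] V where
  toFun u := u.1
  map_smul' _ _ := rfl

theorem orbitOf_smul (V : FinGSet G) (g : G) (v : V) : V.orbitOf (g • v) = V.orbitOf v :=
  Quotient.sound' (MulAction.orbitRel_apply.mpr ⟨g, rfl⟩)

theorem orbitOf_eq_iff {V : FinGSet G} {v w : V} : V.orbitOf v = V.orbitOf w ↔ ∃ g : G, g • w = v := by
  rw [orbitOf, orbitOf, Quotient.eq'', MulAction.orbitRel_apply]
  rfl

/-- The map induced on orbits. -/
def mapOrbit {X Y : FinGSet G} (f : X →[G] Y) : Orbits X → Orbits Y :=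
  Quotient.map' f fun a b h => by
    obtain ⟨g, hg⟩ := MulAction.orbitRel_apply.mp h
    exact MulAction.orbitRel_apply.mpr ⟨g, by
      change g • f b = f a
      rw [← map_smul]; exact congrArg f hg⟩

theorem mapOrbit_orbitOf {X Y : FinGSet G} (f : X →[G] Y) (x : X) :
    mapOrbit f (X.orbitOf x) = Y.orbitOf (f x) := rfl

/-- The union of a set of orbits. -/
def part (V : FinGSet G) (F : Set (Orbits V)) : FinGSet G :=
  ⟨({ carrier := {v | V.orbitOf v ∈ F}
      smul_mem' := fun g v hv => by
        change V.orbitOf (g • v) ∈ F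
        rwa [orbitOf_smul] } : SubMulAction G V)⟩

def partInc (V : FinGSet G) (F : Set (Orbits V)) : part V F →[G] V where
  toFun u := u.1
  map_smul' _ _ := rfl

theorem inc_injective (V : FinGSet G) (O : Orbits V) : Function.Injective (inc V O) :=
  Subtype.val_injective

theorem partInc_injective (V : FinGSet G) (F : Set (Orbits V)) :
    Function.Injective (partInc V F) :=
  Subtype.val_injective

theorem mem_range_inc {V : FinGSet G} {O : Orbits V} {v : V} :
    v ∈ Set.range (inc V O) ↔ V.orbitOf v = O := by
  constructor
  · rintro ⟨u, rfl⟩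
    exact MulAction.orbitRel.Quotient.mem_orbit.mp u.2
  · intro h
    exact ⟨⟨v, MulAction.orbitRel.Quotient.mem_orbit.mpr h⟩, rfl⟩

theorem mem_range_partInc {V : FinGSet G} {F : Set (Orbits V)} {v : V} :
    v ∈ Set.range (partInc V F) ↔ V.orbitOf v ∈ F := by
  constructor
  · rintro ⟨u, rfl⟩
    exact u.2
  · intro h
    exact ⟨⟨v, h⟩, rfl⟩

theorem orbitOf_out (V : FinGSet G) (O : Orbits V) : V.orbitOf O.out = O :=
  Quotient.out_eq' O

/-- The inverse of a bijective map of `G`-sets. -/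
def inverse {X Y : FinGSet G} (f : X →[G] Y) (hf : Function.Bijective f) : Y →[G] X where
  toFun := (Equiv.ofBijective f hf).symm
  map_smul' g y := by
    apply hf.1
    change f ((Equiv.ofBijective f hf).symm (g • y)) = f (g • _)
    rw [map_smul f]
    exact ((Equiv.ofBijective f hf).apply_symm_apply _).trans
      (congrArg (g • ·) ((Equiv.ofBijective f hf).apply_symm_apply y).symm)

theorem apply_inverse {X Y : FinGSet G} (f : X →[G] Y) (hf : Function.Bijective f) (y : Y) :
    f (inverse f hf y) = y :=
  (Equiv.ofBijective f hf).apply_symm_apply y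

end FinGSet

namespace MackeyFunctor

open FinGSet

variable {R : Type u} [CommRing R] {G : Type u} [Group G] (M : MackeyFunctor R G)

/-- Injectivity of `f` means that the square formed by `f`, `f` and two identities is a pullback. -/
theorem contra_co_of_injective {X Y : FinGSet G} (f : X →[G] Y) (hf : Function.Injective f) :
    M.contra f ∘ₗ M.co f = LinearMap.id := by
  rw [M.pullback (MulActionHom.id G (X := X)) (MulActionHom.id G (X := X)) f f, M.contra_id, M.co_id]
  · rfl
  · exact ⟨fun _ => rfl, fun x y h => ⟨x, ⟨rfl, hf h⟩, fun z hz => hz.1⟩⟩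

theorem co_contra_of_bijective {X Y : FinGSet G} (f : X →[G] Y) (hf : Function.Bijective f) :
    M.co f ∘ₗ M.contra f = LinearMap.id := by
  have h : M.co f ∘ₗ M.co (inverse f hf) = LinearMap.id := by
    rw [← M.co_comp, ← M.co_id]
    congr 1
    ext y
    exact apply_inverse f hf y
  have h' : M.contra f = M.co (inverse f hf) := by
    rw [← LinearMap.comp_id (M.contra f), ← h, ← LinearMap.comp_assoc,
      M.contra_co_of_injective f hf.1, LinearMap.id_comp]
  rw [h', h]

/-- For an empty `X`, a Mackey functor vanishes at `X`. -/
theorem subsingleton_of_isEmpty (X : FinGSet G) [IsEmpty X] : Subsingleton (M.obj X) := by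
  have hb : Function.Bijective (inl X X) :=
    ⟨fun x => isEmptyElim x, fun y => by rcases y with y | y <;> exact isEmptyElim y⟩
  -- With `X` empty the two inclusions coincide, so the restrictions of one element hit only
  -- diagonal pairs, while additivity hits every pair.
  have he : inl X X = inr X X := by
    ext x
    exact isEmptyElim x
  refine ⟨fun a b => ?_⟩
  obtain ⟨c, hc⟩ := (M.additive X X).2 (a, b)
  have h1 := congrArg Prod.fst hc
  have h2 := congrArg Prod.snd hc
  simp only [LinearMap.prod_apply, Function.prod_apply] at h1 h2
  rw [← h1, ← h2, he]

/-- Maps with disjoint images have an empty pullback, here the least invariant subset of `X`, and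
`M` vanishes there. -/
theorem contra_co_of_disjoint {X Y V : FinGSet G} (f : X →[G] V) (g : Y →[G] V)
    (h : ∀ x y, f x ≠ g y) : M.contra g ∘ₗ M.co f = 0 := by
  let E : FinGSet G := ⟨(⊥ : SubMulAction G X)⟩
  have : IsEmpty E := ⟨fun e => e.2⟩
  let a : E →[G] X := ⟨fun e => isEmptyElim e, fun _ e => isEmptyElim e⟩
  let b : E →[G] Y := ⟨fun e => isEmptyElim e, fun _ e => isEmptyElim e⟩
  rw [M.pullback a b f g ⟨fun e => isEmptyElim e, fun x y hxy => absurd hxy (h x y)⟩]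
  have := M.subsingleton_of_isEmpty E
  ext m
  rw [LinearMap.comp_apply, Subsingleton.elim (M.contra a m) 0, map_zero]
  rfl

/-- The endomorphism `f_* f^*` of `M(V)`, for `f : X → V`. -/
def loop {X V : FinGSet G} (f : X →[G] V) : M.obj V →ₗ[R] M.obj V := M.co f ∘ₗ M.contra f

theorem loop_comp {X Y V : FinGSet G} (f : X →[G] Y) (g : Y →[G] V) :
    M.loop (g.comp f : X →[G] V) = M.co g ∘ₗ M.loop f ∘ₗ M.contra g := by
  rw [loop, M.co_comp, M.contra_comp]
  rfl

theorem loop_of_bijective {X V : FinGSet G} (f : X →[G] V) (hf : Function.Bijective f) :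
    M.loop f = LinearMap.id :=
  M.co_contra_of_bijective f hf

theorem loop_of_isEmpty {X V : FinGSet G} [IsEmpty X] (f : X →[G] V) : M.loop f = 0 := by
  have := M.subsingleton_of_isEmpty X
  ext m
  rw [loop, LinearMap.comp_apply, Subsingleton.elim (M.contra f m) 0, map_zero]
  rfl

theorem loop_inl_add_loop_inr (X Y : FinGSet G) :
    M.loop (inl X Y) + M.loop (inr X Y) = LinearMap.id := by
  refine LinearMap.ext fun m => (M.additive X Y).1 ?_
  have hl := LinearMap.congr_fun (M.contra_co_of_injective (inl X Y) Sum.inl_injective)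
  have hr := LinearMap.congr_fun (M.contra_co_of_injective (inr X Y) Sum.inr_injective)
  have hlr := LinearMap.congr_fun
    (M.contra_co_of_disjoint (inl X Y) (inr X Y) fun _ _ => Sum.inl_ne_inr)
  have hrl := LinearMap.congr_fun
    (M.contra_co_of_disjoint (inr X Y) (inl X Y) fun _ _ => Sum.inr_ne_inl)
  simp only [LinearMap.comp_apply, LinearMap.id_apply, LinearMap.zero_apply] at hl hr hlr hrl
  simp only [loop, LinearMap.add_apply, LinearMap.comp_apply, LinearMap.prod_apply,
    Function.prod_apply, map_add, hl, hr, hlr, hrl, LinearMap.id_apply, Prod.mk_add_mk, add_zero, zero_add]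

theorem loop_desc {X Y V : FinGSet G} (f : X →[G] V) (g : Y →[G] V) :
    M.loop (desc f g) = M.loop f + M.loop g := by
  have h1 : f = (desc f g).comp (inl X Y) := by ext; rfl
  have h2 : g = (desc f g).comp (inr X Y) := by ext; rfl
  have h1' := M.loop_comp (inl X Y) (desc f g)
  have h2' := M.loop_comp (inr X Y) (desc f g)
  rw [← h1] at h1'
  rw [← h2] at h2'
  rw [h1', h2', ← LinearMap.comp_add, ← LinearMap.add_comp, loop_inl_add_loop_inr]
  rfl

/-- Two injections with the same image differ by a bijection of their sources, and the loop of a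
bijection is the identity. -/
theorem loop_eq_of_range_eq {X Y V : FinGSet G} (f : X →[G] V) (g : Y →[G] V)
    (hf : Function.Injective f) (hg : Function.Injective g) (h : Set.range f = Set.range g) :
    M.loop f = M.loop g := by
  have hx : ∀ x, ∃ y, g y = f x := fun x => by
    have : f x ∈ Set.range g := h ▸ ⟨x, rfl⟩
    exact this
  choose k hk using hx
  let k' : X →[G] Y := ⟨k, fun c x => hg (by
    rw [hk, map_smul g, hk, map_smul f]
    rfl)⟩
  have hb : Function.Bijective k' := by
    refine ⟨fun a b hab => hf ?_, fun y => ?_⟩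
    · rw [← hk, ← hk]
      exact congrArg g hab
    · obtain ⟨x, hx⟩ : g y ∈ Set.range f := h ▸ ⟨y, rfl⟩
      exact ⟨x, hg ((hk x).trans hx)⟩
  have he : f = g.comp k' := by
    ext x
    exact (hk x).symm
  rw [he, loop_comp, loop_of_bijective M k' hb]
  rfl

/-- Orbits are split off one at a time with `loop_desc`. Allowing an arbitrary union of orbits keeps
the induction going, and also covers preimages of orbits later. -/
theorem loop_eq_sum_orbits {V : FinGSet G} (F : Finset (Orbits V)) :
    ∀ {X : FinGSet G} (f : X →[G] V), Function.Injective f →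
      (∀ v, v ∈ Set.range f ↔ V.orbitOf v ∈ F) → M.loop f = ∑ O ∈ F, M.loop (inc V O) := by
  classical
  induction F using Finset.induction_on with
  | empty =>
    intro X f _ h
    have : IsEmpty X := ⟨fun x => by simpa using (h (f x)).mp ⟨x, rfl⟩⟩
    rw [loop_of_isEmpty, Finset.sum_empty]
  | insert O F hO ih =>
    intro X f hf h
    have hdisj : ∀ u w, inc V O u ≠ partInc V F w := fun u w huw => by
      have h1 := (mem_range_inc (V := V)).mp ⟨u, rfl⟩
      have h2 := (mem_range_partInc (V := V)).mp ⟨w, rfl⟩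
      rw [← huw, h1] at h2
      exact hO h2
    rw [Finset.sum_insert hO, ← ih (partInc V F) (partInc_injective V F)
      fun v => by rw [mem_range_partInc]; rfl, ← loop_desc]
    refine M.loop_eq_of_range_eq _ _ hf ?_ ?_
    · exact Function.Injective.sumElim (inc_injective V O) (partInc_injective V F) hdisj
    · ext v
      have : Set.range (desc (inc V O) (partInc V F)) =
          Set.range (inc V O) ∪ Set.range (partInc V F) := Set.Sum.elim_range _ _
      rw [h, this, Set.mem_union, mem_range_inc, mem_range_partInc, Finset.mem_insert]
      rfl

end MackeyFunctor

end

/-! ### Orbit-constant coefficients and the cohomological relation for arbitrary maps. -/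

noncomputable section

namespace FinGSet

variable {G : Type u} [Group G]

instance instFintypeCarrier (X : FinGSet G) : Fintype X := Fintype.ofFinite X

instance instFintypeOrbits (X : FinGSet G) : Fintype (Orbits X) := Fintype.ofFinite _

/-- A function on a `G`-set that is constant on orbits. -/
def IsInvariant {A : Type*} {X : FinGSet G} (φ : X → A) : Prop := ∀ (g : G) (x : X), φ (g • x) = φ x

theorem IsInvariant.apply_out {A : Type*} {X : FinGSet G} {φ : X → A} (h : IsInvariant φ) (x : X) :
    φ (X.orbitOf x).out = φ x := by
  obtain ⟨g, hg⟩ := orbitOf_eq_iff.mp (X.orbitOf_out (X.orbitOf x))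
  rw [← hg, h]

theorem IsInvariant.comp {A : Type*} {X Y : FinGSet G} {φ : Y → A} (h : IsInvariant φ)
    (f : X →[G] Y) : IsInvariant fun x => φ (f x) := fun g x =>
  (congrArg φ (map_smul f g x)).trans (h g _)

open scoped Classical in
/-- Summation along the fibres of `f`. -/
def push {A : Type*} [AddCommMonoid A] {X Y : FinGSet G} (f : X →[G] Y) (ψ : X → A) (y : Y) : A :=
  ∑ x, if f x = y then ψ x else 0

/-- The stabilizer orbit map `G/K → U`. -/
def orbitMap [Finite G] {U : FinGSet G} (u : U) : quot (MulAction.stabilizer G u) →[G] U where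
  toFun := MulAction.ofQuotientStabilizer G u
  map_smul' g x := MulAction.ofQuotientStabilizer_smul G u g x

theorem orbitMap_injective [Finite G] {U : FinGSet G} (u : U) :
    Function.Injective (orbitMap u) :=
  MulAction.injective_ofQuotientStabilizer G u

theorem orbitMap_bijective [Finite G] {U : FinGSet G} [MulAction.IsPretransitive G U] (u : U) :
    Function.Bijective (orbitMap u) :=
  ⟨orbitMap_injective u, fun w => by
    obtain ⟨g, hg⟩ := MulAction.exists_smul_eq G u w
    exact ⟨(g : G ⧸ MulAction.stabilizer G u), hg⟩⟩

theorem stabilizer_le {U W : FinGSet G} (c : U →[G] W) (u : U) :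
    MulAction.stabilizer G u ≤ MulAction.stabilizer G (c u) := fun g hg => by
  rw [MulAction.mem_stabilizer_iff] at hg ⊢
  rw [← map_smul c, hg]

theorem comp_orbitMap [Finite G] {U W : FinGSet G} (c : U →[G] W) (u : U) :
    c.comp (orbitMap u) = (orbitMap (c u)).comp (proj (stabilizer_le c u)) := by
  ext x
  induction x using QuotientGroup.induction_on with
  | H g => exact map_smul c g u

/-- By transitivity all fibres have the same size, so `|U| = |W|` times that size; orbit–stabilizer
turns both cardinalities into indices, and `|W|` cancels. -/
theorem card_fibre [Finite G] {U W : FinGSet G} [MulAction.IsPretransitive G U]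
    [MulAction.IsPretransitive G W] (c : U →[G] W) (u : U) (w : W) :
    Nat.card {x : U // c x = w} =
      (MulAction.stabilizer G u).relIndex (MulAction.stabilizer G (c u)) := by
  have hcongr : ∀ w' : W, Nat.card {x : U // c x = w'} = Nat.card {x : U // c x = w} := fun w' => by
    obtain ⟨g, rfl⟩ := MulAction.exists_smul_eq G w w'
    refine (Nat.card_congr (Equiv.subtypeEquiv (MulAction.toPerm g) fun a => ?_)).symm
    rw [MulAction.toPerm_apply, map_smul c, smul_left_cancel_iff]
  have h1 : Nat.card U = Nat.card W * Nat.card {x : U // c x = w} := by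
    rw [← Nat.card_congr (Equiv.sigmaFiberEquiv c), Nat.card_sigma,
      Finset.sum_congr rfl fun w' _ => hcongr w', Finset.sum_const, Finset.card_univ,
      smul_eq_mul, ← Nat.card_eq_fintype_card]
  have h2 : ∀ {X : FinGSet G} [MulAction.IsPretransitive G X] (x : X),
      (MulAction.stabilizer G x).index = Nat.card X := fun x =>
    Nat.card_congr (Equiv.ofBijective _ (orbitMap_bijective x))
  have h3 := Subgroup.relIndex_mul_index (stabilizer_le c u)
  rw [h2, h2, h1, mul_comm] at h3
  have : Nonempty W := ⟨w⟩
  exact (Nat.eq_of_mul_eq_mul_left Nat.card_pos h3).symm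

end FinGSet

theorem LinearMap.comp_finsetSum {R A B C ι : Type*} [CommRing R] [AddCommGroup A] [AddCommGroup B]
    [AddCommGroup C] [Module R A] [Module R B] [Module R C] (g : B →ₗ[R] C) (s : Finset ι)
    (f : ι → A →ₗ[R] B) : g ∘ₗ ∑ i ∈ s, f i = ∑ i ∈ s, g ∘ₗ f i := by
  ext
  simp

theorem LinearMap.finsetSum_comp {R A B C ι : Type*} [CommRing R] [AddCommGroup A] [AddCommGroup B]
    [AddCommGroup C] [Module R A] [Module R B] [Module R C] (g : A →ₗ[R] B) (s : Finset ι)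
    (f : ι → B →ₗ[R] C) : (∑ i ∈ s, f i) ∘ₗ g = ∑ i ∈ s, f i ∘ₗ g := by
  ext
  simp

namespace MackeyFunctor

open FinGSet

variable {R : Type u} [CommRing R] {G : Type u} [Group G] (M : MackeyFunctor R G)

/-- The action on `M(V)` of a function that is constant on orbits. -/
def mulOp {V : FinGSet G} (φ : V → R) : M.obj V →ₗ[R] M.obj V :=
  ∑ O : Orbits V, φ O.out • M.loop (inc V O)

theorem mulOp_one {V : FinGSet G} : M.mulOp (fun _ : V => (1 : R)) = LinearMap.id := by
  have h := M.loop_eq_sum_orbits Finset.univ (MulActionHom.id G (X := V)) Function.injective_id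
    fun v => by simp
  rw [M.loop_of_bijective _ Function.bijective_id] at h
  rw [h, mulOp]
  exact Finset.sum_congr rfl fun O _ => one_smul _ _

section Preimage

variable {X V : FinGSet G} (f : X →[G] V) (O : Orbits V)

/-- The preimage of an orbit maps to the orbit. -/
def _root_.FinGSet.preimageMap : part X {O' | mapOrbit f O' = O} →[G] orb V O where
  toFun x := ⟨f x.1, MulAction.orbitRel.Quotient.mem_orbit.mpr x.2⟩
  map_smul' g x := Subtype.ext (map_smul f g x.1)

theorem _root_.FinGSet.preimage_square :
    (inc V O).comp (preimageMap f O) = f.comp (partInc X {O' | mapOrbit f O' = O}) := rfl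

open scoped Classical in
theorem loop_preimage : M.loop (partInc X {O' | mapOrbit f O' = O}) =
    ∑ O' with mapOrbit f O' = O, M.loop (inc X O') :=
  M.loop_eq_sum_orbits _ _ (partInc_injective _ _) fun v => by
    rw [mem_range_partInc, Finset.mem_filter]
    simp

/-- Base change: the pullback of `O → V` along `f` is the preimage of `O`, a union of orbits of `X`.
The next lemma is the covariant version. -/
theorem contra_loop_inc : M.contra f ∘ₗ M.loop (inc V O) =
    M.loop (partInc X {O' | mapOrbit f O' = O}) ∘ₗ M.contra f := by
  have h := M.pullback (preimageMap f O) (partInc X {O' | mapOrbit f O' = O}) (inc V O) f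
    ⟨fun _ => rfl, fun x y hxy => ⟨⟨y, by
      change mapOrbit f (X.orbitOf y) = O
      rw [mapOrbit_orbitOf, ← hxy]
      exact mem_range_inc.mp ⟨x, rfl⟩⟩, ⟨inc_injective V O hxy.symm, rfl⟩,
      fun z hz => Subtype.ext hz.2⟩⟩
  rw [loop, ← LinearMap.comp_assoc, h, LinearMap.comp_assoc, ← M.contra_comp, preimage_square,
    M.contra_comp]
  rfl

theorem loop_inc_co : M.loop (inc V O) ∘ₗ M.co f =
    M.co f ∘ₗ M.loop (partInc X {O' | mapOrbit f O' = O}) := by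
  have h := M.pullback (partInc X {O' | mapOrbit f O' = O}) (preimageMap f O) f (inc V O)
    ⟨fun _ => rfl, fun y x hxy => ⟨⟨y, by
      change mapOrbit f (X.orbitOf y) = O
      rw [mapOrbit_orbitOf, hxy]
      exact mem_range_inc.mp ⟨x, rfl⟩⟩, ⟨rfl, inc_injective V O hxy⟩,
      fun z hz => Subtype.ext hz.1⟩⟩
  rw [loop, LinearMap.comp_assoc, h, ← LinearMap.comp_assoc, ← M.co_comp, preimage_square,
    M.co_comp]
  rfl

theorem sum_smul_loop_preimage {φ : V → R} (hφ : IsInvariant φ) :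
    ∑ O : Orbits V, φ O.out • M.loop (partInc X {O' | mapOrbit f O' = O}) =
      M.mulOp fun x => φ (f x) := by
  classical
  simp only [loop_preimage, Finset.smul_sum]
  rw [mulOp, ← Finset.sum_fiberwise Finset.univ (mapOrbit f)]
  refine Finset.sum_congr rfl fun O _ => Finset.sum_congr (by congr) fun O' hO' => ?_
  rw [← (Finset.mem_filter.mp hO').2, ← X.orbitOf_out O', mapOrbit_orbitOf, hφ.apply_out,
    X.orbitOf_out]

/-- With `mulOp_co` this is the projection formula: invariant coefficients pass through restriction
and transfer. -/
theorem contra_mulOp {φ : V → R} (hφ : IsInvariant φ) :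
    M.contra f ∘ₗ M.mulOp φ = M.mulOp (fun x => φ (f x)) ∘ₗ M.contra f := by
  rw [← sum_smul_loop_preimage M f hφ, mulOp, LinearMap.comp_finsetSum, LinearMap.finsetSum_comp]
  refine Finset.sum_congr rfl fun O _ => ?_
  rw [LinearMap.comp_smul, contra_loop_inc, LinearMap.smul_comp]

theorem mulOp_co {φ : V → R} (hφ : IsInvariant φ) :
    M.mulOp φ ∘ₗ M.co f = M.co f ∘ₗ M.mulOp (fun x => φ (f x)) := by
  rw [← sum_smul_loop_preimage M f hφ, mulOp, LinearMap.comp_finsetSum, LinearMap.finsetSum_comp]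
  refine Finset.sum_congr rfl fun O _ => ?_
  rw [LinearMap.comp_smul, ← loop_inc_co, LinearMap.smul_comp]

end Preimage

variable {M} [Finite G]

/-- Orbit maps identify `c` with a projection `G/K → G/H` between stabilizers, for which the
relation is the definition. -/
theorem IsCohomological.loop_of_isPretransitive (hM : M.IsCohomological) {U W : FinGSet G}
    [MulAction.IsPretransitive G U] [MulAction.IsPretransitive G W] (c : U →[G] W) (u : U) :
    M.loop c = (MulAction.stabilizer G u).relIndex (MulAction.stabilizer G (c u)) •
      LinearMap.id := by
  have h := M.loop_comp (orbitMap u) c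
  rw [comp_orbitMap, loop_of_bijective M _ (orbitMap_bijective u), loop_comp] at h
  have h' : M.loop (proj (stabilizer_le c u)) =
      (MulAction.stabilizer G u).relIndex (MulAction.stabilizer G (c u)) • LinearMap.id := by
    ext m
    exact hM _ _ _ m
  rw [h'] at h
  have h'' : M.loop c = M.co c ∘ₗ LinearMap.id ∘ₗ M.contra c := rfl
  rw [h'', ← h, LinearMap.smul_comp, LinearMap.comp_smul, LinearMap.id_comp,
    M.co_contra_of_bijective _ (orbitMap_bijective (c u))]

/-- The restriction of a map to an orbit. -/
def _root_.FinGSet.orbMap {X V : FinGSet G} (f : X →[G] V) (O : Orbits X) :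
    orb X O →[G] orb V (mapOrbit f O) where
  toFun x := ⟨f x.1, MulAction.orbitRel.Quotient.mem_orbit.mpr
    (congrArg (mapOrbit f) (MulAction.orbitRel.Quotient.mem_orbit.mp x.2))⟩
  map_smul' g x := Subtype.ext (map_smul f g x.1)

instance _root_.FinGSet.isPretransitive_orb {X : FinGSet G} (O : Orbits X) :
    MulAction.IsPretransitive G (orb X O) :=
  inferInstanceAs (MulAction.IsPretransitive G O.orbit)

/-- A single index is both the scalar of the transfer on an orbit and the number of points of that
orbit over each point of its image. This coincidence is why transfer corresponds to summation along
fibres. -/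
theorem IsCohomological.loop_orbit (hM : M.IsCohomological) {X V : FinGSet G} (f : X →[G] V)
    (O : Orbits X) : ∃ n : ℕ, M.loop (f.comp (inc X O)) = n • M.loop (inc V (mapOrbit f O)) ∧
      ∀ v, V.orbitOf v = mapOrbit f O → Nat.card {x : X // X.orbitOf x = O ∧ f x = v} = n := by
  obtain ⟨u⟩ : Nonempty (orb X O) := (MulAction.orbitRel.Quotient.nonempty_orbit O).to_subtype
  refine ⟨(MulAction.stabilizer G u).relIndex (MulAction.stabilizer G (orbMap f O u)),
    ?_, fun v hv => ?_⟩
  rotate_left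
  · obtain ⟨w, hw⟩ := mem_range_inc.mpr hv
    rw [← card_fibre (orbMap f O) u w]
    exact Nat.card_congr
      { toFun := fun x => ⟨⟨x.1, MulAction.orbitRel.Quotient.mem_orbit.mpr x.2.1⟩,
          inc_injective _ _ (x.2.2.trans hw.symm)⟩
        invFun := fun x => ⟨x.1.1, MulAction.orbitRel.Quotient.mem_orbit.mp x.1.2,
          (congrArg Subtype.val x.2).trans hw⟩
        left_inv := fun _ => rfl
        right_inv := fun _ => rfl }
  · have : f.comp (inc X O) = (inc V (mapOrbit f O)).comp (orbMap f O) := rfl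
    rw [this, loop_comp, hM.loop_of_isPretransitive _ u, LinearMap.smul_comp, LinearMap.comp_smul,
      LinearMap.id_comp]
    rfl

/-- The cohomological condition, for an arbitrary map `f` and with coefficients. -/
theorem IsCohomological.co_mulOp_contra (hM : M.IsCohomological) {X V : FinGSet G} (f : X →[G] V)
    {ψ : X → R} (hψ : IsInvariant ψ) :
    M.co f ∘ₗ M.mulOp ψ ∘ₗ M.contra f = M.mulOp (push f ψ) := by
  classical
  choose n hn hn' using hM.loop_orbit f
  -- The fibre over `v` is grouped by orbits; an orbit `O'` lying over the orbit of `v` contributes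
  -- `n O'` equal terms.
  have hpush : ∀ v, push f ψ v =
      ∑ O' with mapOrbit f O' = V.orbitOf v, ψ O'.out * n O' := fun v => by
    rw [push, ← Finset.sum_fiberwise Finset.univ X.orbitOf, Finset.sum_filter]
    refine Finset.sum_congr rfl fun O' _ => ?_
    split_ifs with h
    · rw [← hn' O' v h.symm, Nat.card_eq_fintype_card, Fintype.card_subtype, mul_comm,
        ← nsmul_eq_mul, ← Finset.sum_const, ← Finset.filter_filter, Finset.sum_filter, Finset.sum_filter, Finset.sum_filter]
      refine Finset.sum_congr rfl fun x _ => ?_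
      by_cases hx : X.orbitOf x = O'
      · subst hx
        simp only [hψ.apply_out]
      · rw [if_neg hx, if_neg hx]
    · refine Finset.sum_eq_zero fun x hx => if_neg fun hv => h ?_
      rw [← (Finset.mem_filter.mp hx).2, ← hv]
      rfl
  have h1 : M.co f ∘ₗ M.mulOp ψ ∘ₗ M.contra f =
      ∑ O', (ψ O'.out * n O') • M.loop (inc V (mapOrbit f O')) := by
    rw [mulOp, LinearMap.finsetSum_comp, LinearMap.comp_finsetSum]
    refine Finset.sum_congr rfl fun O' _ => ?_
    rw [LinearMap.smul_comp, LinearMap.comp_smul, ← loop_comp, hn, mul_smul, Nat.cast_smul_eq_nsmul]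
  rw [h1, mulOp, ← Finset.sum_fiberwise Finset.univ (mapOrbit f)]
  refine Finset.sum_congr rfl fun O _ => ?_
  rw [hpush, V.orbitOf_out, Finset.sum_smul]
  refine Finset.sum_congr rfl fun O' hO' => ?_
  rw [(Finset.mem_filter.mp hO').2]

end MackeyFunctor

end

/-! ### Invariant matrices acting on cohomological Mackey functors. -/

noncomputable section

namespace FinGSet

variable {G : Type u} [Group G]

theorem sum_prod_carrier {A : Type*} [AddCommMonoid A] (X Y : FinGSet G) (f : prod X Y → A) :
    ∑ v, f v = ∑ x : X, ∑ y : Y, f (x, y) := by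
  rw [← Fintype.sum_prod_type']
  exact Finset.sum_congr (Finset.ext fun v => iff_of_true (Finset.mem_univ _)
    (@Finset.mem_univ _ (_) v))
    fun _ _ => rfl

/-- Matrices that are constant on the orbits of pairs. -/
def IsInvariantMatrix {A : Type*} {Z X : FinGSet G} (a : Matrix Z X A) : Prop :=
  ∀ (g : G) (z : Z) (x : X), a (g • z) (g • x) = a z x

theorem IsInvariantMatrix.isInvariant {A : Type*} {Z X : FinGSet G} {a : Matrix Z X A}
    (h : IsInvariantMatrix a) : IsInvariant fun v : prod Z X => a v.1 v.2 :=
  fun g v => h g v.1 v.2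

section

variable {R : Type*} [CommRing R]

theorem IsInvariantMatrix.mul {Z X Y : FinGSet G} {a : Matrix Z X R} {b : Matrix X Y R}
    (ha : IsInvariantMatrix a) (hb : IsInvariantMatrix b) : IsInvariantMatrix (a * b) :=
  fun g z y => by
    rw [Matrix.mul_apply, Matrix.mul_apply]
    refine (Fintype.sum_equiv (MulAction.toPerm g) _ _ fun x => ?_).symm
    rw [MulAction.toPerm_apply, ha, hb]

open scoped Classical in
/-- The matrix of a map, for the contravariant structure. -/
def contraMatrix (R : Type*) [CommRing R] {Z X : FinGSet G} (f : Z →[G] X) : Matrix Z X R :=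
  fun z x => if f z = x then 1 else 0

open scoped Classical in
/-- The matrix of a map, for the covariant structure. -/
def coMatrix (R : Type*) [CommRing R] {X Z : FinGSet G} (f : X →[G] Z) : Matrix Z X R :=
  fun z x => if f x = z then 1 else 0

open scoped Classical in
theorem isInvariantMatrix_contraMatrix {Z X : FinGSet G} (f : Z →[G] X) :
    IsInvariantMatrix (contraMatrix R f) := fun g z x =>
  if_congr (by rw [map_smul f, smul_left_cancel_iff]) rfl rfl

open scoped Classical in
theorem isInvariantMatrix_coMatrix {Z X : FinGSet G} (f : X →[G] Z) :
    IsInvariantMatrix (coMatrix R f) := fun g z x =>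
  if_congr (by rw [map_smul f, smul_left_cancel_iff]) rfl rfl

open scoped Classical in
theorem isInvariantMatrix_one (X : FinGSet G) : IsInvariantMatrix (1 : Matrix X X R) :=
  fun g z x => by simp only [Matrix.one_apply, smul_left_cancel_iff]

open scoped Classical in
theorem contraMatrix_id (X : FinGSet G) :
    contraMatrix R (MulActionHom.id G (X := X)) = 1 := rfl

theorem contraMatrix_mul_apply {Z X Y : FinGSet G} (f : Z →[G] X) (a : Matrix X Y R) (z : Z)
    (y : Y) : (contraMatrix R f * a) z y = a (f z) y := by
  classical
  simp [Matrix.mul_apply, contraMatrix]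

theorem coMatrix_mul_apply {Z X Y : FinGSet G} (f : X →[G] Z) (a : Matrix X Y R) (z : Z)
    (y : Y) : (coMatrix R f * a) z y = push f (fun x => a x y) z := by
  classical
  simp [Matrix.mul_apply, coMatrix, push]

end

end FinGSet

namespace MackeyFunctor

open FinGSet

variable {R : Type u} [CommRing R] {G : Type u} [Group G] (M : MackeyFunctor R G)

theorem mulOp_smul {V : FinGSet G} (r : R) (φ : V → R) :
    M.mulOp (fun v => r * φ v) = r • M.mulOp φ := by
  simp only [mulOp, Finset.smul_sum, mul_smul]

theorem mulOp_add {V : FinGSet G} (φ ψ : V → R) :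
    M.mulOp (fun v => φ v + ψ v) = M.mulOp φ + M.mulOp ψ := by
  simp only [mulOp, add_smul, Finset.sum_add_distrib]

theorem mulOp_mul {V : FinGSet G} {φ : V → R} (ψ : V → R) (hφ : IsInvariant φ) :
    M.mulOp φ ∘ₗ M.mulOp ψ = M.mulOp fun v => φ v * ψ v := by
  change M.mulOp φ ∘ₗ ∑ O : Orbits V, ψ O.out • M.loop (inc V O) =
    ∑ O : Orbits V, (φ O.out * ψ O.out) • M.loop (inc V O)
  rw [LinearMap.comp_finsetSum]
  refine Finset.sum_congr rfl fun O _ => ?_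
  have h : (fun x => φ (inc V O x)) = fun x => φ O.out * 1 := by
    ext x
    have hx := hφ.apply_out (inc V O x)
    rw [mem_range_inc.mp ⟨x, rfl⟩] at hx
    rw [mul_one, hx]
  rw [LinearMap.comp_smul, loop, ← LinearMap.comp_assoc, M.mulOp_co _ hφ, h, M.mulOp_smul,
    M.mulOp_one, LinearMap.comp_smul, LinearMap.comp_id, LinearMap.smul_comp, smul_smul, mul_comm]

/-- The action `M(X) → M(Z)` of an invariant matrix, i.e. of a homomorphism of permutation
modules. -/
def act {Z X : FinGSet G} (a : Matrix Z X R) : M.obj X →ₗ[R] M.obj Z :=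
  M.co (fst Z X) ∘ₗ M.mulOp (fun v : prod Z X => a v.1 v.2) ∘ₗ M.contra (snd Z X)

theorem act_add {Z X : FinGSet G} (a b : Matrix Z X R) : M.act (a + b) = M.act a + M.act b := by
  rw [act, act, act, ← LinearMap.comp_add, ← LinearMap.add_comp, ← mulOp_add]
  rfl

theorem act_smul {Z X : FinGSet G} (r : R) (a : Matrix Z X R) : M.act (r • a) = r • M.act a := by
  rw [act, act, ← LinearMap.comp_smul, ← LinearMap.smul_comp, ← mulOp_smul]
  rfl

theorem act_zero {Z X : FinGSet G} : M.act (0 : Matrix Z X R) = 0 := by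
  rw [← zero_smul R (0 : Matrix Z X R), act_smul, zero_smul]

theorem act_sub {Z X : FinGSet G} (a b : Matrix Z X R) : M.act (a - b) = M.act a - M.act b := by
  rw [eq_sub_iff_add_eq, ← act_add, sub_add_cancel]

theorem Hom.app_act {M N : MackeyFunctor R G} (f : Hom M N) {Z X : FinGSet G} (a : Matrix Z X R)
    (m : M.obj X) : f.app Z (M.act a m) = N.act a (f.app X m) := by
  have h1 : ∀ {X Y : FinGSet G} (k : X →[G] Y) (m), f.app Y (M.co k m) = N.co k (f.app X m) :=
    fun k => LinearMap.congr_fun (f.co_comm k)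
  have h2 : ∀ {X Y : FinGSet G} (k : X →[G] Y) (m),
      f.app X (M.contra k m) = N.contra k (f.app Y m) :=
    fun k => LinearMap.congr_fun (f.contra_comm k)
  simp only [act, mulOp, loop, LinearMap.comp_apply, h1, h2, LinearMap.sum_apply,
    LinearMap.smul_apply, map_sum, map_smul]

/-- The sum defining `rho` is the expansion of `mulOp` over the orbits of `X × X`. -/
theorem rho_eq_act (z : MonoidAlgebra R G) (X : FinGSet G) :
    M.rho z X = M.act (permCoeff z X) := by
  let _ : Fintype X.PairOrbits := inferInstanceAs (Fintype (Orbits (prod X X)))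
  rw [rho, finsum_eq_sum_of_fintype]
  change _ = M.co (fst X X) ∘ₗ (∑ O : Orbits (prod X X), permCoeff z X O.out.1 O.out.2 •
    M.loop (inc (prod X X) O)) ∘ₗ M.contra (snd X X)
  rw [LinearMap.finsetSum_comp, LinearMap.comp_finsetSum]
  refine Finset.sum_congr rfl fun O _ => ?_
  rw [LinearMap.smul_comp, LinearMap.comp_smul]
  have h1 : M.co (X.ofOrbitFst O) = M.co (fst X X) ∘ₗ M.co (inc (prod X X) O) :=
    M.co_comp (inc (prod X X) O) (fst X X)
  have h2 : M.contra (X.ofOrbitSnd O) = M.contra (inc (prod X X) O) ∘ₗ M.contra (snd X X) :=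
    M.contra_comp (inc (prod X X) O) (snd X X)
  rw [h1, h2]
  rfl

variable {M} [Finite G]

/-- The span factors through `pair f g : U → Z × X`, and the cohomological relation pushes the
weight `ψ` forward. Thus a weighted span acts only through its matrix, which is the independence of
choices in the definition of `rho`. -/
theorem IsCohomological.act_span (hM : M.IsCohomological) {U Z X : FinGSet G} (f : U →[G] Z)
    (g : U →[G] X) {ψ : U → R} (hψ : IsInvariant ψ) :
    M.co f ∘ₗ M.mulOp ψ ∘ₗ M.contra g = M.act fun z x => push (pair f g) ψ (z, x) := by
  have h1 : f = (fst Z X).comp (pair f g) := rfl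
  have h2 : g = (snd Z X).comp (pair f g) := rfl
  have h3 := M.co_comp (pair f g) (fst Z X)
  have h4 := M.contra_comp (pair f g) (snd Z X)
  rw [← h1] at h3
  rw [← h2] at h4
  rw [h3, h4]
  change _ = M.co (fst Z X) ∘ₗ M.mulOp (push (pair f g) ψ) ∘ₗ M.contra (snd Z X)
  rw [← hM.co_mulOp_contra (pair f g) hψ]
  rfl

/-- Composition of spans is a pullback over `X`, and pushing the product weight forward to `Z × Y`
sums over the middle variable, which is the matrix product. This is the substance of Yoshida's
theorem. -/
theorem IsCohomological.act_mul (hM : M.IsCohomological) {Z X Y : FinGSet G} {a : Matrix Z X R}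
    {b : Matrix X Y R} (ha : IsInvariantMatrix a) (hb : IsInvariantMatrix b) :
    M.act (a * b) = M.act a ∘ₗ M.act b := by
  classical
  -- `W` is the pullback of `Z × X` and `X × Y` over `X`, with projections `q` and `p`.
  let W := prod Z (prod X Y)
  let p : W →[G] prod X Y := snd _ _
  let q : W →[G] prod Z X := pair (fst _ _) ((fst X Y).comp (snd Z (prod X Y)))
  have hpb := M.pullback p q (fst X Y) (snd Z X) ⟨fun _ => rfl, fun v w h => by
    refine ⟨(w.1, v), ⟨rfl, Prod.ext rfl h⟩, fun t ht => ?_⟩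
    have h1 : (q t).1 = w.1 := congrArg Prod.fst ht.2
    have h2 : p t = v := ht.1
    exact Prod.ext h1 h2⟩
  have h := hM.act_span ((fst Z X).comp q) ((snd X Y).comp p)
    (ψ := fun w => a (q w).1 (q w).2 * b (p w).1 (p w).2)
    (fun g w => congrArg₂ (· * ·) (ha g w.1 w.2.1) (hb g w.2.1 w.2.2))
  have he : (a * b : Matrix Z Y R) = fun z y => push (pair ((fst Z X).comp q) ((snd X Y).comp p))
      (fun w => a (q w).1 (q w).2 * b (p w).1 (p w).2) (z, y) := by
    ext z y
    simp only [push]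
    rw [sum_prod_carrier]
    simp only [sum_prod_carrier]
    rw [Matrix.mul_apply, Finset.sum_eq_single z]
    · refine Finset.sum_congr rfl fun x _ => ?_
      rw [Finset.sum_eq_single y]
      · exact (if_pos rfl).symm
      · intro y' _ hy'
        exact if_neg fun h => hy' (congrArg Prod.snd h)
      · exact fun h => absurd (Finset.mem_univ _) h
    · intro z' _ hz'
      refine Finset.sum_eq_zero fun x _ => Finset.sum_eq_zero fun y' _ => ?_
      exact if_neg fun h => hz' (congrArg Prod.fst h)
    · exact fun h => absurd (Finset.mem_univ _) h
  rw [he, ← h, ← M.mulOp_mul (φ := fun w => a (q w).1 (q w).2) (fun w => b (p w).1 (p w).2)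
    (ha.isInvariant.comp q), M.co_comp, M.contra_comp, act, act]
  have h1 := M.mulOp_co q ha.isInvariant
  have h2 := M.contra_mulOp p hb.isInvariant
  -- The weights are moved outside `q_*` and `p^*` by the projection formula, after which `q_* p^*`
  -- is replaced using the pullback square.
  calc _ = M.co (fst Z X) ∘ₗ (M.co q ∘ₗ M.mulOp fun w => a (q w).1 (q w).2) ∘ₗ
        ((M.mulOp fun w => b (p w).1 (p w).2) ∘ₗ M.contra p) ∘ₗ M.contra (snd X Y) := rfl
    _ = M.co (fst Z X) ∘ₗ (M.mulOp fun v : prod Z X => a v.1 v.2) ∘ₗ (M.co q ∘ₗ M.contra p) ∘ₗ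
        (M.mulOp fun v : prod X Y => b v.1 v.2) ∘ₗ M.contra (snd X Y) := by
      rw [← h1, ← h2]
      rfl
    _ = _ := by
      rw [← hpb]
      rfl

theorem IsCohomological.contra_eq_act (hM : M.IsCohomological) {Z X : FinGSet G} (f : Z →[G] X) :
    M.contra f = M.act (contraMatrix R f) := by
  classical
  have h := hM.act_span (MulActionHom.id G (X := Z)) f (ψ := fun _ => (1 : R)) fun _ _ => rfl
  rw [M.mulOp_one, M.co_id, LinearMap.id_comp, LinearMap.id_comp] at h
  rw [h]
  congr 1
  ext z x
  simp only [push]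
  rw [Finset.sum_eq_single z]
  · simp only [contraMatrix]
    congr 1
    exact propext ⟨fun h => congrArg Prod.snd h, fun h => Prod.ext rfl h⟩
  · exact fun w _ hw => if_neg fun h => hw (congrArg Prod.fst h)
  · exact fun h => absurd (Finset.mem_univ _) h

theorem IsCohomological.co_eq_act (hM : M.IsCohomological) {X Z : FinGSet G} (f : X →[G] Z) :
    M.co f = M.act (coMatrix R f) := by
  classical
  have h := hM.act_span f (MulActionHom.id G (X := X)) (ψ := fun _ => (1 : R)) fun _ _ => rfl
  rw [M.mulOp_one, M.contra_id, LinearMap.comp_id] at h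
  change M.co f = _ at h
  rw [h]
  congr 1
  ext z x
  simp only [push]
  rw [Finset.sum_eq_single x]
  · simp only [coMatrix]
    congr 1
    exact propext ⟨fun h => congrArg Prod.fst h, fun h => Prod.ext h rfl⟩
  · exact fun w _ hw => if_neg fun h => hw (congrArg Prod.snd h)
  · exact fun h => absurd (Finset.mem_univ _) h

open scoped Classical in
theorem IsCohomological.act_one (hM : M.IsCohomological) (X : FinGSet G) :
    M.act (1 : Matrix X X R) = LinearMap.id := by
  rw [← contraMatrix_id, ← hM.contra_eq_act, M.contra_id]

end MackeyFunctor

end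

/-! ### Representable functors and the Yoneda lemma. -/

noncomputable section

namespace FinGSet

variable {G : Type u} [Group G]

/-- The module of invariant matrices, i.e. of homomorphisms of permutation modules. -/
def invMat (R : Type u) [CommRing R] (Z X : FinGSet G) : Submodule R (Matrix Z X R) where
  carrier := {a | IsInvariantMatrix a}
  add_mem' ha hb g z x := congrArg₂ (· + ·) (ha g z x) (hb g z x)
  zero_mem' _ _ _ := rfl
  smul_mem' r _ ha g z x := congrArg (r * ·) (ha g z x)

section Push

variable {A : Type*} [AddCommMonoid A] {X Y Z P : FinGSet G}

theorem push_eq_sum_filter (f : X →[G] Y) (ψ : X → A) (y : Y) [DecidablePred fun x => f x = y] :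
    push f ψ y = ∑ x with f x = y, ψ x := by
  rw [Finset.sum_filter, push]
  exact Finset.sum_congr rfl fun x _ => by congr

/-- In a pullback square `a` maps the fibre of `b` over `y` bijectively onto the fibre of `c` over
`d y`. -/
theorem push_pullback {a : P →[G] X} {b : P →[G] Y} {c : X →[G] Z} {d : Y →[G] Z}
    (h : IsPullbackSquare a b c d) (ψ : X → A) (y : Y) :
    push b (fun w => ψ (a w)) y = push c ψ (d y) := by
  classical
  rw [push_eq_sum_filter, push_eq_sum_filter]
  refine Finset.sum_bij (fun w _ => a w) ?_ ?_ ?_ fun _ _ => rfl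
  · intro w hw
    rw [Finset.mem_filter] at hw ⊢
    exact ⟨Finset.mem_univ _, by rw [h.1, hw.2]⟩
  · intro w hw w' hw' he
    have h1 := (Finset.mem_filter.mp hw).2
    have h2 := (Finset.mem_filter.mp hw').2
    exact (h.2 (a w) y (by rw [h.1, h1])).unique ⟨rfl, h1⟩ ⟨he.symm, h2⟩
  · intro x hx
    obtain ⟨w, hw, -⟩ := h.2 x y (Finset.mem_filter.mp hx).2
    exact ⟨w, Finset.mem_filter.mpr ⟨Finset.mem_univ _, hw.2⟩, hw.1⟩

theorem push_id (ψ : X → A) : push (MulActionHom.id G (X := X)) ψ = ψ := by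
  classical
  ext x
  rw [push, Finset.sum_eq_single x]
  · exact if_pos rfl
  · exact fun w _ hw => if_neg hw
  · exact fun h => absurd (Finset.mem_univ _) h

theorem push_comp (f : X →[G] Y) (g : Y →[G] Z) (ψ : X → A) :
    push (g.comp f) ψ = push g (push f ψ) := by
  classical
  ext z
  rw [push_eq_sum_filter, push_eq_sum_filter]
  simp only [push_eq_sum_filter f]
  rw [← Finset.sum_fiberwise_of_maps_to (g := f) (t := Finset.univ.filter fun y => g y = z)]
  · refine Finset.sum_congr rfl fun y hy => Finset.sum_congr ?_ fun _ _ => rfl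
    ext x
    simp only [Finset.mem_filter, Finset.mem_univ, true_and, and_iff_right_iff_imp]
    rintro rfl
    exact (Finset.mem_filter.mp hy).2
  · intro x hx
    exact Finset.mem_filter.mpr ⟨Finset.mem_univ _, (Finset.mem_filter.mp hx).2⟩

theorem push_smul_smul (f : X →[G] Y) (ψ ψ' : X → A) (g : G) (h : ∀ x, ψ (g • x) = ψ' x) (y : Y) :
    push f ψ (g • y) = push f ψ' y := by
  classical
  rw [push, push]
  refine (Fintype.sum_equiv (MulAction.toPerm g) _ _ fun x => ?_).symm
  rw [MulAction.toPerm_apply, h, map_smul f, smul_left_cancel_iff]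

theorem push_add (f : X →[G] Y) (ψ ψ' : X → A) (y : Y) :
    push f (fun x => ψ x + ψ' x) y = push f ψ y + push f ψ' y := by
  classical
  simp only [push_eq_sum_filter, Finset.sum_add_distrib]

theorem push_mul_left {R : Type*} [CommRing R] (f : X →[G] Y) (r : R) (ψ : X → R) (y : Y) :
    push f (fun x => r * ψ x) y = r * push f ψ y := by
  classical
  simp only [push_eq_sum_filter, Finset.mul_sum]

end Push

theorem card_fibre_proj [Finite G] {K H : Subgroup G} (h : K ≤ H) (y : quot H) :
    Nat.card {x : quot K // proj h x = y} = K.relIndex H := by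
  have : MulAction.IsPretransitive G (quot K) := MulAction.isPretransitive_quotient G K
  have : MulAction.IsPretransitive G (quot H) := MulAction.isPretransitive_quotient G H
  have := card_fibre (proj h) (QuotientGroup.mk 1 : G ⧸ K) y
  have hK : MulAction.stabilizer G (QuotientGroup.mk 1 : G ⧸ K) = K :=
    MulAction.stabilizer_quotient K
  have hH : MulAction.stabilizer G (QuotientGroup.mk 1 : G ⧸ H) = H :=
    MulAction.stabilizer_quotient H
  rw [this]
  exact congrArg₂ Subgroup.relIndex hK hH

end FinGSet

open FinGSet

variable {R : Type u} [CommRing R] {G : Type u} [Group G]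

/-- The Mackey functor `Hom_{RG}(R?, RX)`. -/
def permFunctor (R : Type u) [CommRing R] {G : Type u} [Group G] (X : FinGSet G) :
    MackeyFunctor R G where
  obj Z := ModuleCat.of R (invMat R Z X)
  contra {Z Z'} f :=
    { toFun := fun b => ⟨fun z x => b.1 (f z) x, fun g z x =>
        (congrArg (fun w => b.1 w (g • x)) (map_smul f g z)).trans (b.2 g (f z) x)⟩
      map_add' := fun _ _ => rfl
      map_smul' := fun _ _ => rfl }
  co {Z Z'} f :=
    { toFun := fun b => ⟨fun z x => push f (fun u => b.1 u x) z, fun g z x =>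
        push_smul_smul f _ _ g (fun u => b.2 g u x) z⟩
      map_add' := fun b c => Subtype.ext (by
        ext z x
        exact push_add f _ _ z)
      map_smul' := fun r b => Subtype.ext (by
        ext z x
        exact push_mul_left f r _ z) }
  contra_id _ := rfl
  co_id Z := LinearMap.ext fun b => Subtype.ext (by
    ext z x
    exact congrFun (push_id fun u => b.1 u x) z)
  contra_comp _ _ := rfl
  co_comp f g := LinearMap.ext fun b => Subtype.ext (by
    ext z x
    exact congrFun (push_comp f g fun u => b.1 u x) z)
  additive Z Z' := by
    constructor
    · intro b c h
      refine Subtype.ext ?_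
      ext z x
      rcases z with z | z
      · exact congrFun (congrFun (congrArg (fun t => t.1.1) h) z) x
      · exact congrFun (congrFun (congrArg (fun t => t.2.1) h) z) x
    · rintro ⟨b, c⟩
      refine ⟨⟨fun z x => Sum.elim (fun z => b.1 z x) (fun z => c.1 z x) z, ?_⟩, rfl⟩
      rintro g (z | z) x
      · exact b.2 g z x
      · exact c.2 g z x
  pullback a b c d h := LinearMap.ext fun m => Subtype.ext (by
    ext z x
    exact (push_pullback h (fun u => m.1 u x) z).symm)

namespace permFunctor

variable {X : FinGSet G}

/-- The matrix underlying an element of `Hom_{RG}(RZ, RX)`. -/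
def mat {Z : FinGSet G} : (permFunctor R X).obj Z →ₗ[R] Matrix Z X R := (invMat R Z X).subtype

theorem mat_isInvariant {Z : FinGSet G} (b : (permFunctor R X).obj Z) : IsInvariantMatrix (mat b) :=
  b.2

theorem mat_injective {Z : FinGSet G} :
    Function.Injective (mat : (permFunctor R X).obj Z →ₗ[R] Matrix Z X R) :=
  Subtype.val_injective

/-- The element of `Hom_{RG}(RZ, RX)` given by an invariant matrix. -/
def ofMat {Z : FinGSet G} (a : Matrix Z X R) (ha : IsInvariantMatrix a) :
    (permFunctor R X).obj Z :=
  (⟨a, ha⟩ : invMat R Z X)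

theorem mat_ofMat {Z : FinGSet G} (a : Matrix Z X R) (ha : IsInvariantMatrix a) :
    mat (ofMat a ha) = a := rfl

theorem contra_apply {Z Z' : FinGSet G} (f : Z →[G] Z') (b : (permFunctor R X).obj Z') (z : Z)
    (x : X) : mat ((permFunctor R X).contra f b) z x = mat b (f z) x := rfl

theorem mat_contra {Z Z' : FinGSet G} (f : Z →[G] Z') (b : (permFunctor R X).obj Z') :
    mat ((permFunctor R X).contra f b) = contraMatrix R f * mat b := by
  ext z x
  exact (contraMatrix_mul_apply f (mat b) z x).symm

theorem mat_co {Z Z' : FinGSet G} (f : Z →[G] Z') (b : (permFunctor R X).obj Z) :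
    mat ((permFunctor R X).co f b) = coMatrix R f * mat b := by
  ext z x
  exact (coMatrix_mul_apply f (mat b) z x).symm

open scoped Classical in
theorem loop_inc_apply {Z : FinGSet G} (O : Orbits Z) (b : (permFunctor R X).obj Z) (z : Z)
    (x : X) :
    mat ((permFunctor R X).loop (inc Z O) b) z x = if Z.orbitOf z = O then mat b z x else 0 := by
  change push (inc Z O) (fun u => mat b (inc Z O u) x) z = _
  split_ifs with h
  · obtain ⟨w, rfl⟩ := mem_range_inc.mpr h
    rw [push, Finset.sum_eq_single w]
    · exact if_pos rfl
    · exact fun u _ hu => if_neg fun he => hu (inc_injective Z O he)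
    · exact fun h => absurd (Finset.mem_univ _) h
  · exact Finset.sum_eq_zero fun u _ => if_neg fun he => h (mem_range_inc.mp ⟨u, he⟩)

theorem mulOp_apply {Z : FinGSet G} {φ : Z → R} (hφ : IsInvariant φ)
    (b : (permFunctor R X).obj Z) (z : Z) (x : X) :
    mat ((permFunctor R X).mulOp φ b) z x = φ z * mat b z x := by
  classical
  simp only [MackeyFunctor.mulOp, LinearMap.sum_apply, map_sum, Matrix.sum_apply,
    LinearMap.smul_apply, map_smul, Matrix.smul_apply, loop_inc_apply, smul_eq_mul]
  rw [Finset.sum_eq_single (Z.orbitOf z)]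
  · rw [if_pos rfl, hφ.apply_out]
  · intro O _ hO
    rw [if_neg (fun h => hO h.symm), mul_zero]
  · exact fun h => absurd (Finset.mem_univ _) h

theorem act_apply {Z Y : FinGSet G} {a : Matrix Z Y R} (ha : IsInvariantMatrix a)
    (b : (permFunctor R X).obj Y) : mat ((permFunctor R X).act a b) = a * mat b := by
  classical
  ext z x
  change push (fst Z Y) (fun v => mat ((permFunctor R X).mulOp (fun v : prod Z Y => a v.1 v.2)
    ((permFunctor R X).contra (snd Z Y) b)) v x) z = _
  simp only [mulOp_apply ha.isInvariant, push]
  rw [sum_prod_carrier, Matrix.mul_apply, Finset.sum_eq_single z]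
  · exact Finset.sum_congr rfl fun y _ => if_pos rfl
  · exact fun z' _ hz' => Finset.sum_eq_zero fun y _ => if_neg hz'
  · exact fun h => absurd (Finset.mem_univ _) h

theorem isCohomological [Finite G] : (permFunctor R X).IsCohomological := by
  classical
  intro K H h m
  refine mat_injective ?_
  ext y x
  change push (proj h) (fun u => mat m (proj h u) x) y = K.relIndex H • mat m y x
  rw [push_eq_sum_filter, Finset.sum_congr rfl (g := fun _ => mat m y x)
    (fun u hu => by rw [(Finset.mem_filter.mp hu).2]), Finset.sum_const, ← card_fibre_proj h y,
    Nat.card_eq_fintype_card, Fintype.card_subtype]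

open scoped Classical in
/-- The identity matrix, the universal element of a representable functor. -/
def one (R : Type u) [CommRing R] (X : FinGSet G) : (permFunctor R X).obj X :=
  ofMat 1 (isInvariantMatrix_one X)

open scoped Classical in
theorem mat_one (X : FinGSet G) : mat (one R X) = 1 := rfl

/-- Half of the Yoneda lemma: the identity matrix generates the representable functor, so a morphism
out of it is determined by the image of `one`. -/
theorem act_one {Z : FinGSet G} (b : (permFunctor R X).obj Z) :
    (permFunctor R X).act (mat b) (one R X) = b := by
  refine mat_injective ?_
  classical
  rw [permFunctor.act_apply (mat_isInvariant b), mat_one]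
  convert Matrix.mul_one _

end permFunctor

/-- The representable cohomological Mackey functor `Hom_{RG}(R?, RX)`. -/
def cohPerm (R : Type u) [CommRing R] {G : Type u} [Group G] [Finite G] (X : FinGSet G) :
    CohomologicalMackeyFunctor R G where
  toMackeyFunctor := permFunctor R X
  cohomological := permFunctor.isCohomological

namespace MackeyFunctor

theorem Hom.app_contra {M N : MackeyFunctor R G} (f : Hom M N) {X Y : FinGSet G} (k : X →[G] Y)
    (m : M.obj Y) : f.app X (M.contra k m) = N.contra k (f.app Y m) :=
  LinearMap.congr_fun (f.contra_comm k) m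

theorem Hom.app_co {M N : MackeyFunctor R G} (f : Hom M N) {X Y : FinGSet G} (k : X →[G] Y)
    (m : M.obj X) : f.app Y (M.co k m) = N.co k (f.app X m) :=
  LinearMap.congr_fun (f.co_comm k) m

/-- The identity morphism. -/
def Hom.id (M : MackeyFunctor R G) : Hom M M where
  app _ := LinearMap.id
  contra_comm _ := rfl
  co_comm _ := rfl

/-- Composition of morphisms, `g` after `f`. -/
def Hom.comp {L M N : MackeyFunctor R G} (g : Hom M N) (f : Hom L M) : Hom L N where
  app X := g.app X ∘ₗ f.app X
  contra_comm k := LinearMap.ext fun m => by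
    simp only [LinearMap.comp_apply, f.app_contra, g.app_contra]
  co_comm k := LinearMap.ext fun m => by
    simp only [LinearMap.comp_apply, f.app_co, g.app_co]

variable {M : MackeyFunctor R G}

open permFunctor

theorem Hom.app_permFunctor {X : FinGSet G} (f : Hom (permFunctor R X) M) {Z : FinGSet G}
    (b : (permFunctor R X).obj Z) : f.app Z b = M.act (mat b) (f.app X (one R X)) := by
  rw [← Hom.app_act, permFunctor.act_one]

variable [Finite G]

/-- The morphism from a representable functor given by an element. -/
def IsCohomological.yoneda (hM : M.IsCohomological) {X : FinGSet G} (m : M.obj X) :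
    Hom (permFunctor R X) M where
  app Z :=
    { toFun := fun b => M.act (mat b) m
      map_add' := fun b c => by rw [map_add, act_add, LinearMap.add_apply]
      map_smul' := fun r b => by rw [map_smul, act_smul, LinearMap.smul_apply, RingHom.id_apply] }
  contra_comm f := LinearMap.ext fun b => by
    change M.act (mat ((permFunctor R X).contra f b)) m = M.contra f (M.act (mat b) m)
    rw [mat_contra, hM.contra_eq_act, hM.act_mul (isInvariantMatrix_contraMatrix f) (mat_isInvariant b)]
    rfl
  co_comm f := LinearMap.ext fun b => by
    change M.act (mat ((permFunctor R X).co f b)) m = M.co f (M.act (mat b) m)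
    rw [mat_co, hM.co_eq_act, hM.act_mul (isInvariantMatrix_coMatrix f) (mat_isInvariant b)]
    rfl

theorem IsCohomological.yoneda_one (hM : M.IsCohomological) {X : FinGSet G} (m : M.obj X) :
    (hM.yoneda m).app X (one R X) = m :=
  LinearMap.congr_fun (hM.act_one X) m

end MackeyFunctor

end

noncomputable section

open FinGSet

variable {R : Type u} [CommRing R] {G : Type u} [Group G]

namespace MackeyFunctor

variable {M N K : MackeyFunctor R G}

/-! ### The lattice of subfunctors -/

namespace Sub

theorem obj_injective : Function.Injective (Sub.obj : Sub M → ∀ X, Submodule R (M.obj X)) := by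
  rintro ⟨a, _, _⟩ ⟨b, _, _⟩ h
  congr

instance : PartialOrder (Sub M) := PartialOrder.lift Sub.obj obj_injective

theorem le_iff {L L' : Sub M} : L ≤ L' ↔ ∀ X, ∀ m ∈ L.obj X, m ∈ L'.obj X := Iff.rfl

theorem ext' {L L' : Sub M} (h : ∀ X m, m ∈ L.obj X ↔ m ∈ L'.obj X) : L = L' :=
  le_antisymm (le_iff.mpr fun X m => (h X m).mp) (le_iff.mpr fun X m => (h X m).mpr)

instance : Lattice (Sub M) where
  sup L L' :=
    { obj := fun X => L.obj X ⊔ L'.obj X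
      contra_mem := fun f m hm => by
        obtain ⟨a, ha, b, hb, rfl⟩ := Submodule.mem_sup.mp hm
        rw [map_add]
        exact Submodule.add_mem_sup (L.contra_mem f a ha) (L'.contra_mem f b hb)
      co_mem := fun f m hm => by
        obtain ⟨a, ha, b, hb, rfl⟩ := Submodule.mem_sup.mp hm
        rw [map_add]
        exact Submodule.add_mem_sup (L.co_mem f a ha) (L'.co_mem f b hb) }
  inf L L' :=
    { obj := fun X => L.obj X ⊓ L'.obj X
      contra_mem := fun f m hm => ⟨L.contra_mem f m hm.1, L'.contra_mem f m hm.2⟩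
      co_mem := fun f m hm => ⟨L.co_mem f m hm.1, L'.co_mem f m hm.2⟩ }
  le_sup_left L L' := fun X => le_sup_left (a := L.obj X)
  le_sup_right L L' := fun X => le_sup_right (a := L.obj X)
  sup_le L L' L'' h h' := fun X => sup_le (h X) (h' X)
  inf_le_left L L' := fun X => inf_le_left (a := L.obj X)
  inf_le_right L L' := fun X => inf_le_right (a := L.obj X)
  le_inf L L' L'' h h' := fun X => le_inf (h X) (h' X)

instance : BoundedOrder (Sub M) where
  top := ⟨fun _ => ⊤, fun _ _ _ => trivial, fun _ _ _ => trivial⟩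
  bot := ⟨fun _ => ⊥, fun f m hm => by rw [(Submodule.mem_bot R).mp hm, map_zero]; exact zero_mem _,
    fun f m hm => by rw [(Submodule.mem_bot R).mp hm, map_zero]; exact zero_mem _⟩
  le_top L := fun X => le_top (a := L.obj X)
  bot_le L := fun X => bot_le (a := L.obj X)

theorem inf_obj (L L' : Sub M) (X : FinGSet G) : (L ⊓ L').obj X = L.obj X ⊓ L'.obj X := rfl
theorem mem_top {X : FinGSet G} (m : M.obj X) : m ∈ (⊤ : Sub M).obj X := trivial
theorem mem_bot {X : FinGSet G} {m : M.obj X} : m ∈ (⊥ : Sub M).obj X ↔ m = 0 :=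
  Submodule.mem_bot R

theorem eq_top_iff' {L : Sub M} : L = ⊤ ↔ ∀ X m, m ∈ L.obj X :=
  ⟨fun h X m => h ▸ mem_top m, fun h => ext' fun X m => iff_of_true (h X m) (mem_top m)⟩

theorem eq_bot_iff' {L : Sub M} : L = ⊥ ↔ ∀ X, ∀ m ∈ L.obj X, m = 0 :=
  ⟨fun h X m hm => mem_bot.mp (h ▸ hm), fun h => le_antisymm (fun X m hm => mem_bot.mpr (h X m hm))
    bot_le⟩

instance : IsModularLattice (Sub M) where
  sup_inf_le_assoc_of_le {L} L' L'' h := fun X => sup_inf_le_assoc_of_le (L'.obj X) (h X)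

theorem obj_eq_bot_iff {L : Sub M} : (∀ X, L.obj X = ⊥) ↔ L = ⊥ :=
  ⟨fun h => obj_injective (funext h), fun h X => h ▸ rfl⟩

theorem obj_eq_top_iff {L : Sub M} : (∀ X, L.obj X = ⊤) ↔ L = ⊤ :=
  ⟨fun h => obj_injective (funext h), fun h X => h ▸ rfl⟩

theorem isCompl_obj_iff {L L' : Sub M} : (∀ X, IsCompl (L.obj X) (L'.obj X)) ↔ IsCompl L L' := by
  simp only [isCompl_iff, disjoint_iff, codisjoint_iff, forall_and]
  exact and_congr (obj_eq_bot_iff (L := L ⊓ L')) (obj_eq_top_iff (L := L ⊔ L'))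

/-- Preimage of a subfunctor. -/
def comap (f : Hom M N) (L : Sub N) : Sub M where
  obj X := (L.obj X).comap (f.app X)
  contra_mem k m hm := by
    rw [Submodule.mem_comap, f.app_contra]
    exact L.contra_mem k _ hm
  co_mem k m hm := by
    rw [Submodule.mem_comap, f.app_co]
    exact L.co_mem k _ hm

/-- Image of a subfunctor. -/
def map (f : Hom M N) (L : Sub M) : Sub N where
  obj X := (L.obj X).map (f.app X)
  contra_mem k m hm := by
    obtain ⟨a, ha, rfl⟩ := hm
    exact ⟨_, L.contra_mem k a ha, f.app_contra k a⟩
  co_mem k m hm := by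
    obtain ⟨a, ha, rfl⟩ := hm
    exact ⟨_, L.co_mem k a ha, f.app_co k a⟩

theorem mem_comap {f : Hom M N} {L : Sub N} {X : FinGSet G} {m : M.obj X} :
    m ∈ (comap f L).obj X ↔ f.app X m ∈ L.obj X := Iff.rfl

theorem gc_map_comap (f : Hom M N) : GaloisConnection (map f) (comap f) := fun _ _ =>
  forall_congr' fun _ => Submodule.map_le_iff_le_comap

theorem map_comap_eq (f : Hom M N) (L : Sub N) : map f (comap f L) = map f ⊤ ⊓ L :=
  obj_injective (funext fun X => by
    rw [inf_obj]
    exact (Submodule.map_comap_eq (f.app X) (L.obj X)).trans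
      (congrArg (· ⊓ _) (LinearMap.range_eq_map (f.app X))))

theorem map_top_of_isSurjective {f : Hom M N} (hf : f.IsSurjective) : map f ⊤ = ⊤ :=
  eq_top_iff'.mpr fun X n => by
    obtain ⟨m, rfl⟩ := hf X n
    exact ⟨m, trivial, rfl⟩

end Sub

theorem Hom.isInjective_iff {f : Hom M N} : f.IsInjective ↔ Sub.comap f ⊥ = ⊥ := by
  rw [Sub.eq_bot_iff']
  exact forall_congr' fun X => injective_iff_map_eq_zero (f.app X)

theorem Hom.isSurjective_iff {f : Hom M N} : f.IsSurjective ↔ Sub.map f ⊤ = ⊤ := by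
  refine ⟨Sub.map_top_of_isSurjective, fun h X n => ?_⟩
  obtain ⟨m, -, hm⟩ := Sub.eq_top_iff'.mp h X n
  exact ⟨m, hm⟩

theorem isZero_iff : M.IsZero ↔ (⊤ : Sub M) = ⊥ := by
  rw [Sub.eq_bot_iff']
  exact ⟨fun h X m _ => (h X).elim _ _, fun h X => ⟨fun a b => (h X a trivial).trans (h X b trivial).symm⟩⟩

theorem isSimple_iff : M.IsSimple ↔ IsSimpleOrder (Sub M) := by
  rw [IsSimple, isZero_iff]
  simp only [Sub.obj_eq_bot_iff, Sub.obj_eq_top_iff]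
  constructor
  · rintro ⟨h1, h2⟩
    have : Nontrivial (Sub M) := ⟨⟨_, _, h1⟩⟩
    exact ⟨h2⟩
  · intro h
    exact ⟨top_ne_bot, h.eq_bot_or_eq_top⟩

theorem isIndecomposable_iff : M.IsIndecomposable ↔
    (⊤ : Sub M) ≠ ⊥ ∧ ∀ L L' : Sub M, IsCompl L L' → L = ⊥ ∨ L' = ⊥ := by
  rw [IsIndecomposable, isZero_iff]
  simp only [Sub.isCompl_obj_iff, Sub.obj_eq_bot_iff]

/-- Recovering an element from its two restrictions by transfers is what keeps subfunctors and
quotients additive. -/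
theorem loop_inl_add_loop_inr_apply (M : MackeyFunctor R G) {X Y : FinGSet G}
    (m : M.obj (sum X Y)) : M.co (inl X Y) (M.contra (inl X Y) m) +
      M.co (inr X Y) (M.contra (inr X Y) m) = m :=
  LinearMap.congr_fun (M.loop_inl_add_loop_inr X Y) m

/-! ### Subfunctors and quotients as functors -/

/-- A subfunctor as a Mackey functor. -/
def Sub.toFunctor (L : Sub M) : MackeyFunctor R G where
  obj X := ModuleCat.of R (L.obj X)
  contra f := (M.contra f).restrict (L.contra_mem f)
  co f := (M.co f).restrict (L.co_mem f)
  contra_id X := LinearMap.ext fun m => Subtype.ext (LinearMap.congr_fun (M.contra_id X) m.1)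
  co_id X := LinearMap.ext fun m => Subtype.ext (LinearMap.congr_fun (M.co_id X) m.1)
  contra_comp f g := LinearMap.ext fun m => Subtype.ext (LinearMap.congr_fun (M.contra_comp f g) m.1)
  co_comp f g := LinearMap.ext fun m => Subtype.ext (LinearMap.congr_fun (M.co_comp f g) m.1)
  additive X Y := by
    constructor
    · intro a b h
      refine Subtype.ext ((M.additive X Y).1 (Prod.ext ?_ ?_))
      · exact congrArg (fun t => t.1.1) h
      · exact congrArg (fun t => t.2.1) h
    · rintro ⟨⟨a, ha⟩, ⟨b, hb⟩⟩
      obtain ⟨m, hm⟩ := (M.additive X Y).2 (a, b)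
      have h1 : M.contra (inl X Y) m = a := congrArg Prod.fst hm
      have h2 : M.contra (inr X Y) m = b := congrArg Prod.snd hm
      refine ⟨⟨m, ?_⟩, Prod.ext (Subtype.ext h1) (Subtype.ext h2)⟩
      rw [← M.loop_inl_add_loop_inr_apply m, h1, h2]
      exact add_mem (L.co_mem _ _ ha) (L.co_mem _ _ hb)
  pullback a b c d h :=
    LinearMap.ext fun m => Subtype.ext (LinearMap.congr_fun (M.pullback a b c d h) m.1)

/-- The inclusion of a subfunctor. -/
def Sub.incl (L : Sub M) : Hom L.toFunctor M where
  app X := (L.obj X).subtype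
  contra_comm _ := rfl
  co_comm _ := rfl

theorem Sub.incl_isInjective (L : Sub M) : L.incl.IsInjective := fun _ => Subtype.val_injective

theorem Sub.map_incl_top (L : Sub M) : Sub.map L.incl ⊤ = L :=
  Sub.ext' fun _ m => ⟨fun ⟨a, _, h⟩ => h ▸ a.2, fun h => ⟨⟨m, h⟩, trivial, rfl⟩⟩

/-- The quotient of a Mackey functor by a subfunctor. -/
def quotient (M : MackeyFunctor R G) (L : Sub M) : MackeyFunctor R G where
  obj X := ModuleCat.of R (M.obj X ⧸ L.obj X)
  contra f := (L.obj _).mapQ (L.obj _) (M.contra f) (L.contra_mem f)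
  co f := (L.obj _).mapQ (L.obj _) (M.co f) (L.co_mem f)
  contra_id X := Submodule.linearMap_qext _ (LinearMap.ext fun m =>
    congrArg _ (LinearMap.congr_fun (M.contra_id X) m))
  co_id X := Submodule.linearMap_qext _ (LinearMap.ext fun m =>
    congrArg _ (LinearMap.congr_fun (M.co_id X) m))
  contra_comp f g := Submodule.linearMap_qext _ (LinearMap.ext fun m =>
    congrArg _ (LinearMap.congr_fun (M.contra_comp f g) m))
  co_comp f g := Submodule.linearMap_qext _ (LinearMap.ext fun m =>
    congrArg _ (LinearMap.congr_fun (M.co_comp f g) m))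
  additive X Y := by
    constructor
    · refine (injective_iff_map_eq_zero _).mpr fun m hm => ?_
      obtain ⟨m, rfl⟩ := Submodule.Quotient.mk_surjective _ m
      have h1 : M.contra (inl X Y) m ∈ L.obj X :=
        (Submodule.Quotient.mk_eq_zero _).mp (congrArg Prod.fst hm)
      have h2 : M.contra (inr X Y) m ∈ L.obj Y :=
        (Submodule.Quotient.mk_eq_zero _).mp (congrArg Prod.snd hm)
      refine (Submodule.Quotient.mk_eq_zero _).mpr ?_
      rw [← M.loop_inl_add_loop_inr_apply m]
      exact add_mem (L.co_mem _ _ h1) (L.co_mem _ _ h2)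
    · rintro ⟨a, b⟩
      obtain ⟨a, rfl⟩ := Submodule.Quotient.mk_surjective _ a
      obtain ⟨b, rfl⟩ := Submodule.Quotient.mk_surjective _ b
      obtain ⟨m, hm⟩ := (M.additive X Y).2 (a, b)
      have h1 : M.contra (inl X Y) m = a := congrArg Prod.fst hm
      have h2 : M.contra (inr X Y) m = b := congrArg Prod.snd hm
      exact ⟨Submodule.Quotient.mk m, Prod.ext (congrArg (Submodule.Quotient.mk (p := L.obj X)) h1)
        (congrArg (Submodule.Quotient.mk (p := L.obj Y)) h2)⟩
  pullback a b c d h := Submodule.linearMap_qext _ (LinearMap.ext fun m =>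
    congrArg _ (LinearMap.congr_fun (M.pullback a b c d h) m))

/-- The projection to a quotient. -/
def quotientMk (L : Sub M) : Hom M (M.quotient L) where
  app X := (L.obj X).mkQ
  contra_comm _ := rfl
  co_comm _ := rfl

theorem quotientMk_isSurjective (L : Sub M) : (quotientMk L).IsSurjective :=
  fun X => Submodule.mkQ_surjective (L.obj X)

theorem quotientMk_eq_zero {L : Sub M} {X : FinGSet G} {m : M.obj X} :
    (quotientMk L).app X m = 0 ↔ m ∈ L.obj X :=
  Submodule.Quotient.mk_eq_zero _

theorem comap_quotientMk_bot (L : Sub M) : Sub.comap (quotientMk L) ⊥ = L :=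
  Sub.ext' fun _ _ => (Sub.mem_bot).trans quotientMk_eq_zero

/-- A morphism that vanishes on the kernel of an epimorphism factors through it. -/
theorem Hom.exists_factor {q : Hom M N} (hq : q.IsSurjective) (f : Hom M K)
    (h : ∀ X m, q.app X m = 0 → f.app X m = 0) :
    ∃ g : Hom N K, ∀ X m, g.app X (q.app X m) = f.app X m := by
  have hex : ∀ X, ∃ g : N.obj X →ₗ[R] K.obj X, ∀ m, g (q.app X m) = f.app X m := fun X => by
    let e := (q.app X).quotKerEquivOfSurjective (hq X)
    refine ⟨(Submodule.liftQ (LinearMap.ker (q.app X)) (f.app X) fun m hm =>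
      h X m (LinearMap.mem_ker.mp hm)) ∘ₗ e.symm.toLinearMap, fun m => ?_⟩
    have : e.symm (q.app X m) = Submodule.Quotient.mk m := by
      rw [LinearEquiv.symm_apply_eq]
      rfl
    rw [LinearMap.comp_apply, LinearEquiv.coe_coe, this]
    rfl
  choose g hg using hex
  refine ⟨⟨g, fun {X Y} k => LinearMap.ext fun n => ?_, fun {X Y} k => LinearMap.ext fun n => ?_⟩,
    hg⟩
  · obtain ⟨m, rfl⟩ := hq Y n
    rw [LinearMap.comp_apply, LinearMap.comp_apply, ← q.app_contra, hg, hg, f.app_contra]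
  · obtain ⟨m, rfl⟩ := hq X n
    rw [LinearMap.comp_apply, LinearMap.comp_apply, ← q.app_co, hg, hg, f.app_co]

/-- A morphism into the image of a monomorphism lifts. -/
theorem Hom.exists_lift {i : Hom N M} (hi : i.IsInjective) (f : Hom K M)
    (h : ∀ X k, ∃ n, i.app X n = f.app X k) :
    ∃ g : Hom K N, ∀ X k, i.app X (g.app X k) = f.app X k := by
  choose g hg using h
  refine ⟨⟨fun X => ⟨⟨g X, fun a b => hi X ?_⟩, fun r a => hi X ?_⟩,
    fun {X Y} k => LinearMap.ext fun n => hi X ?_,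
    fun {X Y} k => LinearMap.ext fun n => hi Y ?_⟩, hg⟩
  · rw [hg, map_add, map_add, hg, hg]
  · simp only [RingHom.id_apply]
    rw [hg, map_smul, map_smul, hg]
  · change i.app X (g X _) = i.app X (N.contra k (g Y n))
    rw [hg, i.app_contra, hg, f.app_contra]
  · change i.app Y (g Y _) = i.app Y (N.co k (g X n))
    rw [hg, i.app_co, hg, f.app_co]

/-- Subfunctors of the quotient embed, by preimage, into the interval above `L`, which has only two
members when `L` is a coatom. -/
theorem isSimple_quotient {L : Sub M} (hL : IsCoatom L) : (M.quotient L).IsSimple := by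
  rw [isSimple_iff]
  have hmap : ∀ N : Sub (M.quotient L), Sub.map (quotientMk L) (Sub.comap (quotientMk L) N) = N :=
    fun N => by
      rw [Sub.map_comap_eq, Sub.map_top_of_isSurjective (quotientMk_isSurjective L), top_inf_eq]
  have hbot : Sub.map (quotientMk L) L = ⊥ :=
    le_bot_iff.mp ((Sub.gc_map_comap _ _ _).mpr (comap_quotientMk_bot L).ge)
  have hne : (⊤ : Sub (M.quotient L)) ≠ ⊥ := fun h => hL.1 (by
    rw [← comap_quotientMk_bot L, ← h]
    rfl)
  have : Nontrivial (Sub (M.quotient L)) := ⟨⟨_, _, hne⟩⟩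
  refine ⟨fun N => ?_⟩
  have hle : L ≤ Sub.comap (quotientMk L) N := by
    conv_lhs => rw [← comap_quotientMk_bot L]
    exact (Sub.gc_map_comap _).monotone_u bot_le
  rcases hle.eq_or_lt with h | h
  · left
    rw [← hmap N, ← h, hbot]
  · right
    rw [← hmap N, hL.2 _ h, Sub.map_top_of_isSurjective (quotientMk_isSurjective L)]

/-- A Mackey functor with finitely generated values. -/
class IsFiniteType (M : MackeyFunctor R G) : Prop where
  finite : ∀ X, Module.Finite R (M.obj X)

attribute [instance] IsFiniteType.finite

instance [IsNoetherianRing R] (X : FinGSet G) : IsFiniteType (permFunctor R X) where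
  finite Z := inferInstanceAs (Module.Finite R (invMat R Z X))

instance [IsFiniteType M] (L : Sub M) : IsFiniteType (M.quotient L) where
  finite X := inferInstanceAs (Module.Finite R (M.obj X ⧸ L.obj X))

theorem IsFiniteType.of_isSurjective [IsFiniteType M] {N : MackeyFunctor R G} {f : Hom M N}
    (hf : f.IsSurjective) : IsFiniteType N where
  finite X := Module.Finite.of_surjective (f.app X) (hf X)

end MackeyFunctor

namespace CohomologicalMackeyFunctor

open MackeyFunctor

variable [Finite G]

/-- A subfunctor as a cohomological Mackey functor. -/
def sub (M : CohomologicalMackeyFunctor R G) (L : Sub M.toMackeyFunctor) :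
    CohomologicalMackeyFunctor R G where
  toMackeyFunctor := L.toFunctor
  cohomological K H h m := Subtype.ext (M.cohomological K H h m.1)

/-- A quotient as a cohomological Mackey functor. -/
def quot (M : CohomologicalMackeyFunctor R G) (L : Sub M.toMackeyFunctor) :
    CohomologicalMackeyFunctor R G where
  toMackeyFunctor := M.quotient L
  cohomological K H h m := by
    obtain ⟨m, rfl⟩ := Submodule.Quotient.mk_surjective _ m
    exact congrArg Submodule.Quotient.mk (M.cohomological K H h m)

end CohomologicalMackeyFunctor

/-! ### The generating `G`-set -/

namespace FinGSet

variable [Finite G]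

/-- The disjoint union of all `G/H`. -/
def omega (G : Type u) [Group G] [Finite G] : FinGSet G where
  carrier := Σ H : Subgroup G, G ⧸ H

def omegaInc (H : Subgroup G) : quot H →[G] omega G where
  toFun x := ⟨H, x⟩
  map_smul' _ _ := rfl

theorem omegaInc_injective (H : Subgroup G) : Function.Injective (omegaInc H) := fun x y h => by
  have : (⟨H, x⟩ : Σ H : Subgroup G, G ⧸ H) = ⟨H, y⟩ := h
  exact eq_of_heq (Sigma.mk.inj_iff.mp this).2

end FinGSet

namespace MackeyFunctor

variable [Finite G] {M : MackeyFunctor R G}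

/-- Each `M(X)` is a sum of transfers from orbits, each orbit is some `G/H`, and `G/H` sits
injectively in `omega G`; so a subfunctor is determined by its value there. Chain conditions on
subfunctors reduce to chain conditions on one module. -/
theorem Sub.le_of_omega {L L' : Sub M} (h : L.obj (omega G) ≤ L'.obj (omega G)) : L ≤ L' := by
  intro X x hx
  have hid := LinearMap.congr_fun (M.mulOp_one (V := X)) x
  rw [LinearMap.id_apply] at hid
  rw [← hid, mulOp, LinearMap.sum_apply]
  refine Submodule.sum_mem _ fun O _ => ?_
  rw [one_smul]
  refine L'.co_mem _ _ ?_
  have hy := L.contra_mem (inc X O) x hx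
  set y := M.contra (inc X O) x
  obtain ⟨u⟩ : Nonempty (orb X O) := (MulAction.orbitRel.Quotient.nonempty_orbit O).to_subtype
  have hy' := LinearMap.congr_fun (M.co_contra_of_bijective _ (orbitMap_bijective u)) y
  rw [LinearMap.id_apply] at hy'
  rw [← hy']
  refine L'.co_mem _ _ ?_
  have hw := L.contra_mem (orbitMap u) y hy
  set w := M.contra (orbitMap u) y
  have hw' := LinearMap.congr_fun (M.contra_co_of_injective _
    (omegaInc_injective (MulAction.stabilizer G u))) w
  rw [LinearMap.id_apply] at hw'
  rw [← hw']
  exact L'.contra_mem _ _ (h (L.co_mem _ _ hw))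

theorem Sub.strictMono_omega : StrictMono fun L : Sub M => L.obj (omega G) := fun L L' h =>
  lt_of_le_of_ne (h.le _) fun he => h.not_ge (Sub.le_of_omega he.ge)

theorem Sub.wellFoundedGT [IsNoetherian R (M.obj (omega G))] : WellFoundedGT (Sub M) :=
  Sub.strictMono_omega.wellFoundedGT

theorem Sub.wellFoundedLT [IsArtinian R (M.obj (omega G))] : WellFoundedLT (Sub M) :=
  Sub.strictMono_omega.wellFoundedLT

instance [IsNoetherianRing R] [IsFiniteType M] : WellFoundedGT (Sub M) :=
  Sub.wellFoundedGT

end MackeyFunctor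

end

noncomputable section

open FinGSet

variable {R : Type u} [CommRing R] {G : Type u} [Group G]

/-! ### Matrices of elements of the group algebra on permutation modules -/

/-- The (transposed) matrix of an element of the group algebra acting on `RX`. -/
def permMatrix (z : MonoidAlgebra R G) (X : FinGSet G) : Matrix X X R := permCoeff z X

theorem permMatrix_add (z w : MonoidAlgebra R G) (X : FinGSet G) :
    permMatrix (z + w) X = permMatrix z X + permMatrix w X := by
  ext x y
  rw [Matrix.add_apply]
  simp [permMatrix, permCoeff]

theorem permMatrix_zero (X : FinGSet G) : permMatrix (0 : MonoidAlgebra R G) X = 0 := by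
  ext x y
  simp [permMatrix, permCoeff]

theorem permMatrix_sub (z w : MonoidAlgebra R G) (X : FinGSet G) :
    permMatrix (z - w) X = permMatrix z X - permMatrix w X := by
  rw [eq_sub_iff_add_eq, ← permMatrix_add, sub_add_cancel]

open scoped Classical in
theorem permMatrix_single (g : G) (r : R) (X : FinGSet G) (x y : X) :
    permMatrix (MonoidAlgebra.single g r) X x y = if g • x = y then r else 0 := by
  rw [permMatrix, permCoeff, Representation.asAlgebraHom_single, LinearMap.smul_apply,
    Representation.ofMulAction_single, MonoidAlgebra.coeff_smul, Finsupp.smul_apply,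
    MonoidAlgebra.coeff_single, Finsupp.single_apply]
  simp

open scoped Classical in
theorem permMatrix_one (X : FinGSet G) : permMatrix (1 : MonoidAlgebra R G) X = 1 := by
  ext x y
  rw [MonoidAlgebra.one_def, permMatrix_single, one_smul, Matrix.one_apply]

open scoped Classical in
theorem permMatrix_eq_sum [Fintype G] (z : MonoidAlgebra R G) (X : FinGSet G) (x y : X) :
    permMatrix z X x y = ∑ g : G, if g • x = y then z.coeff g else 0 := by
  induction z using MonoidAlgebra.induction_linear with
  | zero => rw [permMatrix_zero]; simp
  | add z w hz hw =>
    rw [permMatrix_add, Matrix.add_apply, hz, hw, ← Finset.sum_add_distrib]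
    refine Finset.sum_congr rfl fun g _ => ?_
    split_ifs <;> simp
  | single g r =>
    rw [permMatrix_single, Finset.sum_eq_single g]
    · simp
    · intro h _ hh
      simp [MonoidAlgebra.coeff_single, hh.symm]
    · exact fun h => absurd (Finset.mem_univ _) h

theorem isInvariantMatrix_permMatrix {z : MonoidAlgebra R G}
    (hz : z ∈ Subring.center (MonoidAlgebra R G)) (X : FinGSet G) :
    IsInvariantMatrix (permMatrix z X) := permCoeff_smul_smul hz X

/-- Equivariant maps commute with all of `RG`, so `z` need not be central: for a group element the
identity is the invariance of `b`, and both sides are additive in `z`. -/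
theorem permMatrix_mul_comm (z : MonoidAlgebra R G) {Z X : FinGSet G} {b : Matrix Z X R}
    (hb : IsInvariantMatrix b) :
    permMatrix z Z * b = b * permMatrix z X := by
  classical
  induction z using MonoidAlgebra.induction_linear with
  | zero => rw [permMatrix_zero, permMatrix_zero, Matrix.zero_mul, Matrix.mul_zero]
  | add z w hz hw => rw [permMatrix_add, permMatrix_add, Matrix.add_mul, Matrix.mul_add, hz, hw]
  | single g r =>
    ext u x
    simp only [Matrix.mul_apply, permMatrix_single, ite_mul, zero_mul, mul_ite, mul_zero,
      Finset.sum_ite_eq, Finset.mem_univ, if_true]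
    rw [Finset.sum_eq_single (g⁻¹ • x), if_pos (smul_inv_smul g x), ← hb g u, smul_inv_smul,
      mul_comm]
    · intro y _ hy
      rw [if_neg fun h => hy (by rw [← h, inv_smul_smul])]
    · exact fun h => absurd (Finset.mem_univ _) h

theorem coeff_asAlgebraHom_permRep (z : MonoidAlgebra R G) (X : FinGSet G) (f : MonoidAlgebra R X)
    (y : X) : ((permRep R X).asAlgebraHom z f).coeff y = ∑ x, f.coeff x * permMatrix z X x y := by
  classical
  induction f using MonoidAlgebra.induction_linear with
  | zero => simp
  | add f f' hf hf' =>
    rw [map_add, MonoidAlgebra.coeff_add, Finsupp.add_apply, hf, hf', ← Finset.sum_add_distrib]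
    exact Finset.sum_congr rfl fun x _ => by simp [add_mul]
  | single x r =>
    rw [Finset.sum_eq_single x]
    · have : (MonoidAlgebra.single x r : MonoidAlgebra R X) = r • MonoidAlgebra.single x 1 := by simp
      rw [this, map_smul]
      simp [permMatrix, permCoeff]
    · intro h _ hh
      simp [MonoidAlgebra.coeff_single, hh.symm]
    · exact fun h => absurd (Finset.mem_univ _) h

/-- The order is reversed because rows are indexed by the source of multiplication by `z`. -/
theorem permMatrix_mul (z w : MonoidAlgebra R G) (X : FinGSet G) :
    permMatrix (z * w) X = permMatrix w X * permMatrix z X := by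
  ext x y
  rw [permMatrix, permCoeff, map_mul, Module.End.mul_apply, coeff_asAlgebraHom_permRep, Matrix.mul_apply]
  rfl

theorem coeff_mul_comm_of_mem_center {z : MonoidAlgebra R G}
    (hz : z ∈ Subring.center (MonoidAlgebra R G)) (g h : G) :
    z.coeff (g * h) = z.coeff (h * g) := by
  have := congrArg (fun t => t.coeff h) (Subring.mem_center_iff.mp hz (MonoidAlgebra.single g⁻¹ 1))
  simpa using this

namespace MackeyFunctor

variable {M N : MackeyFunctor R G}

theorem rho_eq_act_permMatrix (z : MonoidAlgebra R G) (X : FinGSet G) :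
    M.rho z X = M.act (permMatrix z X) := M.rho_eq_act z X

theorem Hom.app_rho (f : Hom M N) (z : MonoidAlgebra R G) {X : FinGSet G} (m : M.obj X) :
    f.app X (M.rho z X m) = N.rho z X (f.app X m) := by
  rw [rho_eq_act_permMatrix, rho_eq_act_permMatrix, f.app_act]

theorem rho_add (z w : MonoidAlgebra R G) (X : FinGSet G) :
    M.rho (z + w) X = M.rho z X + M.rho w X := by
  rw [rho_eq_act_permMatrix, rho_eq_act_permMatrix, rho_eq_act_permMatrix, permMatrix_add, act_add]

theorem rho_sub (z w : MonoidAlgebra R G) (X : FinGSet G) :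
    M.rho (z - w) X = M.rho z X - M.rho w X := by
  rw [rho_eq_act_permMatrix, rho_eq_act_permMatrix, rho_eq_act_permMatrix, permMatrix_sub, act_sub]

theorem rho_zero (X : FinGSet G) : M.rho 0 X = 0 := by
  rw [rho_eq_act_permMatrix, permMatrix_zero, act_zero]

namespace IsCohomological

variable [Finite G] (hM : M.IsCohomological)

include hM

theorem rho_one (X : FinGSet G) : M.rho 1 X = LinearMap.id := by
  classical
  rw [rho_eq_act_permMatrix, permMatrix_one]
  convert hM.act_one X using 3

theorem rho_mul {z w : MonoidAlgebra R G} (hz : z ∈ Subring.center (MonoidAlgebra R G))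
    (hw : w ∈ Subring.center (MonoidAlgebra R G)) (X : FinGSet G) :
    M.rho (z * w) X = M.rho z X ∘ₗ M.rho w X := by
  rw [Subring.mem_center_iff.mp hw z, rho_eq_act_permMatrix, permMatrix_mul,
    hM.act_mul (isInvariantMatrix_permMatrix hz X) (isInvariantMatrix_permMatrix hw X), rho_eq_act_permMatrix,
    rho_eq_act_permMatrix]

/-- The action of a central element as an endomorphism. -/
def rhoHom {z : MonoidAlgebra R G} (hz : z ∈ Subring.center (MonoidAlgebra R G)) : Hom M M where
  app := M.rho z
  contra_comm {X Y} f := by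
    rw [rho_eq_act_permMatrix, rho_eq_act_permMatrix, hM.contra_eq_act,
      ← hM.act_mul (isInvariantMatrix_permMatrix hz X) (isInvariantMatrix_contraMatrix f),
      ← hM.act_mul (isInvariantMatrix_contraMatrix f) (isInvariantMatrix_permMatrix hz Y),
      permMatrix_mul_comm z (isInvariantMatrix_contraMatrix f)]
  co_comm {X Y} f := by
    rw [rho_eq_act_permMatrix, rho_eq_act_permMatrix, hM.co_eq_act,
      ← hM.act_mul (isInvariantMatrix_permMatrix hz Y) (isInvariantMatrix_coMatrix f),
      ← hM.act_mul (isInvariantMatrix_coMatrix f) (isInvariantMatrix_permMatrix hz X),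
      permMatrix_mul_comm z (isInvariantMatrix_coMatrix f)]

/-- The module structure on `M(G/1)` comes from right multiplications, while `rho` uses the left
action on `G/1`. In the row of `a'` the two agree after substituting `a' g a'⁻¹` for `g`, and the
coefficients of a central element are constant on conjugacy classes. -/
theorem asAlgebraHom_evalOne {z : MonoidAlgebra R G}
    (hz : z ∈ Subring.center (MonoidAlgebra R G)) :
    M.evalOne.asAlgebraHom z = M.rho z (quot ⊥) := by
  classical
  have := Fintype.ofFinite G
  have h : ∀ z : MonoidAlgebra R G, M.evalOne.asAlgebraHom z =
      M.act (∑ g : G, z.coeff g • contraMatrix R (rightMul g)) := fun z => by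
    induction z using MonoidAlgebra.induction_linear with
    | zero => simp [act_zero]
    | add z w hz hw =>
      rw [map_add, hz, hw, ← act_add, ← Finset.sum_add_distrib]
      congr 1
      exact Finset.sum_congr rfl fun g _ => by simp [add_smul]
    | single g r =>
      rw [Representation.asAlgebraHom_single, Finset.sum_eq_single g]
      · rw [MonoidAlgebra.coeff_single, Finsupp.single_eq_same, act_smul, ← hM.contra_eq_act]
        rfl
      · intro h _ hh
        simp [MonoidAlgebra.coeff_single, hh.symm]
      · exact fun h => absurd (Finset.mem_univ _) h
  rw [h, rho_eq_act_permMatrix]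
  congr 1
  ext a c
  obtain ⟨a', ha⟩ : ∃ a' : G, a = (QuotientGroup.mk a' : G ⧸ (⊥ : Subgroup G)) :=
    (QuotientGroup.mk_surjective a).imp fun _ h => h.symm
  rw [permMatrix_eq_sum, Matrix.sum_apply]
  refine Fintype.sum_equiv (MulAut.conj a').toEquiv _ _ fun g => ?_
  have h1 : (MulAut.conj a' g) • a = rightMul g a := by
    rw [ha]
    exact congrArg QuotientGroup.mk (show a' * g * a'⁻¹ * a' = a' * g by simp)
  have h2 : z.coeff (MulAut.conj a' g) = z.coeff g := by
    rw [MulAut.conj_apply, coeff_mul_comm_of_mem_center hz, ← mul_assoc, inv_mul_cancel, one_mul]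
  rw [Matrix.smul_apply, contraMatrix, smul_eq_mul, mul_ite, mul_one, mul_zero]
  exact if_congr (by rw [← h1]; rfl) h2.symm rfl

end IsCohomological

end MackeyFunctor

end

noncomputable section

/-! ### Finite algebras over a complete local ring -/

/-- Write each difference `f (k + 1) - f k` in a finite generating family with coefficients in `I ^
k`; the series of coefficients converge in `R`, and the limits assemble to a limit of `f`. -/
theorem IsPrecomplete.of_finite {R : Type*} [CommRing R] (I : Ideal R) [IsPrecomplete I R]
    (M : Type*) [AddCommGroup M] [Module R M] [Module.Finite R M] : IsPrecomplete I M := by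
  obtain ⟨n, v, hv⟩ := Module.Finite.exists_fin (R := R) (M := M)
  have hmem : ∀ k, ∀ x ∈ (I ^ k • ⊤ : Submodule R M), ∃ c : Fin n → R, (∀ i, c i ∈ I ^ k) ∧
      ∑ i, c i • v i = x := fun k x hx => by
    rw [← hv, Submodule.mem_ideal_smul_span_iff_exists_sum] at hx
    obtain ⟨c, hc, hx⟩ := hx
    exact ⟨c, hc, by rw [← hx, Finsupp.sum_fintype _ _ (by simp)]⟩
  refine ⟨fun f hf => ?_⟩
  have hstep : ∀ k, f (k + 1) - f k ∈ (I ^ k • ⊤ : Submodule R M) := fun k =>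
    (SModEq.sub_mem.mp (hf (Nat.le_succ k)).symm)
  choose c hc hsum using fun k => hmem k _ (hstep k)
  have hcauchy : ∀ i, ∃ L : R, ∀ k, (∑ j ∈ Finset.range k, c j i) ≡ L
      [SMOD (I ^ k • ⊤ : Submodule R R)] := fun i => by
    refine IsPrecomplete.prec' _ fun {m k} hmk => ?_
    rw [SModEq.comm, SModEq.sub_mem, ← Finset.sum_Ico_eq_sub _ hmk]
    refine Submodule.sum_mem _ fun j hj => ?_
    rw [smul_eq_mul, Ideal.mul_top]
    exact Ideal.pow_le_pow_right (Finset.mem_Ico.mp hj).1 (hc j i)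
  choose L hL using hcauchy
  refine ⟨f 0 + ∑ i, L i • v i, fun k => ?_⟩
  have hf' : f k = f 0 + ∑ i, (∑ j ∈ Finset.range k, c j i) • v i := by
    simp_rw [Finset.sum_smul]
    rw [Finset.sum_comm]
    simp_rw [hsum]
    rw [Finset.sum_range_sub]
    abel
  rw [SModEq.sub_mem, hf', add_sub_add_left_eq_sub, ← Finset.sum_sub_distrib]
  refine Submodule.sum_mem _ fun i _ => ?_
  rw [← sub_smul]
  have := SModEq.sub_mem.mp (hL i k)
  rw [smul_eq_mul, Ideal.mul_top] at this
  exact Submodule.smul_mem_smul this trivial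

section Fitting

open IsLocalRing Polynomial

variable {R : Type*} [CommRing R] [IsLocalRing R] [IsNoetherianRing R]
  [IsAdicComplete (maximalIdeal R) R]

theorem isAdicComplete_of_finite (M : Type*) [AddCommGroup M] [Module R M] [Module.Finite R M] :
    IsAdicComplete (maximalIdeal R) M where
  toIsHausdorff := inferInstance
  toIsPrecomplete := IsPrecomplete.of_finite _ M

/-- Lifting of idempotents: the Fitting idempotent of an element of a finite algebra. -/
theorem exists_fitting_idempotent_comm {B : Type*} [CommRing B] [Algebra R B] [Module.Finite R B]
    (a : B) : ∃ (b e : B) (n : ℕ), e = a * b ∧ e * e = e ∧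
      a ^ n * (1 - e) ∈ (maximalIdeal R • ⊤ : Submodule R B) := by
  set I : Ideal B := (maximalIdeal R).map (algebraMap R B) with hI
  have := isAdicComplete_of_finite (R := R) B
  have : IsAdicComplete I B := (IsAdicComplete.map_algebraMap_iff (maximalIdeal R) B).mpr this
  have hen : HenselianRing B I := inferInstance
  have : Module.Finite (R ⧸ maximalIdeal R) (B ⧸ I) := inferInstance
  let _ : Field (R ⧸ maximalIdeal R) := Ideal.Quotient.field _
  have : IsArtinianRing (B ⧸ I) := IsArtinianRing.of_finite (R ⧸ maximalIdeal R) (B ⧸ I)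
  -- `B ⧸ I` is artinian, so the ideals generated by the powers of `a` stabilize: `a ^ n = a ^ (n +
  -- 1) * y` modulo `I`.
  obtain ⟨n, y, hy⟩ := IsArtinian.exists_pow_succ_smul_dvd (Ideal.Quotient.mk I a) (1 : B ⧸ I)
  obtain ⟨y, rfl⟩ := Ideal.Quotient.mk_surjective y
  have hy1 : (Ideal.Quotient.mk I a) ^ (n + 1) =
      Ideal.Quotient.mk I a ^ (n + 1) * (Ideal.Quotient.mk I a * Ideal.Quotient.mk I y) := by
    have : (Ideal.Quotient.mk I a) ^ (n + 1) * Ideal.Quotient.mk I y = Ideal.Quotient.mk I a ^ n := by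
      simpa using hy
    calc _ = Ideal.Quotient.mk I a * Ideal.Quotient.mk I a ^ n := by ring
      _ = _ := by rw [← this]; ring
  have hy2 : ∀ k, (Ideal.Quotient.mk I a) ^ (n + 1) =
      Ideal.Quotient.mk I a ^ (n + 1) * (Ideal.Quotient.mk I a * Ideal.Quotient.mk I y) ^ k := by
    intro k
    induction k with
    | zero => simp
    | succ k ih => rw [pow_succ (_ * _) k, ← mul_assoc, ← ih, ← hy1]
  -- Modulo `I` the element `a y` fixes `a ^ (n + 1)`, and `e₀` is a multiple of `a ^ (n + 1)`;
  -- hence `e₀` is idempotent modulo `I`.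
  set e₀ : B := (a * y) ^ (n + 1) with he₀
  have h1 : a ^ (n + 1) * (1 - e₀) ∈ I := by
    rw [← Ideal.Quotient.eq_zero_iff_mem, map_mul, map_sub, he₀]
    simp only [map_pow, map_mul, map_one]
    rw [mul_sub, ← hy2, mul_one, sub_self]
  have h2 : e₀ ^ 2 - e₀ ∈ I := by
    have : e₀ ^ 2 - e₀ = -(y ^ (n + 1)) * (a ^ (n + 1) * (1 - e₀)) := by
      rw [he₀]
      ring
    rw [this]
    exact I.mul_mem_left _ h1
  -- Hensel's lemma for `X² - X`: the derivative `2 e₀ - 1` is its own inverse modulo `I`, because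
  -- its square is `1 + 4 (e₀² - e₀)`.
  obtain ⟨e, he, hee⟩ := hen.is_henselian (X ^ 2 - X) (by monicity!) e₀ (by simpa using h2) (by
    refine IsUnit.of_mul_eq_one (Ideal.Quotient.mk I (2 * e₀ - 1)) ?_
    have h3 : (Ideal.Quotient.mk I) (4 * (e₀ ^ 2 - e₀)) = 0 :=
      Ideal.Quotient.eq_zero_iff_mem.mpr (I.mul_mem_left _ h2)
    rw [← map_mul, ← sub_eq_zero, ← map_one (Ideal.Quotient.mk I), ← map_sub, ← h3]
    congr 1
    simp
    ring)
  have he : e * e = e := by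
    have : e ^ 2 - e = 0 := by simpa using he
    linear_combination this
  have hunit : IsUnit (1 - (e - e₀)) := by
    have := Ideal.mem_jacobson_bot.mp (hen.jac hee) (-1)
    rwa [mul_neg_one, neg_add_eq_sub] at this
  obtain ⟨v, hv⟩ := hunit.exists_right_inv
  -- The witness comes from `e = e (1 - (e - e₀)) v = e e₀ v`, in which `e₀` contains the factor
  -- `a`.
  refine ⟨a ^ n * y ^ (n + 1) * e * v, e, n + 1, ?_, he, ?_⟩
  · calc e = e * ((1 - (e - e₀)) * v) := by rw [hv, mul_one]
      _ = (e - e * e + e * e₀) * v := by ring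
      _ = _ := by rw [he, he₀]; ring
  · rw [Ideal.smul_top_eq_map, Submodule.restrictScalars_mem]
    have : a ^ (n + 1) * (1 - e) = a ^ (n + 1) * (1 - e₀) - a ^ (n + 1) * (e - e₀) := by ring
    rw [this]
    exact I.sub_mem h1 (I.mul_mem_left _ hee)

/-- Everything takes place in the commutative subalgebra generated by `a`, which is finite over the
noetherian ring `R`. -/
theorem exists_fitting_idempotent {A : Type*} [Ring A] [Algebra R A] [Module.Finite R A] (a : A) :
    ∃ (b e : A) (n : ℕ), e = a * b ∧ e = b * a ∧ e * e = e ∧ a * e = e * a ∧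
      a ^ n * (1 - e) ∈ (maximalIdeal R • ⊤ : Submodule R A) := by
  let S := Algebra.adjoin R {a}
  have := Algebra.isMulCommutative_adjoin R (s := {a}) (by simp)
  let _ : CommRing S := inferInstance
  have : Module.Finite R S := inferInstanceAs (Module.Finite R (Subalgebra.toSubmodule S))
  obtain ⟨b, e, n, h1, h2, h3⟩ := exists_fitting_idempotent_comm (R := R)
    (⟨a, Algebra.subset_adjoin rfl⟩ : S)
  refine ⟨b, e, n, congrArg Subtype.val h1, congrArg Subtype.val (h1.trans (mul_comm _ _)),
    congrArg Subtype.val h2, congrArg Subtype.val (mul_comm (⟨a, Algebra.subset_adjoin rfl⟩ : S) e), ?_⟩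
  have := Submodule.mem_map_of_mem (f := S.val.toLinearMap) h3
  rw [Submodule.map_smul''] at this
  exact Submodule.smul_mono le_rfl le_top this

end Fitting

/-- These properties treat both kinds of coefficient ring at once; for a field the maximal ideal is
zero and completeness is automatic. -/
theorem IsModularCoefficientRing.exists_isLocalRing {p : ℕ} {R : Type u} [CommRing R]
    (h : IsModularCoefficientRing p R) : ∃ _ : IsLocalRing R, IsNoetherianRing R ∧
      IsAdicComplete (IsLocalRing.maximalIdeal R) R := by
  rcases h with ⟨_, _, hc, -, -⟩ | ⟨hf, -⟩
  · exact ⟨inferInstance, inferInstance, hc⟩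
  · have hl : IsLocalRing R := by
      let _ := hf.toField
      infer_instance
    refine ⟨hl, ?_, ?_⟩
    · let _ := hf.toField
      infer_instance
    · rw [(IsLocalRing.isField_iff_maximalIdeal_eq).mp hf]
      infer_instance

/-! ### Coloured covers in modular lattices -/

section ColouredLattice

variable {α : Type*} [Lattice α]

/-- All covers below `x` satisfy `c`. -/
def CoversBelow (c : α → α → Prop) (x : α) : Prop := ∀ a b, a ⋖ b → b ≤ x → c a b

variable {c : α → α → Prop}

theorem CoversBelow.bot [BoundedOrder α] : CoversBelow c ⊥ := fun _ _ hab hb =>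
  absurd (hab.lt.trans_le hb) not_lt_bot

variable [IsModularLattice α]

theorem inf_covBy_of_covBy_sup' {a b d : α} (h : b ⋖ d) (hd : a ⊔ b = d) : a ⊓ b ⋖ a :=
  inf_covBy_of_covBy_sup_right (hd ▸ h)

/-- `h1` says that perspective covers have the same colour. By modularity a cover `p ⋖ r` below `z`
is perspective either to `x ⋖ z`, when `r ⊓ x ≤ p`, or else to a cover below `x`. -/
theorem CoversBelow.of_covBy (h1 : ∀ a b, a ⊓ b ⋖ a → (c (a ⊓ b) a ↔ c b (a ⊔ b))) {x z : α}
    (hx : CoversBelow c x) (hxz : x ⋖ z) (hc : c x z) : CoversBelow c z := by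
  intro p r hpr hrz
  by_cases hle : r ⊓ x ≤ p
  · have hi : r ⊓ (p ⊔ x) = p := by
      rw [inf_comm, sup_inf_assoc_of_le x hpr.le, inf_comm x, sup_eq_left.mpr hle]
    have hcov : r ⊓ (p ⊔ x) ⋖ r := by rwa [hi]
    have hiff := h1 r (p ⊔ x) hcov
    rw [hi] at hiff
    have hlt : p ⊔ x < r ⊔ (p ⊔ x) := by
      refine lt_of_le_of_ne le_sup_right fun he => hpr.lt.not_ge ?_
      have : r ≤ p ⊔ x := he ▸ le_sup_left
      rw [← hi]
      exact le_inf le_rfl this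
    have hle2 : r ⊔ (p ⊔ x) ≤ z := sup_le hrz (sup_le (hpr.le.trans hrz) hxz.le)
    have e1 : p ⊔ x = x := by
      rcases hxz.eq_or_eq le_sup_right (hlt.le.trans hle2) with h | h
      · exact h
      · exact absurd (h ▸ hlt) (not_lt_of_ge hle2)
    have e2 : r ⊔ (p ⊔ x) = z := by
      rcases hxz.eq_or_eq (le_sup_right.trans le_sup_right) hle2 with h | h
      · rw [h, e1] at hlt
        exact absurd hlt (lt_irrefl _)
      · exact h
    rw [hiff, e2, e1]
    exact hc
  · have hs : r ⊓ x ⊔ p = r := by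
      rcases hpr.eq_or_eq (le_sup_right (a := r ⊓ x)) (sup_le inf_le_left hpr.le) with h | h
      · exact absurd (h ▸ le_sup_left) hle
      · exact h
    have hcov := inf_covBy_of_covBy_sup' hpr hs
    have hiff := h1 (r ⊓ x) p hcov
    rw [hs] at hiff
    exact hiff.mp (hx _ _ hcov inf_le_right)

theorem exists_colour_complement [WellFoundedLT α] [WellFoundedGT α]
    (h1 : ∀ a b, a ⊓ b ⋖ a → (c (a ⊓ b) a ↔ c b (a ⊔ b)))
    (h2 : ∀ a b d, a ⋖ b → b ⋖ d → ¬ c a b → c b d → ∃ b', a ≤ b' ∧ b' ⊓ b = a ∧ b' ⊔ b = d)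
    {x y b d : α} (hy : CoversBelow (fun a b => ¬ c a b) y) (hxy : x ⊔ y = b)
    (hbd : b ⋖ d) (hc : c b d) : ∃ z, x ≤ z ∧ z ⊓ b = x ∧ z ⊔ b = d := by
  have hxb : x ≤ b := hxy ▸ le_sup_left
  obtain ⟨z, ⟨hxz, hzb⟩, hmin⟩ := wellFounded_lt.has_min {z | x ≤ z ∧ z ⊔ b = d}
    ⟨d, hxb.trans hbd.le, sup_eq_left.mpr hbd.le⟩
  refine ⟨z, hxz, ?_, hzb⟩
  by_contra hne
  set w := z ⊓ b with hw
  have hxw : x < w := lt_of_le_of_ne (le_inf hxz hxb) fun h => hne h.symm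
  obtain ⟨w', hxw', hw'⟩ := exists_le_covBy_of_lt hxw
  have hwz : w ⋖ z := inf_covBy_of_covBy_sup' hbd hzb
  have hcw : c w z := by
    have := h1 z b hwz
    rw [hzb] at this
    exact this.mpr hc
  -- The modular law, using `w ≤ b = x ⊔ y`. It makes the cover `w' ⋖ w` perspective to one below
  -- `y`.
  have e1 : x ⊔ w ⊓ y = w := by
    rw [inf_comm w, ← sup_inf_assoc_of_le y hxw.le, hxy, hw, inf_comm, inf_assoc, inf_idem]
  have e2 : w ⊓ y ⊔ w' = w := by
    refine le_antisymm (sup_le inf_le_left hw'.le) ?_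
    conv_lhs => rw [← e1]
    exact sup_le (hxw'.trans le_sup_right) le_sup_left
  have hcov := inf_covBy_of_covBy_sup' hw' e2
  have hncw : ¬ c w' w := by
    have := h1 (w ⊓ y) w' hcov
    rw [e2] at this
    rw [← this]
    exact hy _ _ hcov inf_le_right
  obtain ⟨z', hz1, hz2, hz3⟩ := h2 w' w z hw' hwz hncw hcw
  have hz'z : z' < z := by
    refine lt_of_le_of_ne (hz3 ▸ le_sup_left) fun h => ?_
    rw [h, inf_eq_right.mpr hwz.le] at hz2
    exact hw'.lt.ne' hz2
  refine hmin z' ⟨hxw'.trans hz1, ?_⟩ hz'z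
  rw [← hzb, ← hz3, sup_assoc, sup_eq_right.mpr (inf_le_right : w ≤ b)]

/-- A finite length modular lattice with a compatible `2`-colouring of its covers, such that
any two successive covers of different colours can be exchanged, is a direct product of its
coloured parts. -/
theorem exists_isCompl_coversBelow [BoundedOrder α] [WellFoundedLT α] [WellFoundedGT α]
    (h1 : ∀ a b, a ⊓ b ⋖ a → (c (a ⊓ b) a ↔ c b (a ⊔ b)))
    (h2 : ∀ a b d, a ⋖ b → b ⋖ d → ¬ (c a b ↔ c b d) → ∃ b', a ≤ b' ∧ b' ⊓ b = a ∧ b' ⊔ b = d) :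
    ∃ x y, IsCompl x y ∧ CoversBelow c x ∧ CoversBelow (fun a b => ¬ c a b) y := by
  suffices H : ∀ d : α, ∃ x y, x ⊓ y = ⊥ ∧ x ⊔ y = d ∧ CoversBelow c x ∧
      CoversBelow (fun a b => ¬ c a b) y by
    obtain ⟨x, y, hi, hs, hx, hy⟩ := H ⊤
    exact ⟨x, y, ⟨disjoint_iff.mpr hi, codisjoint_iff.mpr hs⟩, hx, hy⟩
  have h1' : ∀ a b, a ⊓ b ⋖ a → (¬ c (a ⊓ b) a ↔ ¬ c b (a ⊔ b)) := fun a b h => not_congr (h1 a b h)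
  -- Below a cover `b ⋖ d`, `b` is already split as `x ⊔ y`. The part having the colour of `b ⋖ d`
  -- is enlarged to an element `z` that meets `b` in that part and joins with `b` to `d`.
  intro d
  induction d using WellFoundedLT.induction with
  | ind d ih =>
  by_cases hd : d = ⊥
  · exact ⟨⊥, ⊥, by simp, by simp [hd], .bot, .bot⟩
  obtain ⟨b, -, hbd⟩ := exists_le_covBy_of_lt (bot_lt_iff_ne_bot.mpr hd)
  obtain ⟨x, y, hi, hs, hx, hy⟩ := ih b hbd.lt
  by_cases hc : c b d
  · obtain ⟨z, hxz, hzb, hzd⟩ := exists_colour_complement h1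
      (fun a b d hab hbd hn hc => h2 a b d hab hbd fun h => hn (h.mpr hc)) hy hs hbd hc
    have hcov : z ⊓ b ⋖ z := inf_covBy_of_covBy_sup' hbd hzd
    have hcz : c x z := by
      have := h1 z b hcov
      rw [hzb, hzd] at this
      exact this.mpr hc
    refine ⟨z, y, ?_, ?_, hx.of_covBy h1 (hzb ▸ hcov) hcz, hy⟩
    · rw [← hi, ← hzb, inf_assoc, inf_eq_right.mpr (hs ▸ le_sup_right : y ≤ b)]
    · rw [← hzd, ← hs, ← sup_assoc, sup_eq_left.mpr hxz]
  · obtain ⟨z, hyz, hzb, hzd⟩ := exists_colour_complement (c := fun a b => ¬ c a b) h1'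
      (fun a b d hab hbd hn hc => h2 a b d hab hbd fun h => hn fun h' => hc (h.mp h'))
      (x := y) (y := x) (fun a b hab hb h => h (hx a b hab hb)) ((sup_comm y x).trans hs) hbd hc
    have hcov : z ⊓ b ⋖ z := inf_covBy_of_covBy_sup' hbd hzd
    have hcz : ¬ c y z := by
      have := h1' z b hcov
      rw [hzb, hzd] at this
      exact this.mpr hc
    refine ⟨x, z, ?_, ?_, hx, hy.of_covBy h1' (hzb ▸ hcov) hcz⟩
    · rw [← hi, ← hzb, inf_comm z, ← inf_assoc, inf_eq_left.mpr (hs ▸ le_sup_left : x ≤ b)]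
    · rw [← hzd, ← hs, sup_comm x y, ← sup_assoc, sup_eq_left.mpr hyz, sup_comm]

end ColouredLattice

end

/-! ### Simple functors and the blocks of the group algebra. -/

noncomputable section

open FinGSet MackeyFunctor

variable {R : Type u} [CommRing R] {G : Type u} [Group G]

namespace MackeyFunctor

variable {M N : MackeyFunctor R G}

theorem exists_ne_zero_of_not_isZero (h : ¬ M.IsZero) : ∃ X, ∃ m : M.obj X, m ≠ 0 := by
  by_contra! h'
  exact h fun X => ⟨fun a b => (h' X a).trans (h' X b).symm⟩

/-- The subfunctor generated by `m` is the image of a Yoneda morphism, and representable functors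
have finitely generated values. -/
theorem IsCohomological.exists_isFiniteType_sub [Finite G] [IsNoetherianRing R] (hM : M.IsCohomological)
    {X : FinGSet G} (m : M.obj X) : ∃ L : Sub M, m ∈ L.obj X ∧ IsFiniteType L.toFunctor := by
  let L := Sub.map (hM.yoneda m) ⊤
  refine ⟨L, ⟨permFunctor.one R X, trivial, hM.yoneda_one m⟩, ?_⟩
  obtain ⟨g, hg⟩ := Hom.exists_lift L.incl_isInjective (hM.yoneda m)
    fun Z b => ⟨⟨_, ⟨b, trivial, rfl⟩⟩, rfl⟩
  refine IsFiniteType.of_isSurjective (f := g) fun Z n => ?_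
  obtain ⟨b, -, hb⟩ := n.2
  exact ⟨b, Subtype.ext ((hg Z b).trans hb)⟩

theorem IsSimple.hom_injective_or_zero {S : MackeyFunctor R G} (hS : S.IsSimple) (f : Hom S N) :
    f.IsInjective ∨ ∀ X m, f.app X m = 0 := by
  have := isSimple_iff.mp hS
  rcases eq_bot_or_eq_top (Sub.comap f ⊥) with h | h
  · exact Or.inl (Hom.isInjective_iff.mpr h)
  · exact Or.inr fun X m => Sub.mem_bot.mp (Sub.eq_top_iff'.mp h X m)

theorem IsSimple.hom_surjective_or_zero {S : MackeyFunctor R G} (hS : S.IsSimple) (f : Hom N S) :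
    f.IsSurjective ∨ ∀ X m, f.app X m = 0 := by
  have := isSimple_iff.mp hS
  rcases eq_bot_or_eq_top (Sub.map f ⊤) with h | h
  · exact Or.inr fun X m => Sub.eq_bot_iff'.mp h X _ ⟨m, trivial, rfl⟩
  · exact Or.inl (Hom.isSurjective_iff.mpr h)

/-- Schur: `rho e` is an idempotent endomorphism of a simple functor, so it is injective or zero,
and an injective idempotent is the identity. -/
theorem IsCohomological.rho_eq_id_or_zero [Finite G] {S : MackeyFunctor R G} (hc : S.IsCohomological)
    (hS : S.IsSimple) {e : MonoidAlgebra R G} (he : e ∈ Subring.center (MonoidAlgebra R G))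
    (hi : IsIdempotentElem e) :
    (∀ X, S.rho e X = LinearMap.id) ∨ ∀ X, S.rho e X = 0 := by
  rcases hS.hom_injective_or_zero (hc.rhoHom he) with h | h
  · refine Or.inl fun X => LinearMap.ext fun m => h X ?_
    have := LinearMap.congr_fun (hc.rho_mul he he X) m
    rw [hi.eq] at this
    exact this.symm
  · exact Or.inr fun X => LinearMap.ext (h X)

theorem IsSimple.rho_id_ne_zero {S : MackeyFunctor R G} (hS : S.IsSimple)
    {e : MonoidAlgebra R G} (h1 : ∀ X, S.rho e X = LinearMap.id) (h0 : ∀ X, S.rho e X = 0) :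
    False := by
  obtain ⟨X, m, hm⟩ := exists_ne_zero_of_not_isZero hS.1
  exact hm ((LinearMap.congr_fun (h1 X) m).symm.trans (LinearMap.congr_fun (h0 X) m))

end MackeyFunctor

theorem one_sub_mem_center {A : Type*} [Ring A] {e : A} (he : e ∈ Subring.center A) :
    1 - e ∈ Subring.center A := sub_mem (one_mem _) he

theorem mul_comm_of_mem_center {A : Type*} [Ring A] {e : A} (he : e ∈ Subring.center A) (a : A) :
    e * a = a * e := (Subring.mem_center_iff.mp he a).symm

theorem permMatrix_quot_bot [Finite G] (z : MonoidAlgebra R G) (g : G) :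
    permMatrix z (quot (⊥ : Subgroup G)) (QuotientGroup.mk 1 : G ⧸ (⊥ : Subgroup G))
      (QuotientGroup.mk g : G ⧸ (⊥ : Subgroup G)) = z.coeff g := by
  classical
  have := Fintype.ofFinite G
  refine (permMatrix_eq_sum z (FinGSet.quot ⊥) _ _).trans ?_
  rw [Finset.sum_eq_single g]
  · exact if_pos (congrArg QuotientGroup.mk (mul_one g))
  · intro h _ hh
    refine if_neg fun he => hh ?_
    have he' : (QuotientGroup.mk (h * 1) : G ⧸ (⊥ : Subgroup G)) = QuotientGroup.mk g := he
    rw [mul_one, QuotientGroup.eq, Subgroup.mem_bot, inv_mul_eq_one] at he'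
    exact he'
  · exact fun h => absurd (Finset.mem_univ _) h

namespace CohomologicalMackeyFunctor

variable [Finite G] {M N S T : CohomologicalMackeyFunctor R G} {b b' : MonoidAlgebra R G}

/-- A nonzero subfunctor of finite type satisfies the ascending chain condition, hence has a maximal
subfunctor. -/
theorem exists_simple_subquotient [IsNoetherianRing R] (h : ¬ M.IsZero) :
    ∃ S : CohomologicalMackeyFunctor R G, S.IsSimple ∧ S.IsSubquotientOf M := by
  obtain ⟨X, m, hm⟩ := exists_ne_zero_of_not_isZero h
  obtain ⟨L, hL, hfin⟩ := M.cohomological.exists_isFiniteType_sub m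
  have hne : (⊤ : Sub L.toFunctor) ≠ ⊥ := fun he =>
    hm (congrArg Subtype.val (Sub.eq_bot_iff'.mp he X ⟨m, hL⟩ trivial))
  obtain ⟨K, hK, -⟩ := (eq_top_or_exists_le_coatom (⊥ : Sub L.toFunctor)).resolve_left hne.symm
  exact ⟨(M.sub L).quot K, isSimple_quotient hK, M.sub L, L.incl, quotientMk K, L.incl_isInjective,
    quotientMk_isSurjective K⟩

theorem MemBlock.of_isInjective {f : Hom N.toMackeyFunctor M.toMackeyFunctor} (hf : f.IsInjective)
    (h : M.MemBlock b) : N.MemBlock b := fun X => LinearMap.ext fun n => hf X (by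
  rw [f.app_rho, h]
  rfl)

theorem MemBlock.of_isSurjective {f : Hom M.toMackeyFunctor N.toMackeyFunctor}
    (hf : f.IsSurjective) (h : M.MemBlock b) : N.MemBlock b := fun X => LinearMap.ext fun n => by
  obtain ⟨m, rfl⟩ := hf X n
  rw [← f.app_rho, h]
  rfl

theorem MemBlock.of_isSubquotientOf (h : M.MemBlock b) (hS : S.IsSubquotientOf M) :
    S.MemBlock b := by
  obtain ⟨L, i, q, hi, hq⟩ := hS
  exact (h.of_isInjective hi).of_isSurjective hq

theorem MemBlock.rho_one_sub (h : M.MemBlock b) (X : FinGSet G) : M.rho (1 - b) X = 0 := by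
  rw [rho_sub, M.cohomological.rho_one, h, sub_self]

/-- `b b'` acts as the identity on a nonzero functor, so it is not zero; primitivity applied to `b =
b b' + (b - b b')` gives `b = b b'`, and symmetry finishes. -/
theorem MemBlock.eq_of_isSimple (hS : S.IsSimple) (hb : IsBlockIdempotent b)
    (hb' : IsBlockIdempotent b') (h : S.MemBlock b) (h' : S.MemBlock b') : b = b' := by
  have key : ∀ {b b' : MonoidAlgebra R G}, IsBlockIdempotent b → IsBlockIdempotent b' →
      S.MemBlock b → S.MemBlock b' → b = b * b' := fun {b b'} hb hb' h h' => by
    have hcomm := mul_comm_of_mem_center hb.1 b'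
    have hc : IsIdempotentElem (b * b') := hb.2.1.mul_of_commute hcomm hb'.2.1
    have hbbb : b * (b * b') = b * b' := by rw [← mul_assoc, hb.2.1.eq]
    have hbbb' : b * b' * b = b * b' := by rw [mul_assoc, ← hcomm, hbbb]
    have hd : IsIdempotentElem (b - b * b') := by
      rw [IsIdempotentElem, sub_mul, mul_sub, mul_sub, hb.2.1.eq, hbbb, hbbb', hc.eq, sub_self,
        sub_zero]
    rcases hb.2.2.2 (b * b') (b - b * b') (mul_mem hb.1 hb'.1) (sub_mem hb.1 (mul_mem hb.1 hb'.1))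
      hc hd (by rw [mul_sub, hbbb', hc.eq, sub_self]) (by abel) with h0 | h0
    · exfalso
      refine hS.rho_id_ne_zero (e := b * b') (fun X => ?_) fun X => ?_
      · rw [S.cohomological.rho_mul hb.1 hb'.1, h, h', LinearMap.id_comp]
      · rw [h0, rho_zero]
    · exact sub_eq_zero.mp h0
  rw [key hb hb' h h', mul_comm_of_mem_center hb.1, ← key hb' hb h' h]

/-- Among the central idempotents acting as the identity on `S`, choose a minimal one. In any
splitting of it, one summand acts as the identity by Schur, so minimality kills the other. -/
theorem exists_memBlock_of_isSimple [IsNoetherianRing R] (hS : S.IsSimple) :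
    ∃ b : MonoidAlgebra R G, IsBlockIdempotent b ∧ S.MemBlock b := by
  have : Module.Finite R (MonoidAlgebra R G) :=
    Module.Finite.equiv (MonoidAlgebra.coeffLinearEquiv R).symm
  let E : Set (MonoidAlgebra R G) := {e | e ∈ Subring.center (MonoidAlgebra R G) ∧
    IsIdempotentElem e ∧ S.MemBlock e}
  -- Smaller idempotents have larger annihilators, so a minimal `e` is found by maximizing the
  -- kernel of left multiplication in the noetherian module `RG`.
  obtain ⟨_, ⟨e, he, rfl⟩, hmax⟩ := wellFounded_gt.has_min
    ((fun e : MonoidAlgebra R G => LinearMap.ker (LinearMap.mulLeft R e)) '' E)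
    ⟨_, 1, ⟨one_mem _, IsIdempotentElem.one, S.cohomological.rho_one⟩, rfl⟩
  have key : ∀ c d, c ∈ Subring.center (MonoidAlgebra R G) → IsIdempotentElem c → c * d = 0 →
      e = c + d → S.MemBlock c → d = 0 := fun c d hc hic hcd hecd hSc => by
    have hce : c * e = c := by rw [hecd, mul_add, hcd, hic.eq, add_zero]
    have hle : LinearMap.ker (LinearMap.mulLeft R e) ≤ LinearMap.ker (LinearMap.mulLeft R c) := by
      intro x hx
      rw [LinearMap.mem_ker, LinearMap.mulLeft_apply] at hx ⊢
      rw [← hce, mul_assoc, hx, mul_zero]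
    have heq := hle.eq_of_not_lt (hmax _ ⟨c, ⟨hc, hic, hSc⟩, rfl⟩)
    have hmem : 1 - c ∈ LinearMap.ker (LinearMap.mulLeft R c) := by
      rw [LinearMap.mem_ker, LinearMap.mulLeft_apply, mul_sub, mul_one, hic.eq, sub_self]
    rw [← heq, LinearMap.mem_ker, LinearMap.mulLeft_apply, mul_sub, mul_one, sub_eq_zero,
      ← mul_comm_of_mem_center hc, hce, hecd] at hmem
    simpa using hmem
  refine ⟨e, ⟨he.1, he.2.1, ?_, fun c d hc hd hic hid hcd hecd => ?_⟩, he.2.2⟩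
  · rintro rfl
    exact hS.rho_id_ne_zero he.2.2 rho_zero
  · rcases S.cohomological.rho_eq_id_or_zero hS hc hic with h | h
    · exact Or.inr (key c d hc hic hcd hecd h)
    · refine Or.inl (key d c hd hid ?_ (hecd.trans (add_comm c d)) fun X => ?_)
      · rw [mul_comm_of_mem_center hd, hcd]
      · have := he.2.2 X
        rwa [hecd, rho_add, h, zero_add] at this

/-- The image of `rho b` on the representable functor of `G/1` lies in the block, and it is nonzero
because the matrix of `b` on `G/1` contains the coefficients of `b`. -/
theorem exists_isSimple_memBlock [IsNoetherianRing R] (hb : IsBlockIdempotent b) :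
    ∃ S : CohomologicalMackeyFunctor R G, S.IsSimple ∧ S.MemBlock b := by
  let Y := cohPerm R (FinGSet.quot (⊥ : Subgroup G))
  let L := Sub.map (Y.cohomological.rhoHom hb.1) ⊤
  have hL : (Y.sub L).MemBlock b := fun X => LinearMap.ext fun n => L.incl_isInjective X (by
    refine (L.incl.app_rho _ _).trans ?_
    obtain ⟨n, m, -, rfl⟩ := n
    change Y.rho b X (Y.rho b X m) = Y.rho b X m
    rw [← LinearMap.comp_apply, ← Y.cohomological.rho_mul hb.1 hb.1, hb.2.1.eq])
  have hne : ¬ (Y.sub L).IsZero := fun h0 => hb.2.2.1 (by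
    classical
    have h1 := (h0 (FinGSet.quot ⊥)).elim ⟨Y.rho b _ (permFunctor.one R _), _, trivial, rfl⟩ 0
    have h2 : (permFunctor R (FinGSet.quot (⊥ : Subgroup G))).rho b (FinGSet.quot ⊥) (permFunctor.one R _) = 0 :=
      congrArg Subtype.val h1
    rw [rho_eq_act_permMatrix] at h2
    have h3 := congrArg permFunctor.mat h2
    rw [permFunctor.act_apply (isInvariantMatrix_permMatrix hb.1 _), permFunctor.mat_one] at h3
    have h4 : permMatrix b (FinGSet.quot (⊥ : Subgroup G)) = 0 := (Matrix.mul_one _).symm.trans h3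
    ext g
    rw [← permMatrix_quot_bot, h4]
    rfl)
  obtain ⟨S, hS, hSL⟩ := exists_simple_subquotient hne
  exact ⟨S, hS, hL.of_isSubquotientOf hSL⟩

/-- A functor lies in a block as soon as all its simple subquotients do. -/
theorem memBlock_of_forall_isSubquotientOf [IsNoetherianRing R]
    (hb : b ∈ Subring.center (MonoidAlgebra R G)) (hi : IsIdempotentElem b)
    (h : ∀ S : CohomologicalMackeyFunctor R G, S.IsSimple → S.IsSubquotientOf M → S.MemBlock b) :
    M.MemBlock b := by
  -- If the image of `rho (1 - b)` were nonzero, it would have a simple subquotient on which both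
  -- `b` and `1 - b` act as the identity.
  let L := Sub.map (M.cohomological.rhoHom (one_sub_mem_center hb)) ⊤
  by_cases hL : (M.sub L).IsZero
  · intro X
    have h0 : M.rho (1 - b) X = 0 := LinearMap.ext fun m =>
      congrArg Subtype.val ((hL X).elim ⟨M.rho (1 - b) X m, m, trivial, rfl⟩ 0)
    rw [rho_sub, M.cohomological.rho_one] at h0
    exact (sub_eq_zero.mp h0).symm
  · exfalso
    obtain ⟨S, hS, hSL⟩ := exists_simple_subquotient hL
    have h1 : (M.sub L).MemBlock (1 - b) := fun X => LinearMap.ext fun n =>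
      L.incl_isInjective X (by
        refine (L.incl.app_rho _ _).trans ?_
        obtain ⟨n, m, -, rfl⟩ := n
        change M.rho (1 - b) X (M.rho (1 - b) X m) = M.rho (1 - b) X m
        rw [← LinearMap.comp_apply, ← M.cohomological.rho_mul (one_sub_mem_center hb)
          (one_sub_mem_center hb), hi.one_sub.eq])
    have h2 := (h1.of_isSubquotientOf hSL)
    obtain ⟨K, i, q, hi', hq⟩ := hSL
    have h3 := h S hS ⟨K, L.incl.comp i, q, fun X => (L.incl_isInjective X).comp (hi' X), hq⟩
    exact hS.rho_id_ne_zero h2 h3.rho_one_sub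

/-- The endomorphism `rho c` of `E` kills the image of `S`, so it factors through `T`; since `c` is
the identity on `T`, the factor is a section of `q`. -/
theorem exists_section_of_memBlock {E : CohomologicalMackeyFunctor R G}
    {i : Hom S.toMackeyFunctor E.toMackeyFunctor} {q : Hom E.toMackeyFunctor T.toMackeyFunctor}
    (hex : IsShortExact i q) {c : MonoidAlgebra R G}
    (hc : c ∈ Subring.center (MonoidAlgebra R G)) (hS : ∀ X, S.rho c X = 0)
    (hT : T.MemBlock c) : q.Splits := by
  obtain ⟨s, hs⟩ := Hom.exists_factor hex.2.2 (E.cohomological.rhoHom hc) fun X m hm => by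
    obtain ⟨n, rfl⟩ := (hex.2.1 X m).mp hm
    change E.rho c X (i.app X n) = 0
    rw [← i.app_rho, hS, LinearMap.zero_apply, map_zero]
  refine ⟨s, fun X => LinearMap.ext fun t => ?_⟩
  obtain ⟨m, rfl⟩ := hex.2.2 X t
  rw [LinearMap.comp_apply, hs]
  change q.app X (E.rho c X m) = _
  rw [q.app_rho, hT]

end CohomologicalMackeyFunctor

namespace SimpleCohomologicalMackeyFunctor

variable [Finite G]

open CohomologicalMackeyFunctor

/-- If `b` acted differently on the two ends of the extension, then `b` or `1 - b` would split it.
-/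
theorem Adjacent.memBlock_iff {S T : SimpleCohomologicalMackeyFunctor R G} (h : Adjacent S T)
    {b : MonoidAlgebra R G} (hb : b ∈ Subring.center (MonoidAlgebra R G))
    (hi : IsIdempotentElem b) : S.1.MemBlock b ↔ T.1.MemBlock b := by
  rcases h with ⟨f, hf, hf'⟩ | ⟨E, i, q, hex, hns⟩
  · exact ⟨fun h => h.of_isSurjective hf', fun h => h.of_isInjective hf⟩
  · rcases S.1.cohomological.rho_eq_id_or_zero S.2 hb hi with hS | hS
    · refine iff_of_true hS ?_
      rcases T.1.cohomological.rho_eq_id_or_zero T.2 hb hi with hT | hT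
      · exact hT
      · refine absurd (exists_section_of_memBlock hex (one_sub_mem_center hb)
          (MemBlock.rho_one_sub hS) fun X => ?_) hns
        rw [rho_sub, hT, T.1.cohomological.rho_one, sub_zero]
    · refine iff_of_false (fun h => S.2.rho_id_ne_zero h hS) fun hT => hns ?_
      exact exists_section_of_memBlock hex hb hS hT

theorem memBlock_iff_of_eqvGen {S T : SimpleCohomologicalMackeyFunctor R G}
    (h : Relation.EqvGen Adjacent S T) {b : MonoidAlgebra R G}
    (hb : b ∈ Subring.center (MonoidAlgebra R G)) (hi : IsIdempotentElem b) :
    S.1.MemBlock b ↔ T.1.MemBlock b := by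
  induction h with
  | rel _ _ h => exact h.memBlock_iff hb hi
  | refl _ => exact Iff.rfl
  | symm _ _ _ ih => exact ih.symm
  | trans _ _ _ _ _ ih ih' => exact ih.trans ih'

end SimpleCohomologicalMackeyFunctor

end

/-! ### Maximal subfunctors of projective functors. -/

noncomputable section

open FinGSet MackeyFunctor

variable {R : Type u} [CommRing R] {G : Type u} [Group G]

namespace MackeyFunctor

/-- The direct sum of copies of a Mackey functor. -/
def finsupp (ι : Type u) (N : MackeyFunctor R G) : MackeyFunctor R G where
  obj X := ModuleCat.of R (ι →₀ N.obj X)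
  contra f := Finsupp.mapRange.linearMap (N.contra f)
  co f := Finsupp.mapRange.linearMap (N.co f)
  contra_id X := LinearMap.ext fun m => Finsupp.ext fun i => LinearMap.congr_fun (N.contra_id X) (m i)
  co_id X := LinearMap.ext fun m => Finsupp.ext fun i => LinearMap.congr_fun (N.co_id X) (m i)
  contra_comp f g := LinearMap.ext fun m => Finsupp.ext fun i =>
    LinearMap.congr_fun (N.contra_comp f g) (m i)
  co_comp f g := LinearMap.ext fun m => Finsupp.ext fun i =>
    LinearMap.congr_fun (N.co_comp f g) (m i)
  additive X Y := by
    constructor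
    · intro a b h
      refine Finsupp.ext fun i => (N.additive X Y).1 (Prod.ext ?_ ?_)
      · exact DFunLike.congr_fun (congrArg Prod.fst h) i
      · exact DFunLike.congr_fun (congrArg Prod.snd h) i
    · rintro ⟨a, b⟩
      have hl : Function.Injective (inl X Y) := Sum.inl_injective
      have hr : Function.Injective (inr X Y) := Sum.inr_injective
      refine ⟨Finsupp.mapRange.linearMap (N.co (inl X Y)) a +
        Finsupp.mapRange.linearMap (N.co (inr X Y)) b, Prod.ext ?_ ?_⟩
      · refine Finsupp.ext fun i => ?_
        change N.contra (inl X Y) (N.co (inl X Y) (a i) + N.co (inr X Y) (b i)) = a i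
        have h1 := LinearMap.congr_fun (N.contra_co_of_injective _ hl) (a i)
        have h2 := LinearMap.congr_fun (N.contra_co_of_disjoint (f := inr X Y) (g := inl X Y)
          fun x y h => Sum.inr_ne_inl h) (b i)
        rw [map_add]
        exact (congrArg₂ (· + ·) h1 h2).trans (add_zero _)
      · refine Finsupp.ext fun i => ?_
        change N.contra (inr X Y) (N.co (inl X Y) (a i) + N.co (inr X Y) (b i)) = b i
        have h1 := LinearMap.congr_fun (N.contra_co_of_injective _ hr) (b i)
        have h2 := LinearMap.congr_fun (N.contra_co_of_disjoint (f := inl X Y) (g := inr X Y)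
          fun x y h => Sum.inl_ne_inr h) (a i)
        rw [map_add]
        exact (congrArg₂ (· + ·) h2 h1).trans (zero_add _)
  pullback a b c d h := LinearMap.ext fun m => Finsupp.ext fun i =>
    LinearMap.congr_fun (N.pullback a b c d h) (m i)

/-- The projections of a direct sum. -/
def finsuppProj {ι : Type u} {N : MackeyFunctor R G} (i : ι) : Hom (finsupp ι N) N where
  app _ := Finsupp.lapply i
  contra_comm _ := rfl
  co_comm _ := rfl

/-- The universal property of a direct sum. -/
def finsuppDesc {ι : Type u} {M N : MackeyFunctor R G} (f : ι → Hom N M) : Hom (finsupp ι N) M where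
  app X := Finsupp.lsum ℕ fun i => (f i).app X
  contra_comm k := Finsupp.lhom_ext fun i n => by
    change Finsupp.lsum ℕ (fun i => (f i).app _) (Finsupp.mapRange.linearMap (N.contra k) (Finsupp.single i n)) =
      M.contra k (Finsupp.lsum ℕ (fun i => (f i).app _) (Finsupp.single i n))
    rw [Finsupp.mapRange.linearMap_apply, Finsupp.mapRange_single, Finsupp.lsum_single,
      Finsupp.lsum_single, Hom.app_contra]
  co_comm k := Finsupp.lhom_ext fun i n => by
    change Finsupp.lsum ℕ (fun i => (f i).app _) (Finsupp.mapRange.linearMap (N.co k) (Finsupp.single i n)) =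
      M.co k (Finsupp.lsum ℕ (fun i => (f i).app _) (Finsupp.single i n))
    rw [Finsupp.mapRange.linearMap_apply, Finsupp.mapRange_single, Finsupp.lsum_single,
      Finsupp.lsum_single, Hom.app_co]

theorem finsuppDesc_single {ι : Type u} {M N : MackeyFunctor R G} (f : ι → Hom N M) (i : ι)
    {X : FinGSet G} (n : N.obj X) :
    (finsuppDesc f).app X (Finsupp.single i n : ι →₀ N.obj X) = (f i).app X n :=
  Finsupp.lsum_single _ _ _ _

/-- A subfunctor that is maximal among the preimages, under `f`, of subfunctors, is maximal. -/
theorem exists_isCoatom_of_hom {M N : MackeyFunctor R G} [WellFoundedGT (Sub N)] {f : Hom M N}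
    (hf : ¬ ∀ X m, f.app X m = 0) : ∃ L : Sub M, IsCoatom L := by
  obtain ⟨K, hK, hmax⟩ := wellFounded_gt.has_min {K : Sub N | Sub.comap f K ≠ ⊤}
    ⟨⊥, fun h => hf fun X m => Sub.mem_bot.mp (Sub.eq_top_iff'.mp h X m)⟩
  refine ⟨Sub.comap f K, hK, fun L hL => ?_⟩
  have hker : Sub.comap f ⊥ ≤ L := ((Sub.gc_map_comap f).monotone_u bot_le).trans hL.le
  by_contra hne
  -- Maximality of `K` makes the preimage of `K ⊔ f(L)` everything. Writing `f m = k + f l`, the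
  -- difference `m - l` lies in the preimage of `K`, hence in `L`.
  have hlt : K < K ⊔ Sub.map f L := by
    refine le_sup_left.lt_of_ne fun h => hL.not_ge ?_
    exact (Sub.gc_map_comap f _ _).mp (h ▸ le_sup_right)
  refine hmax _ (fun h => hne ?_) hlt
  rw [eq_top_iff, ← h]
  intro X m hm
  obtain ⟨k, hk, l', ⟨l, hl, hl'⟩, hkl⟩ := Submodule.mem_sup.mp (show f.app X m ∈ _ from hm)
  have h1 : m - l ∈ (Sub.comap f K).obj X := by
    rw [Sub.mem_comap, map_sub, ← hkl, hl', add_sub_cancel_right]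
    exact hk
  have := add_mem (hL.le X h1) hl
  rwa [sub_add_cancel] at this

variable [Finite G]

theorem IsCohomological.finsupp {ι : Type u} {N : MackeyFunctor R G} (hN : N.IsCohomological) :
    (finsupp ι N).IsCohomological := fun K H h (m : ι →₀ N.obj (quot H)) =>
  Finsupp.ext fun i => (hN K H h (m i)).trans (Finsupp.smul_apply (K.relIndex H) m i).symm

theorem IsCohomological.finsuppDesc_yoneda_isSurjective {M : MackeyFunctor R G}
    (hM : M.IsCohomological) :
    (finsuppDesc fun m : M.obj (omega G) => hM.yoneda m).IsSurjective := by
  rw [Hom.isSurjective_iff, eq_top_iff]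
  refine Sub.le_of_omega fun m _ => ⟨Finsupp.single m (permFunctor.one R _), trivial, ?_⟩
  exact (finsuppDesc_single _ _ _).trans (hM.yoneda_one m)

end MackeyFunctor

namespace CohomologicalMackeyFunctor

variable [Finite G]

/-- `P` is a retract of a direct sum of representable functors. A nonzero component of the embedding
lands in a noetherian functor and yields a coatom; if all components vanish, so does `P`. -/
theorem IsProjective.exists_isCoatom [IsNoetherianRing R] {P : CohomologicalMackeyFunctor R G}
    (hP : P.IsProjective) (h0 : ¬ P.IsZero) : ∃ L : Sub P.toMackeyFunctor, IsCoatom L := by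
  let ι := P.obj (omega G)
  let F : CohomologicalMackeyFunctor R G :=
    { toMackeyFunctor := finsupp ι (permFunctor R (omega G))
      cohomological := permFunctor.isCohomological.finsupp }
  obtain ⟨s, hs⟩ := hP F P (finsuppDesc fun m : ι => P.cohomological.yoneda m)
    (Hom.id _) P.cohomological.finsuppDesc_yoneda_isSurjective
  by_contra hno
  refine h0 fun X => ⟨fun a b => ?_⟩
  have hz : ∀ a, s.app X a = 0 := fun a => Finsupp.ext fun i => by
    by_contra hne
    exact hno (exists_isCoatom_of_hom (f := (finsuppProj i).comp s) fun h => hne (h X a))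
  have ha := LinearMap.congr_fun (hs X) a
  have hb := LinearMap.congr_fun (hs X) b
  rw [LinearMap.comp_apply, hz, map_zero] at ha hb
  exact ha.symm.trans hb

end CohomologicalMackeyFunctor

end

/-! ### Projective indecomposables as retracts of representable functors. -/

noncomputable section

open FinGSet MackeyFunctor

variable {R : Type u} [CommRing R] {G : Type u} [Group G]

open scoped Classical in
/-- The algebra of invariant matrices, opposite to `End_{RG}(RX)`. -/
def invAlgebra (R : Type u) [CommRing R] (X : FinGSet G) : Subalgebra R (Matrix X X R) where
  carrier := {a | IsInvariantMatrix a}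
  mul_mem' ha hb := ha.mul hb
  add_mem' ha hb g z x := congrArg₂ (· + ·) (ha g z x) (hb g z x)
  algebraMap_mem' r := by
    rw [Algebra.algebraMap_eq_smul_one]
    intro g z x
    exact congrArg (r * ·) (isInvariantMatrix_one X g z x)

open scoped Classical in
instance [IsNoetherianRing R] (X : FinGSet G) : Module.Finite R (invAlgebra R X) :=
  inferInstanceAs (Module.Finite R (Subalgebra.toSubmodule (invAlgebra R X)))

namespace MackeyFunctor

/-- Multiplication by a scalar. -/
def smulHom (M : MackeyFunctor R G) (r : R) : Hom M M where
  app _ := r • LinearMap.id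
  contra_comm f := by rw [LinearMap.smul_comp, LinearMap.comp_smul, LinearMap.id_comp,
    LinearMap.comp_id]
  co_comm f := by rw [LinearMap.smul_comp, LinearMap.comp_smul, LinearMap.id_comp,
    LinearMap.comp_id]

/-- Multiplication by `r` is surjective or zero, and Nakayama's lemma excludes surjectivity. -/
theorem IsSimple.smul_eq_zero [IsLocalRing R] {S : MackeyFunctor R G} (hS : S.IsSimple)
    [IsFiniteType S] {r : R} (hr : r ∈ IsLocalRing.maximalIdeal R) {X : FinGSet G} (s : S.obj X) :
    r • s = 0 := by
  rcases hS.hom_surjective_or_zero (S.smulHom r) with h | h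
  · refine absurd (fun X => ?_) hS.1
    have htop : (⊤ : Submodule R (S.obj X)) ≤ IsLocalRing.maximalIdeal R • ⊤ := fun s _ => by
      obtain ⟨t, rfl⟩ := h X s
      exact Submodule.smul_mem_smul hr trivial
    have := Submodule.eq_bot_of_le_smul_of_le_jacobson_bot _ _ Module.Finite.fg_top htop
      (IsLocalRing.maximalIdeal_le_jacobson ⊥)
    exact (Submodule.subsingleton_iff R).mp (subsingleton_of_bot_eq_top this.symm)
  · exact h X s

theorem IsCohomological.isFiniteType_of_isSimple [Finite G] [IsNoetherianRing R]
    {S : MackeyFunctor R G} (hc : S.IsCohomological) (hS : S.IsSimple) : IsFiniteType S := by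
  obtain ⟨X, s, hs⟩ := exists_ne_zero_of_not_isZero hS.1
  refine IsFiniteType.of_isSurjective ((hS.hom_surjective_or_zero (hc.yoneda s)).resolve_right
    fun h => hs ?_)
  rw [← hc.yoneda_one s, h]

/-- The kernel and the image of an idempotent are complementary subfunctors. -/
theorem IsIndecomposable.idempotent_eq_id_or_zero {P : MackeyFunctor R G} (hP : P.IsIndecomposable)
    {ε : Hom P P} (hε : ∀ X m, ε.app X (ε.app X m) = ε.app X m) :
    (∀ X m, ε.app X m = m) ∨ ∀ X m, ε.app X m = 0 := by
  have hcompl : IsCompl (Sub.comap ε ⊥) (Sub.map ε ⊤) := by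
    refine ⟨disjoint_iff.mpr (Sub.eq_bot_iff'.mpr ?_), codisjoint_iff.mpr (Sub.eq_top_iff'.mpr ?_)⟩
    · rintro X _ ⟨h, m, -, rfl⟩
      rw [← hε]
      exact Sub.mem_bot.mp h
    · intro X m
      refine Submodule.mem_sup.mpr ⟨m - ε.app X m, Sub.mem_comap.mpr (Sub.mem_bot.mpr ?_), ε.app X m,
        ⟨m, trivial, rfl⟩, sub_add_cancel _ _⟩
      rw [map_sub, hε, sub_self]
  rcases (isIndecomposable_iff.mp hP).2 _ _ hcompl with h | h
  · exact Or.inl fun X m => Hom.isInjective_iff.mpr h X (hε X m)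
  · exact Or.inr fun X m => Sub.eq_bot_iff'.mp h X _ ⟨m, trivial, rfl⟩

theorem mat_yoneda_app [Finite G] {X Y Z : FinGSet G} (c : (permFunctor R Y).obj X)
    (b : (permFunctor R X).obj Z) :
    permFunctor.mat ((permFunctor.isCohomological.yoneda c).app Z b) =
      permFunctor.mat b * permFunctor.mat c :=
  permFunctor.act_apply (permFunctor.mat_isInvariant b) c

theorem mat_app [Finite G] {X Y Z : FinGSet G} (f : Hom (permFunctor R X) (permFunctor R Y))
    (b : (permFunctor R X).obj Z) :
    permFunctor.mat (f.app Z b) = permFunctor.mat b * permFunctor.mat (f.app X (permFunctor.one R X)) := by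
  rw [f.app_permFunctor, permFunctor.act_apply (permFunctor.mat_isInvariant b)]

open scoped Classical in
theorem IsCohomological.act_coe_one [Finite G] {S : MackeyFunctor R G}
    (hc : S.IsCohomological) (X : FinGSet G) (s : S.obj X) :
    S.act ((1 : invAlgebra R X) : Matrix X X R) s = s :=
  LinearMap.congr_fun (hc.act_one X) s

open scoped Classical in
/-- An element of the algebra of invariant matrices that fixes a nonzero element of a simple functor
is invertible on a nonzero direct summand. -/
theorem IsCohomological.exists_partial_inverse [Finite G] [IsNoetherianRing R] [IsLocalRing R]
    [IsAdicComplete (IsLocalRing.maximalIdeal R) R] {S : MackeyFunctor R G}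
    (hc : S.IsCohomological) (hS : S.IsSimple) {X : FinGSet G} {s : S.obj X} (hs : s ≠ 0)
    {a : invAlgebra R X} (ha : S.act a.1 s = s) :
    ∃ c : invAlgebra R X, c * a * c = c ∧ a * c * a ≠ 0 := by
  have := hc.isFiniteType_of_isSimple hS
  have hmul : ∀ c d : invAlgebra R X, S.act (c * d).1 s = S.act c.1 (S.act d.1 s) := fun c d =>
    LinearMap.congr_fun (hc.act_mul c.2 d.2) _
  obtain ⟨b, e, n, hab, hba, hee, hae, hmem⟩ := exists_fitting_idempotent (R := R) a
  have hpow : ∀ k, S.act (a ^ k).1 s = s := fun k => by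
    induction k with
    | zero =>
      rw [pow_zero]
      exact hc.act_coe_one X s
    | succ k ih => rw [pow_succ, hmul, ha]; exact ih
  -- This element lies in the maximal ideal times the algebra, and the maximal ideal annihilates
  -- `S`. If `e` were zero, `s = a ^ n s` would therefore vanish.
  have hzero : S.act (a ^ n * (1 - e)).1 s = 0 := by
    refine Submodule.smul_induction_on hmem (fun r hr c _ => ?_) fun c d hc hd => ?_
    · exact (LinearMap.congr_fun (act_smul _ r c.1) _).trans (hS.smul_eq_zero hr _)
    · refine (LinearMap.congr_fun (act_add _ c.1 d.1) _).trans ?_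
      exact (congrArg₂ (· + ·) hc hd).trans (add_zero 0)
  -- With `c = b e` one finds `a c a = e a`, and `e = e a b` recovers `e` from it.
  refine ⟨b * e, ?_, fun h => ?_⟩
  · rw [mul_assoc (b * e), ← mul_assoc a, ← hab, mul_assoc b e, hee, hee]
  · have he : e = 0 := by
      rw [← mul_assoc, ← hab, hee] at h
      rw [← hee]
      nth_rw 2 [hab]
      rw [← mul_assoc, h, zero_mul]
    rw [he, sub_zero, mul_one, hpow] at hzero
    exact hs hzero

end MackeyFunctor

namespace CohomologicalMackeyFunctor

variable [Finite G] [IsNoetherianRing R] [IsLocalRing R]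
  [IsAdicComplete (IsLocalRing.maximalIdeal R) R]

/-- Let `q : P → S` be a simple quotient and `g` a morphism from a representable functor with `q g`
nonzero, hence surjective. Projectivity gives `f` with `q g f = q`. The matrix of `f g` fixes a
nonzero element of `S`, so it has a partial inverse, which corrects `g f` to a nonzero idempotent of
the indecomposable `P`. -/
theorem IsProjective.exists_retraction {P : CohomologicalMackeyFunctor R G}
    (hP : P.IsProjective) (hI : P.IsIndecomposable) :
    ∃ (X : FinGSet G) (i : Hom P.toMackeyFunctor (permFunctor R X))
      (r : Hom (permFunctor R X) P.toMackeyFunctor), ∀ Z m, r.app Z (i.app Z m) = m := by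
  classical
  obtain ⟨L, hL⟩ := hP.exists_isCoatom hI.1
  have hS := isSimple_quotient hL
  obtain ⟨X, s, hs⟩ := exists_ne_zero_of_not_isZero hS.1
  obtain ⟨p, rfl⟩ := quotientMk_isSurjective L X s
  set q := quotientMk L
  set g := P.cohomological.yoneda p with hg
  have hgp : g.app X (permFunctor.one R X) = p := P.cohomological.yoneda_one p
  obtain ⟨f, hf⟩ : ∃ f : Hom P.toMackeyFunctor (permFunctor R X), ∀ Z m,
      q.app Z (g.app Z (f.app Z m)) = q.app Z m := by
    obtain ⟨f, hf⟩ := hP (cohPerm R X) (P.quot L) (q.comp g) q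
      ((hS.hom_surjective_or_zero (q.comp g)).resolve_right fun h => hs (by
        rw [← hgp]
        exact h X _))
    exact ⟨f, fun Z m => LinearMap.congr_fun (hf Z) m⟩
  have ha : (P.toMackeyFunctor.quotient L).act (permFunctor.mat (f.app X p)) (q.app X p) =
      q.app X p := (q.app_act _ _).symm.trans (hf X p)
  obtain ⟨c, hcac, haca⟩ := (P.quot L).cohomological.exists_partial_inverse hS hs
    (a := ⟨permFunctor.mat (f.app X p), permFunctor.mat_isInvariant (f.app X p)⟩) ha
  let γ := (permFunctor.isCohomological (R := R)).yoneda (permFunctor.ofMat c.1 c.2)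
  have hγ : ∀ {Z} (w : (permFunctor R X).obj Z),
      permFunctor.mat (γ.app Z w) = permFunctor.mat w * c.1 := fun w => mat_yoneda_app _ w
  have hfg : ∀ {Z} (w : (permFunctor R X).obj Z),
      permFunctor.mat (f.app Z (g.app Z w)) = permFunctor.mat w * permFunctor.mat (f.app X p) := fun w => by
    refine (mat_app (f.comp g) w).trans ?_
    congr 2
    exact congrArg (f.app X) hgp
  have hsq : ∀ {Z} (m : P.obj Z), γ.app Z (f.app Z (g.app Z (γ.app Z (f.app Z m)))) =
      γ.app Z (f.app Z m) := fun m => permFunctor.mat_injective (by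
    rw [hγ, hfg, hγ, Matrix.mul_assoc, Matrix.mul_assoc]
    exact congrArg (permFunctor.mat (f.app _ m) * ·)
      ((Matrix.mul_assoc _ _ _).symm.trans (congrArg Subtype.val hcac)))
  -- Idempotence follows from `c a c = c`. If `ε` were zero then `f ε g`, whose matrix is `a c a`,
  -- would be zero as well.
  let ε : Hom P.toMackeyFunctor P.toMackeyFunctor := g.comp (γ.comp f)
  rcases hI.idempotent_eq_id_or_zero (ε := ε) fun Z m => congrArg (g.app Z) (hsq m) with h | h
  · exact ⟨X, f, g.comp γ, h⟩
  · refine absurd (Subtype.ext ?_) haca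
    have h0 : g.app X (γ.app X (f.app X (g.app X (permFunctor.one R X)))) = 0 := h X _
    have h1 := congrArg (fun t => permFunctor.mat (f.app X t)) h0
    simp only [map_zero] at h1
    rw [hfg, hγ, hfg, permFunctor.mat_one, Matrix.one_mul] at h1
    exact h1

end CohomologicalMackeyFunctor

end

/-! ### Evaluation at `G/1`. -/

noncomputable section

open FinGSet MackeyFunctor

variable {R : Type u} [CommRing R] {G : Type u} [Group G]

/-- A map of representations commuting with `G`, as a map of modules over the group algebra. -/
def Representation.moduleHom {V W : Type u} [AddCommGroup V] [Module R V] [AddCommGroup W]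
    [Module R W] {ρ : Representation R G V} {σ : Representation R G W} (f : V →ₗ[R] W)
    (hf : ∀ g v, f (ρ g v) = σ g (f v)) : ρ.asModule →ₗ[MonoidAlgebra R G] σ.asModule :=
  Representation.IntertwiningMap.equivLinearMapAsModule ρ σ
    (f.intertwiningMap_of_isIntertwiningMap ρ σ hf)

/-- The underlying linear map of a module homomorphism commutes with `G`. -/
theorem Representation.map_rho {V W : Type u} [AddCommGroup V] [Module R V]
    [AddCommGroup W] [Module R W] {ρ : Representation R G V} {σ : Representation R G W}
    (φ : ρ.asModule →ₗ[MonoidAlgebra R G] σ.asModule) (g : G) (v : V) :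
    φ (ρ g v) = σ g (φ v) :=
  LinearMap.congr_fun
    (((Representation.IntertwiningMap.equivLinearMapAsModule ρ σ).symm φ).isIntertwining' g) v

namespace FinGSet

theorem mk_bot_injective : Function.Injective (QuotientGroup.mk (s := (⊥ : Subgroup G))) :=
  fun a b h => by rwa [QuotientGroup.eq, Subgroup.mem_bot, inv_mul_eq_one] at h

variable [Finite G]

/-- The map `G/1 → X` with value `x` at `1`. -/
def pointMap {X : FinGSet G} (x : X) : quot (⊥ : Subgroup G) →[G] X :=
  (orbitMap x).comp (proj bot_le)

theorem pointMap_one {X : FinGSet G} (x : X) :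
    pointMap x (QuotientGroup.mk 1 : G ⧸ (⊥ : Subgroup G)) = x := one_smul G x

end FinGSet

variable [Finite G]

namespace MackeyFunctor

theorem Hom.app_evalOne {M N : MackeyFunctor R G} (f : Hom M N) (g : G)
    (m : M.obj (quot (⊥ : Subgroup G))) :
    f.app (quot ⊥) (M.evalOne g m) = N.evalOne g (f.app (quot ⊥) m) := f.app_contra _ m

end MackeyFunctor

namespace permFunctor

variable {X : FinGSet G}

/-- The first row of a matrix. -/
def row (R : Type u) [CommRing R] (X : FinGSet G) :
    (permFunctor R X).obj (quot (⊥ : Subgroup G)) →ₗ[R] X → R where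
  toFun b := mat b (QuotientGroup.mk 1 : G ⧸ (⊥ : Subgroup G))
  map_add' _ _ := rfl
  map_smul' _ _ := rfl

theorem mat_mk (b : (permFunctor R X).obj (quot (⊥ : Subgroup G))) (g : G) (x : X) :
    mat b (QuotientGroup.mk g : G ⧸ (⊥ : Subgroup G)) x = row R X b (g⁻¹ • x) := by
  have h := mat_isInvariant b g (QuotientGroup.mk 1 : G ⧸ (⊥ : Subgroup G)) (g⁻¹ • x)
  rw [smul_inv_smul] at h
  refine Eq.trans ?_ h
  exact congrArg (fun t => mat b t x) (congrArg QuotientGroup.mk (mul_one g).symm)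

/-- By invariance the row at `1` determines all other rows, and it can be prescribed freely; this is
`Hom_{RG}(RG, RX) = RX`. -/
theorem row_bijective : Function.Bijective (row R X) := by
  constructor
  · intro b c h
    refine mat_injective ?_
    ext z x
    obtain ⟨g, rfl⟩ : ∃ g : G, z = (QuotientGroup.mk g : G ⧸ (⊥ : Subgroup G)) :=
      (QuotientGroup.mk_surjective z).imp fun _ h => h.symm
    rw [mat_mk, h]
    exact (mat_mk c g x).symm
  · intro v
    have hout : ∀ g : G, (QuotientGroup.mk g : G ⧸ (⊥ : Subgroup G)).out = g := fun g =>
      mk_bot_injective (QuotientGroup.out_eq' _)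
    refine ⟨ofMat (fun (z : G ⧸ (⊥ : Subgroup G)) x => v (z.out⁻¹ • x)) ?_, ?_⟩
    · intro g z x
      obtain ⟨h, rfl⟩ : ∃ h : G, z = (QuotientGroup.mk h : G ⧸ (⊥ : Subgroup G)) :=
        (QuotientGroup.mk_surjective z).imp fun _ h => h.symm
      change v ((QuotientGroup.mk (g * h) : G ⧸ (⊥ : Subgroup G)).out⁻¹ • g • x) =
        v ((QuotientGroup.mk h : G ⧸ (⊥ : Subgroup G)).out⁻¹ • x)
      rw [hout, hout, mul_inv_rev, mul_smul, inv_smul_smul]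
    · ext x
      change v ((QuotientGroup.mk 1 : G ⧸ (⊥ : Subgroup G)).out⁻¹ • x) = v x
      rw [hout, inv_one, one_smul]

theorem row_evalOne (g : G) (b : (permFunctor R X).obj (quot (⊥ : Subgroup G))) (x : X) :
    row R X ((permFunctor R X).evalOne g b) x = row R X b (g⁻¹ • x) := by
  rw [← mat_mk]
  exact congrArg (fun t => mat b t x) (congrArg QuotientGroup.mk (one_mul g))

theorem isPermutationProjective_of_retraction {M : MackeyFunctor R G} (i : Hom M (permFunctor R X))
    (r : Hom (permFunctor R X) M) (h : ∀ Z m, r.app Z (i.app Z m) = m) :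
    IsPermutationProjective M.evalOne := by
  let E : (permFunctor R X).obj (quot (⊥ : Subgroup G)) ≃ₗ[R] MonoidAlgebra R X :=
    (LinearEquiv.ofBijective (row R X) row_bijective).trans
      ((Finsupp.linearEquivFunOnFinite R R X).symm.trans (MonoidAlgebra.coeffLinearEquiv R).symm)
  have hE : ∀ g b, E ((permFunctor R X).evalOne g b) = permRep R X g (E b) := fun g b => by
    ext x
    refine (row_evalOne g b x).trans ?_
    rw [Representation.coeff_ofMulAction]
    rfl
  refine ⟨X, Representation.moduleHom (E.toLinearMap ∘ₗ i.app (quot ⊥)) fun g v => ?_,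
    Representation.moduleHom (r.app (quot ⊥) ∘ₗ E.symm.toLinearMap) fun g v => ?_,
    LinearMap.ext fun v => ?_⟩
  · exact (congrArg E (i.app_evalOne g v)).trans (hE g _)
  · have : E.symm (permRep R X g v) = (permFunctor R X).evalOne g (E.symm v) := by
      rw [LinearEquiv.symm_apply_eq, hE, E.apply_symm_apply]
    exact (congrArg (r.app (quot ⊥)) this).trans (r.app_evalOne g _)
  · refine Eq.trans ?_ (h (quot ⊥) v)
    exact congrArg (r.app (quot ⊥)) (E.symm_apply_apply _)

/-- Row `z` of `b` is the row at `1` of its restriction along `pointMap z`. Hence morphisms into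
representable functors are determined by their values at `G/1`. -/
theorem eq_zero_of_contra_pointMap {Z : FinGSet G} {b : (permFunctor R X).obj Z}
    (h : ∀ z, (permFunctor R X).contra (pointMap z) b = 0) : b = 0 := by
  refine mat_injective ?_
  ext z x
  have h1 := contra_apply (pointMap z) b (QuotientGroup.mk 1 : G ⧸ (⊥ : Subgroup G)) x
  rw [h z, pointMap_one] at h1
  exact h1.symm

/-- The functor of evaluation at `G/1` is full on permutation functors. -/
theorem exists_hom_app_eq (θ : (permFunctor R X).obj (quot (⊥ : Subgroup G)) →ₗ[R]
      (permFunctor R X).obj (quot (⊥ : Subgroup G)))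
    (hθ : ∀ g b, θ ((permFunctor R X).evalOne g b) = (permFunctor R X).evalOne g (θ b)) :
    ∃ f : Hom (permFunctor R X) (permFunctor R X), f.app (quot ⊥) = θ := by
  classical
  let E := LinearEquiv.ofBijective (row R X) row_bijective
  let δ : X → (permFunctor R X).obj (quot (⊥ : Subgroup G)) := fun x => E.symm (Pi.single x 1)
  have hδ : ∀ x, row R X (δ x) = Pi.single x 1 := fun x => E.apply_symm_apply _
  -- The matrix whose rows are the images under `θ` of the standard basis; equivariance of `θ` is
  -- its invariance.
  have hinv : IsInvariantMatrix (fun x => row R X (θ (δ x)) : Matrix X X R) := fun g x y => by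
    have h1 : δ (g • x) = (permFunctor R X).evalOne g (δ x) := row_bijective.1 (by
      ext y
      rw [row_evalOne, hδ, hδ, Pi.single_apply, Pi.single_apply]
      exact if_congr inv_smul_eq_iff.symm rfl rfl)
    change row R X (θ (δ (g • x))) (g • y) = row R X (θ (δ x)) y
    rw [h1, hθ, row_evalOne, inv_smul_smul]
  refine ⟨permFunctor.isCohomological.yoneda (ofMat _ hinv), LinearMap.ext fun b => ?_⟩
  refine row_bijective.1 ?_
  have hb : b = ∑ x, row R X b x • δ x := row_bijective.1 (by
    ext y
    simp only [map_sum, map_smul, hδ, Finset.sum_apply, Pi.smul_apply, Pi.single_apply]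
    simp)
  ext y
  have h1 := congrFun (congrFun (mat_yoneda_app (ofMat _ hinv) b)
    (QuotientGroup.mk 1 : G ⧸ (⊥ : Subgroup G))) y
  refine h1.trans ((Matrix.mul_apply ..).trans ?_)
  conv_rhs => rw [hb]
  simp only [map_sum, map_smul, Finset.sum_apply, Pi.smul_apply, smul_eq_mul]
  rfl

/-- A decomposition of `M(G/1)` is an idempotent `φ`. By fullness `i φ r` extends to an endomorphism
of the representable functor, and cutting that down by `i` and `r` gives an endomorphism of `M` with
value `φ` at `G/1`. It is idempotent by faithfulness, so it is the identity or zero. -/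
theorem isIndecomposableModule_of_retraction {M : MackeyFunctor R G} (i : Hom M (permFunctor R X))
    (r : Hom (permFunctor R X) M) (h : ∀ Z m, r.app Z (i.app Z m) = m)
    (hM : M.IsIndecomposable) :
    IsIndecomposableModule (MonoidAlgebra R G) M.evalOne.asModule := by
  have hdet : ∀ {Z : FinGSet G} (m : M.obj Z), (∀ z, M.contra (pointMap z) m = 0) → m = 0 :=
    fun {Z} m hm => by
      rw [← h Z m, eq_zero_of_contra_pointMap (b := i.app Z m) fun z => ?_, map_zero]
      rw [← i.app_contra, hm, map_zero]
  refine ⟨?_, fun V W hVW => ?_⟩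
  · obtain ⟨Z, m, hm⟩ := exists_ne_zero_of_not_isZero hM.1
    obtain ⟨z, hz⟩ : ∃ z, M.contra (pointMap z) m ≠ 0 := by
      by_contra! hne
      exact hm (hdet m hne)
    exact ⟨⟨M.contra (pointMap z) m, 0, hz⟩⟩
  · let φ := V.projection W hVW
    have hφ : ∀ v, φ (φ v) = φ v := fun v =>
      V.projection_apply_of_mem_left hVW (V.projection_apply_mem hVW v)
    let φ' : M.obj (quot (⊥ : Subgroup G)) →ₗ[R] M.obj (quot (⊥ : Subgroup G)) :=
      ((Representation.IntertwiningMap.equivLinearMapAsModule M.evalOne M.evalOne).symm φ).toLinearMap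
    obtain ⟨Ψ, hΨ⟩ := exists_hom_app_eq (i.app (quot ⊥) ∘ₗ φ' ∘ₗ r.app (quot ⊥)) fun g b => by
      simp only [LinearMap.comp_apply]
      rw [r.app_evalOne, ← i.app_evalOne]
      exact congrArg _ (Representation.map_rho φ g _)
    let ε : Hom M M := r.comp (Ψ.comp i)
    have hε1 : ∀ m : M.obj (quot (⊥ : Subgroup G)), ε.app (quot ⊥) m = φ' m := fun m => by
      change r.app (quot ⊥) (Ψ.app (quot ⊥) (i.app (quot ⊥) m)) = φ' m
      rw [hΨ, LinearMap.comp_apply, LinearMap.comp_apply, h, h]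
    have hε : ∀ Z m, ε.app Z (ε.app Z m) = ε.app Z m := fun Z m => sub_eq_zero.mp
      (hdet _ fun z => by
        rw [map_sub, ← ε.app_contra, ← ε.app_contra, sub_eq_zero, hε1, hε1]
        exact hφ _)
    rcases hM.idempotent_eq_id_or_zero hε with h1 | h1
    · right
      refine (Submodule.eq_bot_iff _).mpr fun w hw => ?_
      have h2 : φ w = 0 := (V.projection_apply_eq_zero_iff hVW).mpr hw
      exact (h1 (quot ⊥) w).symm.trans ((hε1 w).trans h2)
    · left
      refine (Submodule.eq_bot_iff _).mpr fun v hv => ?_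
      have h2 : φ v = v := V.projection_apply_of_mem_left hVW hv
      exact h2.symm.trans ((hε1 v).symm.trans (h1 (quot ⊥) v))

end permFunctor

namespace CohomologicalMackeyFunctor

theorem memBlock_iff_of_projective_indecomposable [IsNoetherianRing R] [IsLocalRing R]
    [IsAdicComplete (IsLocalRing.maximalIdeal R) R] {P : CohomologicalMackeyFunctor R G}
    (hP : P.IsProjective) (hI : P.IsIndecomposable) {b : MonoidAlgebra R G}
    (hb : IsBlockIdempotent b) :
    P.MemBlock b ↔ IsIndecomposableModule (MonoidAlgebra R G) P.evalOne.asModule ∧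
      IsPermutationProjective P.evalOne ∧ ∀ v : P.evalOne.asModule, b • v = v := by
  have hsmul : ∀ v : P.evalOne.asModule, b • v = P.rho b (FinGSet.quot ⊥) v := fun v => by
    rw [← P.cohomological.asAlgebraHom_evalOne hb.1]
    rfl
  obtain ⟨X, i, r, h⟩ := hP.exists_retraction hI
  have hind := permFunctor.isIndecomposableModule_of_retraction i r h hI
  constructor
  · intro hPb
    refine ⟨hind, permFunctor.isPermutationProjective_of_retraction i r h, fun v => ?_⟩
    rw [hsmul, hPb]
    rfl
  · rintro ⟨-, -, hv⟩
    -- The idempotent `rho b` cannot be zero on `P`, because at `G/1` it is the identity of a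
    -- nonzero module.
    rcases hI.idempotent_eq_id_or_zero (ε := P.cohomological.rhoHom hb.1) fun Z m => by
      have := LinearMap.congr_fun (P.cohomological.rho_mul hb.1 hb.1 Z) m
      rw [hb.2.1.eq] at this
      exact this.symm with h1 | h1
    · exact fun Z => LinearMap.ext (h1 Z)
    · exfalso
      obtain ⟨v, hv0⟩ := @exists_ne _ hind.1 (0 : P.evalOne.asModule)
      exact hv0 ((hv v).symm.trans ((hsmul v).trans (h1 _ v)))

end CohomologicalMackeyFunctor

end

/-! ### Factors of subfunctors and simple subquotients. -/

noncomputable section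

open FinGSet MackeyFunctor

variable {R : Type u} [CommRing R] {G : Type u} [Group G]

namespace MackeyFunctor

variable {M N : MackeyFunctor R G} {L L' : Sub M} {S T : MackeyFunctor R G}

/-- `S` is isomorphic to the factor `L' / L` of subfunctors of `M`. -/
def Sub.IsFactor (L L' : Sub M) (S : MackeyFunctor R G) : Prop :=
  ∃ f : Hom L'.toFunctor S, f.IsSurjective ∧ ∀ X (m : L'.obj X), f.app X m = 0 ↔ m.1 ∈ L.obj X

theorem Sub.IsFactor.isIsomorphic (hS : Sub.IsFactor L L' S) (hT : Sub.IsFactor L L' T) :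
    S.IsIsomorphic T := by
  obtain ⟨f, hf, hf'⟩ := hS
  obtain ⟨g, hg, hg'⟩ := hT
  obtain ⟨h, hh⟩ := Hom.exists_factor hf g fun X m hm => (hg' X m).mpr ((hf' X m).mp hm)
  refine ⟨h, fun X => (injective_iff_map_eq_zero _).mpr fun s hs => ?_, fun X t => ?_⟩
  · obtain ⟨m, rfl⟩ := hf X s
    rw [hh] at hs
    exact (hf' X m).mpr ((hg' X m).mp hs)
  · obtain ⟨m, rfl⟩ := hg X t
    exact ⟨f.app X m, hh X m⟩

/-- The inclusion of a subfunctor into a larger one. -/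
def Sub.inclusion (h : L ≤ L') : Hom L.toFunctor L'.toFunctor where
  app X := Submodule.inclusion (h X)
  contra_comm _ := rfl
  co_comm _ := rfl

/-- The second isomorphism theorem; it provides the invariance of colours under perspectivity. -/
theorem Sub.IsFactor.inf_of_sup {a b : Sub M} (h : Sub.IsFactor b (a ⊔ b) S) :
    Sub.IsFactor (a ⊓ b) a S := by
  obtain ⟨f, hf, hf'⟩ := h
  refine ⟨f.comp (Sub.inclusion le_sup_left), fun X s => ?_, fun X m => ?_⟩
  · obtain ⟨⟨m, hm⟩, rfl⟩ := hf X s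
    obtain ⟨x, hx, y, hy, rfl⟩ := Submodule.mem_sup.mp hm
    refine ⟨⟨x, hx⟩, ?_⟩
    have h1 : f.app X ⟨y, Submodule.mem_sup_right hy⟩ = 0 := (hf' X _).mpr hy
    have h2 := map_add (f.app X) ⟨x, Submodule.mem_sup_left hx⟩ ⟨y, Submodule.mem_sup_right hy⟩
    rw [h1, add_zero] at h2
    exact h2.symm
  · exact (hf' X _).trans ⟨fun h => ⟨m.2, h⟩, fun h => h.2⟩

theorem Sub.IsFactor.covBy (hle : L ≤ L') (h : Sub.IsFactor L L' S) (hS : S.IsSimple) :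
    L ⋖ L' := by
  obtain ⟨f, hf, hf'⟩ := h
  refine ⟨lt_of_le_not_ge hle fun hge => ?_, fun K hLK hKL => ?_⟩
  · obtain ⟨X, s, hs⟩ := exists_ne_zero_of_not_isZero hS.1
    obtain ⟨m, rfl⟩ := hf X s
    exact hs ((hf' X m).mpr (hge X m.2))
  · have := isSimple_iff.mp hS
    rcases eq_bot_or_eq_top (Sub.map f (Sub.comap L'.incl K)) with h | h
    · refine hLK.not_ge fun X m hm => (hf' X ⟨m, hKL.le X hm⟩).mp ?_
      exact Sub.eq_bot_iff'.mp h X _ ⟨_, hm, rfl⟩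
    · refine hKL.not_ge fun X m hm => ?_
      obtain ⟨k, hk, hkm⟩ := Sub.eq_top_iff'.mp h X (f.app X ⟨m, hm⟩)
      obtain ⟨m', rfl⟩ : ∃ m' : L'.toFunctor.obj X, m'.1 = m := ⟨⟨m, hm⟩, rfl⟩
      have h1 : f.app X (m' - k) = 0 := by
        rw [map_sub, hkm]
        exact sub_self _
      have h2 := add_mem (hLK.le X ((hf' X _).mp h1)) hk
      have h3 : (m' - k).1 + k.1 = m'.1 := sub_add_cancel m'.1 k.1
      exact h3 ▸ h2

end MackeyFunctor
variable [Finite G]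

theorem ThevenazWebbBlock.of_eq_of_isIsomorphic {S T : CohomologicalMackeyFunctor R G}
    (hS : S.IsSimple) (hT : T.IsSimple) (h : S.IsIsomorphic T.toMackeyFunctor) :
    ThevenazWebbBlock.of S hS = ThevenazWebbBlock.of T hT :=
  Quotient.sound (Relation.EqvGen.rel _ _ (Or.inl h))

theorem ThevenazWebbBlock.of_eq_of_isSurjective {S T : CohomologicalMackeyFunctor R G}
    (hS : S.IsSimple) (hT : T.IsSimple) {f : Hom S.toMackeyFunctor T.toMackeyFunctor}
    (hf : f.IsSurjective) : ThevenazWebbBlock.of S hS = ThevenazWebbBlock.of T hT := by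
  refine of_eq_of_isIsomorphic hS hT ⟨f, (hS.hom_injective_or_zero f).resolve_right fun h => ?_, hf⟩
  obtain ⟨X, t, ht⟩ := exists_ne_zero_of_not_isZero hT.1
  obtain ⟨s, rfl⟩ := hf X t
  exact ht (h X s)

namespace CohomologicalMackeyFunctor

variable {L M N S T : CohomologicalMackeyFunctor R G} {p : ThevenazWebbBlock R G → Prop}

/-- All simple subquotients of `M` lie in blocks that satisfy `p`. -/
def SubquotientsIn (p : ThevenazWebbBlock R G → Prop) (M : CohomologicalMackeyFunctor R G) : Prop :=
  ∀ (S : CohomologicalMackeyFunctor R G) (hS : S.IsSimple), S.IsSubquotientOf M →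
    p (ThevenazWebbBlock.of S hS)

theorem IsSubquotientOf.of_isInjective (h : S.IsSubquotientOf N)
    {i : Hom N.toMackeyFunctor M.toMackeyFunctor} (hi : i.IsInjective) : S.IsSubquotientOf M := by
  obtain ⟨K, j, q, hj, hq⟩ := h
  exact ⟨K, i.comp j, q, fun X => (hi X).comp (hj X), hq⟩

theorem IsSubquotientOf.of_isSurjective (h : S.IsSubquotientOf N)
    {q : Hom M.toMackeyFunctor N.toMackeyFunctor} (hq : q.IsSurjective) : S.IsSubquotientOf M := by
  obtain ⟨K, j, r, hj, hr⟩ := h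
  let K' := Sub.comap q (Sub.map j ⊤)
  obtain ⟨g, hg⟩ := Hom.exists_lift hj (q.comp K'.incl) fun X k => by
    obtain ⟨n, -, hn⟩ := k.2
    exact ⟨n, hn⟩
  refine ⟨M.sub K', K'.incl, r.comp g, K'.incl_isInjective, fun X s => ?_⟩
  obtain ⟨k, rfl⟩ := hr X s
  obtain ⟨m, hm⟩ := hq X (j.app X k)
  refine ⟨⟨m, k, trivial, hm.symm⟩, congrArg (r.app X) (hj X ?_)⟩
  exact (hg X _).trans hm

/-- A nonzero subfunctor of `S` is all of `S`, so `T` is a quotient of `S` and hence isomorphic to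
it. -/
theorem of_eq_of_isSubquotientOf (hS : S.IsSimple) (hT : T.IsSimple)
    (h : T.IsSubquotientOf S) : ThevenazWebbBlock.of T hT = ThevenazWebbBlock.of S hS := by
  obtain ⟨K, j, q, hj, hq⟩ := h
  have hK : ¬ K.IsZero := fun h0 => hT.1 fun X => by
    have := h0 X
    exact (hq X).subsingleton
  have hj' : j.IsSurjective := (hS.hom_surjective_or_zero j).resolve_right fun h0 => by
    obtain ⟨X, k, hk⟩ := exists_ne_zero_of_not_isZero hK
    exact hk (hj X ((h0 X k).trans (map_zero _).symm))
  obtain ⟨g, hg⟩ := Hom.exists_lift hj (Hom.id S.toMackeyFunctor) fun X s => hj' X s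
  have hgs : g.IsSurjective := fun X k => ⟨j.app X k, hj X (hg X _)⟩
  exact (ThevenazWebbBlock.of_eq_of_isSurjective hS hT (f := q.comp g)
    fun X => (hq X).comp (hgs X)).symm

theorem subquotientsIn_of_isSimple (hS : S.IsSimple) (h : p (ThevenazWebbBlock.of S hS)) :
    SubquotientsIn p S := fun T hT hTS => by
  rwa [of_eq_of_isSubquotientOf hS hT hTS]

/-- There are no nonzero morphisms between functors without common blocks. -/
theorem SubquotientsIn.hom_eq_zero [IsNoetherianRing R] (hM : SubquotientsIn p M)
    (hN : SubquotientsIn (fun B => ¬ p B) N) (f : Hom M.toMackeyFunctor N.toMackeyFunctor)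
    (X : FinGSet G) (m : M.obj X) : f.app X m = 0 := by
  by_contra hne
  -- The image of `f` is a quotient of `M` and a subfunctor of `N`, so a simple subquotient of it
  -- would both satisfy and violate `p`.
  let K := Sub.map f ⊤
  obtain ⟨g, hg⟩ := Hom.exists_lift K.incl_isInjective f fun X m => ⟨⟨_, m, trivial, rfl⟩, rfl⟩
  have hgs : g.IsSurjective := fun X k => by
    obtain ⟨m, -, hm⟩ := k.2
    exact ⟨m, K.incl_isInjective X ((hg X m).trans hm)⟩
  obtain ⟨S, hS, hSK⟩ := exists_simple_subquotient (M := N.sub K) fun h0 => hne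
    (congrArg Subtype.val ((h0 X).elim ⟨f.app X m, m, trivial, rfl⟩ 0))
  exact hN S hS (hSK.of_isInjective K.incl_isInjective) (hM S hS (hSK.of_isSurjective (M := M) hgs))

end CohomologicalMackeyFunctor

end

/-! ### Splitting functors of finite length by blocks. -/

noncomputable section

open FinGSet MackeyFunctor

variable {R : Type u} [CommRing R] {G : Type u} [Group G] [Finite G]

namespace CohomologicalMackeyFunctor

variable {M N : CohomologicalMackeyFunctor R G} {p : ThevenazWebbBlock R G → Prop}

theorem exists_isFactor {a b : Sub M.toMackeyFunctor} (h : a ⋖ b) :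
    ∃ S : CohomologicalMackeyFunctor R G, S.IsSimple ∧ Sub.IsFactor a b S.toMackeyFunctor := by
  have hmap : Sub.map b.incl (Sub.comap b.incl a) = a := by
    rw [Sub.map_comap_eq, Sub.map_incl_top, inf_eq_right.mpr h.le]
  have hco : IsCoatom (Sub.comap b.incl a) := by
    refine ⟨fun htop => h.lt.not_ge fun X m hm => Sub.eq_top_iff'.mp htop X ⟨m, hm⟩,
      fun K hK => Sub.eq_top_iff'.mpr fun X m => ?_⟩
    have h1 : a ≤ Sub.map b.incl K := by
      conv_lhs => rw [← hmap]
      exact (Sub.gc_map_comap _).monotone_l hK.le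
    have h2 : Sub.map b.incl K ≤ b := by
      conv_rhs => rw [← Sub.map_incl_top b]
      exact (Sub.gc_map_comap _).monotone_l le_top
    rcases h.eq_or_eq h1 h2 with h3 | h3
    · exact absurd ((Sub.gc_map_comap _ _ _).mp h3.le) hK.not_ge
    · obtain ⟨k, hk, hkm⟩ : m.1 ∈ (Sub.map b.incl K).obj X := h3.symm ▸ m.2
      exact (b.incl_isInjective X hkm) ▸ hk
  exact ⟨(M.sub b).quot _, isSimple_quotient hco, quotientMk _, quotientMk_isSurjective _,
    fun X m => quotientMk_eq_zero⟩

/-- The covers whose factor lies in a block that satisfies `p`. -/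
def FactorIn (p : ThevenazWebbBlock R G → Prop) (a b : Sub M.toMackeyFunctor) : Prop :=
  ∃ (S : CohomologicalMackeyFunctor R G) (hS : S.IsSimple),
    Sub.IsFactor a b S.toMackeyFunctor ∧ p (ThevenazWebbBlock.of S hS)

theorem factorIn_iff {a b : Sub M.toMackeyFunctor} {S : CohomologicalMackeyFunctor R G}
    (hS : S.IsSimple) (h : Sub.IsFactor a b S.toMackeyFunctor) :
    FactorIn p a b ↔ p (ThevenazWebbBlock.of S hS) := by
  refine ⟨fun ⟨T, hT, hT', hp⟩ => ?_, fun hp => ⟨S, hS, h, hp⟩⟩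
  rwa [ThevenazWebbBlock.of_eq_of_isIsomorphic hS hT (h.isIsomorphic hT')]

theorem factorIn_inf_iff_sup {a b : Sub M.toMackeyFunctor} (h : a ⊓ b ⋖ a) :
    FactorIn p (a ⊓ b) a ↔ FactorIn p b (a ⊔ b) := by
  obtain ⟨S, hS, hSf⟩ := exists_isFactor (covBy_sup_of_inf_covBy_left h)
  rw [factorIn_iff hS hSf, factorIn_iff hS hSf.inf_of_sup]

/-- `d/a` is an extension of `d/b` by `b/a`, two simple functors in different Thévenaz–Webb blocks,
so it splits. The preimage in `d` of the image of a section is the element `b'`. -/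
theorem exists_relative_complement {a b d : Sub M.toMackeyFunctor} (hab : a ⋖ b) (hbd : b ⋖ d)
    (h : ¬ (FactorIn p a b ↔ FactorIn p b d)) : ∃ b', a ≤ b' ∧ b' ⊓ b = a ∧ b' ⊔ b = d := by
  obtain ⟨S, hS, f, hf, hf'⟩ := exists_isFactor hab
  obtain ⟨T, hT, g, hg, hg'⟩ := exists_isFactor hbd
  rw [factorIn_iff hS ⟨f, hf, hf'⟩, factorIn_iff hT ⟨g, hg, hg'⟩] at h
  let π : Hom d.toFunctor (d.toFunctor.quotient (Sub.comap d.incl a)) := quotientMk _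
  have hπ : ∀ {X} {m : d.toFunctor.obj X}, π.app X m = 0 ↔ m.1 ∈ a.obj X := quotientMk_eq_zero
  obtain ⟨i, hi⟩ := Hom.exists_factor hf (π.comp (Sub.inclusion hbd.le)) fun X m hm =>
    hπ.mpr ((hf' X m).mp hm)
  obtain ⟨q, hq⟩ := Hom.exists_factor (quotientMk_isSurjective _) g fun X m hm =>
    (hg' X m).mpr (hab.le X (hπ.mp hm))
  have hex : IsShortExact i q := by
    refine ⟨fun X => (injective_iff_map_eq_zero _).mpr fun s hs => ?_, fun X e => ?_, fun X t => ?_⟩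
    · obtain ⟨m, rfl⟩ := hf X s
      exact (hf' X m).mpr (hπ.mp ((hi X m).symm.trans hs))
    · obtain ⟨m, rfl⟩ := quotientMk_isSurjective _ X e
      constructor
      · intro he
        rw [hq] at he
        exact ⟨f.app X ⟨m.1, (hg' X m).mp he⟩, hi X _⟩
      · rintro ⟨s, hs⟩
        obtain ⟨m', rfl⟩ := hf X s
        rw [← hs, hi]
        exact (hq X _).trans ((hg' X _).mpr m'.2)
    · obtain ⟨m, rfl⟩ := hg X t
      exact ⟨π.app X m, hq X m⟩
  have hsplit : q.Splits := by
    by_contra hns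
    refine h ?_
    have : ThevenazWebbBlock.of S hS = ThevenazWebbBlock.of T hT := Quotient.sound
      (Relation.EqvGen.rel _ _ (Or.inr ⟨(M.sub d).quot (Sub.comap d.incl a), i, q, hex, hns⟩))
    rw [this]
  obtain ⟨s, hs⟩ := hsplit
  have hqs : ∀ X t, q.app X (s.app X t) = t := fun X t => LinearMap.congr_fun (hs X) t
  refine ⟨Sub.map d.incl (Sub.comap π (Sub.map s ⊤)), ?_, le_antisymm ?_ ?_, le_antisymm ?_ ?_⟩
  · intro X m hm
    refine ⟨⟨m, hbd.le X (hab.le X hm)⟩, ⟨0, trivial, ?_⟩, rfl⟩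
    rw [map_zero]
    exact (hπ.mpr hm).symm
  · rintro X m ⟨⟨m', ⟨t, -, ht⟩, rfl⟩, hmb⟩
    have h1 : t = 0 := by
      rw [← hqs X t, ht]
      exact (hq X m').trans ((hg' X m').mpr hmb)
    rw [h1, map_zero] at ht
    exact hπ.mp ht.symm
  · intro X m hm
    refine ⟨⟨⟨m, hbd.le X (hab.le X hm)⟩, ⟨0, trivial, ?_⟩, rfl⟩, hab.le X hm⟩
    rw [map_zero]
    exact (hπ.mpr hm).symm
  · refine sup_le ?_ hbd.le
    rintro X _ ⟨m, -, rfl⟩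
    exact m.2
  · intro X m hm
    obtain ⟨m, rfl⟩ : ∃ m' : d.toFunctor.obj X, m'.1 = m := ⟨⟨m, hm⟩, rfl⟩
    obtain ⟨m', hm'⟩ := quotientMk_isSurjective _ X (s.app X (g.app X m))
    have h1 : (m - m').1 ∈ b.obj X := (hg' X _).mp (by
      rw [map_sub, ← hq X m', hm', hqs]
      exact sub_self _)
    refine Submodule.mem_sup.mpr ⟨m'.1, ⟨m', ⟨g.app X m, trivial, hm'.symm⟩, rfl⟩, _, h1, ?_⟩
    exact add_sub_cancel m'.1 m.1

/-- A simple quotient of a subfunctor of `x` is the factor of a cover below `x`: the image of that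
subfunctor over the image of the kernel. -/
theorem subquotientsIn_of_coversBelow {x : Sub M.toMackeyFunctor}
    (h : CoversBelow (FactorIn p) x) : SubquotientsIn p (M.sub x) := by
  rintro S hS ⟨K, i, q, hi, hq⟩
  let j : Hom K.toMackeyFunctor M.toMackeyFunctor := x.incl.comp i
  have hj : j.IsInjective := fun X => (x.incl_isInjective X).comp (hi X)
  let b := Sub.map j ⊤
  obtain ⟨g, hg⟩ := Hom.exists_lift hj b.incl fun X m => by
    obtain ⟨k, -, hk⟩ := m.2
    exact ⟨k, hk⟩
  have hfac : Sub.IsFactor (Sub.map j (Sub.comap q ⊥)) b S.toMackeyFunctor := by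
    refine ⟨q.comp g, fun X s => ?_, fun X m => ?_⟩
    · obtain ⟨k, rfl⟩ := hq X s
      exact ⟨⟨j.app X k, k, trivial, rfl⟩, congrArg (q.app X) (hj X (hg X _))⟩
    · constructor
      · intro hm
        exact ⟨g.app X m, Sub.mem_bot.mpr hm, hg X m⟩
      · rintro ⟨k, hk, hkm⟩
        have h1 : g.app X m = k := hj X ((hg X m).trans hkm.symm)
        change q.app X (g.app X m) = 0
        rw [h1]
        exact Sub.mem_bot.mp hk
  have hle : Sub.map j (Sub.comap q ⊥) ≤ b := (Sub.gc_map_comap j).monotone_l le_top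
  refine (factorIn_iff hS hfac).mp (h _ _ (hfac.covBy hle hS) ?_)
  rintro X _ ⟨k, -, rfl⟩
  exact (i.app X k).2

/-- A functor of finite length is the direct sum of a part with all simple subquotients in blocks
that satisfy `p` and a part with none. -/
theorem exists_isCompl_subquotientsIn [WellFoundedLT (Sub M.toMackeyFunctor)]
    [WellFoundedGT (Sub M.toMackeyFunctor)] (p : ThevenazWebbBlock R G → Prop) :
    ∃ x y : Sub M.toMackeyFunctor, IsCompl x y ∧ SubquotientsIn p (M.sub x) ∧
      SubquotientsIn (fun B => ¬ p B) (M.sub y) := by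
  obtain ⟨x, y, hxy, hx, hy⟩ := exists_isCompl_coversBelow (c := FactorIn (M := M) p)
    (fun _ _ h => factorIn_inf_iff_sup h) fun _ _ _ => exists_relative_complement
  refine ⟨x, y, hxy, subquotientsIn_of_coversBelow hx, subquotientsIn_of_coversBelow ?_⟩
  intro a b hab hb
  obtain ⟨S, hS, hSf⟩ := exists_isFactor hab
  exact (factorIn_iff hS hSf).mpr fun hp => hy a b hab hb ((factorIn_iff hS hSf).mpr hp)

end CohomologicalMackeyFunctor

end

/-! ### Projections onto blocks and their naturality. -/

noncomputable section

open FinGSet MackeyFunctor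

/-- For positive `n` every prime containing the power contains the maximal ideal, which is thus a
minimal prime over it; for `n = 0` the quotient is the zero ring. -/
theorem IsLocalRing.isArtinianRing_quotient_pow (R : Type*) [CommRing R] [IsLocalRing R]
    [IsNoetherianRing R] (n : ℕ) : IsArtinianRing (R ⧸ IsLocalRing.maximalIdeal R ^ n) := by
  rcases n.eq_zero_or_pos with rfl | hn
  · have : Subsingleton (R ⧸ IsLocalRing.maximalIdeal R ^ 0) := by
      rw [pow_zero, Ideal.one_eq_top]
      infer_instance
    infer_instance
  · refine IsLocalRing.quotient_artinian_of_mem_minimalPrimes_of_isLocalRing _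
      ⟨⟨inferInstance, Ideal.pow_le_self hn.ne'⟩, fun J hJ _ => ?_⟩
    have := hJ.1
    exact hJ.1.le_of_pow_le hJ.2

theorem isArtinian_quotient_smul_top {R V : Type*} [CommRing R] [AddCommGroup V] [Module R V]
    [Module.Finite R V] (I : Ideal R) [IsArtinianRing (R ⧸ I)] :
    IsArtinian R (V ⧸ (I • ⊤ : Submodule R V)) := by
  have : Module.Finite (R ⧸ I) (V ⧸ (I • ⊤ : Submodule R V)) :=
    Module.Finite.of_restrictScalars_finite R _ _
  have : IsArtinian (R ⧸ I) (V ⧸ (I • ⊤ : Submodule R V)) := inferInstance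
  exact isArtinian_of_surjective_algebraMap (R := R ⧸ I) (Ideal.Quotient.mk_surjective (I := I))

variable {R : Type u} [CommRing R] {G : Type u} [Group G]

namespace MackeyFunctor

/-- The subfunctor `I M`, for an ideal `I` of the coefficient ring. -/
def Sub.smulTop (M : MackeyFunctor R G) (I : Ideal R) : Sub M where
  obj X := I • ⊤
  contra_mem f m hm := by
    have := Submodule.mem_map_of_mem (f := M.contra f) hm
    rw [Submodule.map_smul''] at this
    exact Submodule.smul_mono le_rfl le_top this
  co_mem f m hm := by
    have := Submodule.mem_map_of_mem (f := M.co f) hm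
    rw [Submodule.map_smul''] at this
    exact Submodule.smul_mono le_rfl le_top this

/-- Reduction modulo an ideal. -/
theorem Hom.exists_quotient_smulTop {M N : MackeyFunctor R G} (f : Hom M N) {I J : Ideal R} (h : I ≤ J) :
    ∃ g : Hom (M.quotient (Sub.smulTop M I)) (N.quotient (Sub.smulTop N J)),
      ∀ X m, g.app X ((quotientMk _).app X m) = (quotientMk _).app X (f.app X m) :=
  Hom.exists_factor (quotientMk_isSurjective _) ((quotientMk (Sub.smulTop N J)).comp f)
    fun X m hm => quotientMk_eq_zero.mpr (by
      have := Submodule.mem_map_of_mem (f := f.app X) (quotientMk_eq_zero.mp hm)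
      exact Submodule.smul_mono h le_top ((Submodule.map_smul'' _ _ _).le this))

theorem wellFoundedLT_quotient_smulTop [Finite G] {M : MackeyFunctor R G} [IsFiniteType M]
    (I : Ideal R) [IsArtinianRing (R ⧸ I)] :
    WellFoundedLT (Sub (M.quotient (Sub.smulTop M I))) := by
  have : IsArtinian R ((M.quotient (Sub.smulTop M I)).obj (omega G)) :=
    isArtinian_quotient_smul_top I
  exact Sub.wellFoundedLT

/-- The projections of a direct sum decomposition. -/
theorem Sub.exists_projection {M : MackeyFunctor R G} {x y : Sub M} (h : IsCompl x y) :
    ∃ e : Hom M M, ∀ X m, e.app X m ∈ x.obj X ∧ m - e.app X m ∈ y.obj X := by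
  have hX := Sub.isCompl_obj_iff.mpr h
  -- Components in a direct sum are unique, and this makes the pointwise projections commute with
  -- restriction and transfer.
  have huniq : ∀ {X} (m a b : M.obj X), a ∈ x.obj X → m - a ∈ y.obj X → b ∈ x.obj X →
      m - b ∈ y.obj X → a = b := fun {X} m a b ha ha' hb hb' => by
    have h1 : a - b ∈ y.obj X := by
      have := sub_mem hb' ha'
      rwa [sub_sub_sub_cancel_left] at this
    exact sub_eq_zero.mp ((Submodule.disjoint_def.mp (hX X).1) _ (sub_mem ha hb) h1)
  have hy : ∀ X (m : M.obj X), m - (x.obj X).projection _ (hX X) m ∈ y.obj X := fun X m => by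
    rw [← Submodule.projection_apply_eq_zero_iff (hX X), map_sub,
      Submodule.projection_apply_of_mem_left (hX X) (Submodule.projection_apply_mem (hX X) m), sub_self]
  refine ⟨⟨fun X => (x.obj X).projection _ (hX X), fun {X Y} f => LinearMap.ext fun m => ?_,
    fun {X Y} f => LinearMap.ext fun m => ?_⟩, fun X m => ⟨Submodule.projection_apply_mem (hX X) m,
      hy X m⟩⟩
  · refine huniq (M.contra f m) _ _ (Submodule.projection_apply_mem (hX X) _) (hy X _)
      (x.contra_mem f _ (Submodule.projection_apply_mem (hX Y) _)) ?_
    rw [LinearMap.comp_apply, ← map_sub]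
    exact y.contra_mem f _ (hy Y m)
  · refine huniq (M.co f m) _ _ (Submodule.projection_apply_mem (hX Y) _) (hy Y _)
      (x.co_mem f _ (Submodule.projection_apply_mem (hX X) _)) ?_
    rw [LinearMap.comp_apply, ← map_sub]
    exact y.co_mem f _ (hy X m)

/-- The difference of the identity and an endomorphism. -/
def Hom.idSub {M : MackeyFunctor R G} (e : Hom M M) : Hom M M where
  app X := LinearMap.id - e.app X
  contra_comm f := by
    rw [LinearMap.sub_comp, LinearMap.comp_sub, e.contra_comm, LinearMap.id_comp, LinearMap.comp_id]
  co_comm f := by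
    rw [LinearMap.sub_comp, LinearMap.comp_sub, e.co_comm, LinearMap.id_comp, LinearMap.comp_id]

end MackeyFunctor

namespace CohomologicalMackeyFunctor

variable [Finite G] {M N : CohomologicalMackeyFunctor R G} {p : ThevenazWebbBlock R G → Prop}

/-- `e` is the projection to the part of `M` in the blocks that satisfy `p`, along the part in the
other blocks. -/
def IsBlockProjection (p : ThevenazWebbBlock R G → Prop) (e : Hom M.toMackeyFunctor M.toMackeyFunctor) :
    Prop :=
  ∃ x y : Sub M.toMackeyFunctor, SubquotientsIn p (M.sub x) ∧
    SubquotientsIn (fun B => ¬ p B) (M.sub y) ∧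
    ∀ X m, e.app X m ∈ x.obj X ∧ m - e.app X m ∈ y.obj X

theorem exists_isBlockProjection [WellFoundedLT (Sub M.toMackeyFunctor)]
    [WellFoundedGT (Sub M.toMackeyFunctor)] (p : ThevenazWebbBlock R G → Prop) :
    ∃ e : Hom M.toMackeyFunctor M.toMackeyFunctor, IsBlockProjection p e := by
  obtain ⟨x, y, hxy, hx, hy⟩ := exists_isCompl_subquotientsIn (M := M) p
  obtain ⟨e, he⟩ := Sub.exists_projection hxy
  exact ⟨e, x, y, hx, hy, he⟩

theorem SubquotientsIn.hom_eq_zero_of_mem [IsNoetherianRing R] {x : Sub M.toMackeyFunctor}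
    {y : Sub N.toMackeyFunctor} (hx : SubquotientsIn p (M.sub x))
    (hy : SubquotientsIn (fun B => ¬ p B) (N.sub y)) (f : Hom M.toMackeyFunctor N.toMackeyFunctor)
    (hf : ∀ X m, f.app X m ∈ y.obj X) {X : FinGSet G} {m : M.obj X} (hm : m ∈ x.obj X) :
    f.app X m = 0 := by
  obtain ⟨g, hg⟩ := Hom.exists_lift y.incl_isInjective (f.comp x.incl) fun X m =>
    ⟨⟨_, hf X m.1⟩, rfl⟩
  have h1 := hx.hom_eq_zero (N := N.sub y) hy g X ⟨m, hm⟩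
  have h2 := hg X ⟨m, hm⟩
  rw [show g.app X ⟨m, hm⟩ = 0 from h1, map_zero] at h2
  exact h2.symm

/-- There are no nonzero morphisms between the `p`-part and the other part in either direction, so
`(1 - e') f` kills the first part of `M` and `e' f` kills the second. -/
theorem IsBlockProjection.naturality [IsNoetherianRing R]
    {e : Hom M.toMackeyFunctor M.toMackeyFunctor} {e' : Hom N.toMackeyFunctor N.toMackeyFunctor}
    (he : IsBlockProjection p e) (he' : IsBlockProjection p e')
    (f : Hom M.toMackeyFunctor N.toMackeyFunctor) {X : FinGSet G} (m : M.obj X) :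
    e'.app X (f.app X m) = f.app X (e.app X m) := by
  obtain ⟨x, y, hx, hy, he⟩ := he
  obtain ⟨x', y', hx', hy', he'⟩ := he'
  have h1 := hx.hom_eq_zero_of_mem hy' (e'.idSub.comp f) (fun X m => (he' X _).2) (he X m).1
  have h2 := hy.hom_eq_zero_of_mem (p := fun B => ¬ p B) (y := x') (by simpa only [not_not] using hx')
    (e'.comp f) (fun X m => (he' X _).1) (he X m).2
  change f.app X (e.app X m) - e'.app X (f.app X (e.app X m)) = 0 at h1
  change e'.app X (f.app X (m - e.app X m)) = 0 at h2
  rw [map_sub, map_sub, sub_eq_zero] at h2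
  rw [h2, ← sub_eq_zero.mp h1]

theorem IsBlockProjection.app_app [IsNoetherianRing R]
    {e : Hom M.toMackeyFunctor M.toMackeyFunctor} (he : IsBlockProjection p e) {X : FinGSet G}
    (m : M.obj X) : e.app X (e.app X m) = e.app X m := by
  obtain ⟨x, y, hx, hy, he⟩ := he
  have h1 := hx.hom_eq_zero_of_mem hy e.idSub (fun X m => (he X _).2) (he X m).1
  exact (sub_eq_zero.mp h1).symm

theorem IsBlockProjection.map_app_eq [IsNoetherianRing R]
    {e : Hom M.toMackeyFunctor M.toMackeyFunctor} (he : IsBlockProjection p e)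
    (hN : SubquotientsIn p N) (f : Hom M.toMackeyFunctor N.toMackeyFunctor) {X : FinGSet G}
    (m : M.obj X) : f.app X (e.app X m) = f.app X m := by
  obtain ⟨x, y, hx, hy, he⟩ := he
  have h2 := hy.hom_eq_zero (N := N) (by simpa only [not_not] using hN) (f.comp y.incl) X
    ⟨_, (he X m).2⟩
  change f.app X (m - e.app X m) = 0 at h2
  rw [map_sub, sub_eq_zero] at h2
  exact h2.symm

theorem IsBlockProjection.map_eq_zero [IsNoetherianRing R]
    {e : Hom M.toMackeyFunctor M.toMackeyFunctor} (he : IsBlockProjection p e)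
    (hN : SubquotientsIn (fun B => ¬ p B) N) (f : Hom M.toMackeyFunctor N.toMackeyFunctor)
    {X : FinGSet G} (m : M.obj X) : f.app X (e.app X m) = 0 := by
  obtain ⟨x, y, hx, hy, he⟩ := he
  exact hx.hom_eq_zero hN (f.comp x.incl) X ⟨_, (he X m).1⟩

end CohomologicalMackeyFunctor

end

/-! ### Reduction modulo powers of the maximal ideal, and the limit. -/

noncomputable section

open FinGSet MackeyFunctor

variable {R : Type u} [CommRing R] [IsLocalRing R] {G : Type u} [Group G] [Finite G]

namespace CohomologicalMackeyFunctor

/-- The reduction of a representable functor modulo a power of the maximal ideal. -/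
def redPerm (R : Type u) [CommRing R] [IsLocalRing R] {G : Type u} [Group G] [Finite G]
    (X : FinGSet G) (n : ℕ) : CohomologicalMackeyFunctor R G :=
  (cohPerm R X).quot (Sub.smulTop _ (IsLocalRing.maximalIdeal R ^ n))

/-- The reduction map. -/
def redMk (R : Type u) [CommRing R] [IsLocalRing R] {G : Type u} [Group G] [Finite G]
    (X : FinGSet G) (n : ℕ) : Hom (permFunctor R X) (redPerm R X n).toMackeyFunctor :=
  quotientMk _

theorem redMk_isSurjective (X : FinGSet G) (n : ℕ) : (redMk R X n).IsSurjective :=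
  quotientMk_isSurjective _

theorem redMk_eq_iff {X Z : FinGSet G} {n : ℕ} {a b : (permFunctor R X).obj Z} :
    (redMk R X n).app Z a = (redMk R X n).app Z b ↔
      a ≡ b [SMOD (IsLocalRing.maximalIdeal R ^ n • ⊤ : Submodule R ((permFunctor R X).obj Z))] := by
  rw [SModEq.sub_mem, ← sub_eq_zero, ← map_sub]
  exact quotientMk_eq_zero

theorem exists_redPerm_hom {X Z : FinGSet G} (f : Hom (permFunctor R X) (permFunctor R Z)) {m n : ℕ}
    (h : m ≤ n) : ∃ g : Hom (redPerm R X n).toMackeyFunctor (redPerm R Z m).toMackeyFunctor,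
      ∀ W w, g.app W ((redMk R X n).app W w) = (redMk R Z m).app W (f.app W w) :=
  f.exists_quotient_smulTop (Ideal.pow_le_pow_right h)

/-- The maximal ideal annihilates `S`, so the first reduction already controls the simple functors.
-/
theorem _root_.MackeyFunctor.IsSimple.exists_factor_redMk {S : MackeyFunctor R G} (hS : S.IsSimple)
    [IsFiniteType S] {X : FinGSet G} (f : Hom (permFunctor R X) S) :
    ∃ g : Hom (redPerm R X 1).toMackeyFunctor S, ∀ Z m, g.app Z ((redMk R X 1).app Z m) = f.app Z m :=
  Hom.exists_factor (redMk_isSurjective X 1) f fun Z m hm => by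
    have h1 := Submodule.mem_map_of_mem (f := f.app Z) (quotientMk_eq_zero.mp hm)
    refine Submodule.smul_induction_on (Submodule.map_smul'' _ _ _ |>.le h1) (fun r hr s _ => ?_)
      fun s t hs ht => ?_
    · exact hS.smul_eq_zero (by rwa [pow_one] at hr) s
    · rw [hs, ht, add_zero]

variable [IsNoetherianRing R] {p : ThevenazWebbBlock R G → Prop}

/-- The values of the reduction are finitely generated over an artinian quotient of `R`, so both
chain conditions hold and the splitting by blocks applies. -/
theorem exists_redPerm_isBlockProjection (p : ThevenazWebbBlock R G → Prop) (X : FinGSet G)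
    (n : ℕ) : ∃ e : Hom (redPerm R X n).toMackeyFunctor (redPerm R X n).toMackeyFunctor,
      IsBlockProjection p e := by
  have := IsLocalRing.isArtinianRing_quotient_pow R n
  have h1 : WellFoundedLT (Sub (redPerm R X n).toMackeyFunctor) :=
    wellFoundedLT_quotient_smulTop (M := permFunctor R X) _
  have h2 : WellFoundedGT (Sub (redPerm R X n).toMackeyFunctor) :=
    inferInstanceAs (WellFoundedGT (Sub ((permFunctor R X).quotient
      (Sub.smulTop (permFunctor R X) (IsLocalRing.maximalIdeal R ^ n)))))
  exact exists_isBlockProjection p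

/-- `E` reduces to the block projections of all the `redPerm R X n`. -/
def IsUniversalProjection (p : ThevenazWebbBlock R G → Prop)
    (E : ∀ X : FinGSet G, (permFunctor R X).obj X) : Prop :=
  ∀ X n (e : Hom (redPerm R X n).toMackeyFunctor (redPerm R X n).toMackeyFunctor),
    IsBlockProjection p e →
      e.app X ((redMk R X n).app X (permFunctor.one R X)) = (redMk R X n).app X (E X)

namespace IsUniversalProjection

variable {E : ∀ X : FinGSet G, (permFunctor R X).obj X}

theorem act_eq_self (hE : IsUniversalProjection p E) {S : CohomologicalMackeyFunctor R G}
    (hS : S.IsSimple) (hp : p (ThevenazWebbBlock.of S hS)) {X : FinGSet G} (s : S.obj X) :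
    S.act (permFunctor.mat (E X)) s = s := by
  have := S.cohomological.isFiniteType_of_isSimple hS
  obtain ⟨e, he⟩ := exists_redPerm_isBlockProjection (R := R) p X 1
  obtain ⟨g, hg⟩ := hS.exists_factor_redMk (S.cohomological.yoneda s)
  have h1 := he.map_app_eq (subquotientsIn_of_isSimple hS hp) g
    ((redMk R X 1).app X (permFunctor.one R X))
  rw [hE X 1 e he, hg, hg, S.cohomological.yoneda_one] at h1
  exact h1

theorem act_eq_zero (hE : IsUniversalProjection p E) {S : CohomologicalMackeyFunctor R G}
    (hS : S.IsSimple) (hp : ¬ p (ThevenazWebbBlock.of S hS)) {X : FinGSet G} (s : S.obj X) :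
    S.act (permFunctor.mat (E X)) s = 0 := by
  have := S.cohomological.isFiniteType_of_isSimple hS
  obtain ⟨e, he⟩ := exists_redPerm_isBlockProjection (R := R) p X 1
  obtain ⟨g, hg⟩ := hS.exists_factor_redMk (S.cohomological.yoneda s)
  have h1 := he.map_eq_zero (subquotientsIn_of_isSimple (p := fun B => ¬ p B) hS hp) g
    ((redMk R X 1).app X (permFunctor.one R X))
  rw [hE X 1 e he, hg] at h1
  exact h1

end IsUniversalProjection

variable [IsAdicComplete (IsLocalRing.maximalIdeal R) R]

/-- Lift the image of the identity under each block projection to `permFunctor R X`. Naturality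
along the reduction maps makes the lifts a Cauchy sequence, and `E X` is its limit. -/
theorem exists_isUniversalProjection (p : ThevenazWebbBlock R G → Prop) :
    ∃ E, IsUniversalProjection p E := by
  suffices H : ∀ X : FinGSet G, ∃ E : (permFunctor R X).obj X, ∀ n
      (e : Hom (redPerm R X n).toMackeyFunctor (redPerm R X n).toMackeyFunctor),
      IsBlockProjection p e →
        e.app X ((redMk R X n).app X (permFunctor.one R X)) = (redMk R X n).app X E by
    choose E hE using H
    exact ⟨E, hE⟩
  intro X
  choose e he using exists_redPerm_isBlockProjection (R := R) p X
  choose a ha using fun n => redMk_isSurjective X n X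
    ((e n).app X ((redMk R X n).app X (permFunctor.one R X)))
  have hnat : ∀ m n, m ≤ n → ∀ e' : Hom (redPerm R X m).toMackeyFunctor (redPerm R X m).toMackeyFunctor,
      IsBlockProjection p e' → e'.app X ((redMk R X m).app X (permFunctor.one R X)) =
        (redMk R X m).app X (a n) := fun m n hmn e' he' => by
    obtain ⟨g, hg⟩ := exists_redPerm_hom (Hom.id (permFunctor R X)) hmn
    have h1 := (he n).naturality he' g ((redMk R X n).app X (permFunctor.one R X))
    rw [← ha n] at h1
    rwa [hg, hg] at h1
  have hc := isAdicComplete_of_finite (R := R) ((permFunctor R X).obj X)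
  obtain ⟨E, hE⟩ := hc.prec' a fun {m n} hmn => redMk_eq_iff.mp
    ((ha m).trans (hnat m n hmn _ (he m)))
  exact ⟨E, fun n e' he' => (hnat n n le_rfl e' he').trans (redMk_eq_iff.mpr (hE n))⟩

theorem permFunctor_eq_of_redMk {X Z : FinGSet G} {a b : (permFunctor R X).obj Z}
    (h : ∀ n, (redMk R X n).app Z a = (redMk R X n).app Z b) : a = b := by
  have hc := isAdicComplete_of_finite (R := R) ((permFunctor R X).obj Z)
  refine sub_eq_zero.mp (hc.haus' _ fun n => ?_)
  rw [SModEq.zero]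
  exact SModEq.sub_mem.mp (redMk_eq_iff.mp (h n))

namespace IsUniversalProjection

variable {E : ∀ X : FinGSet G, (permFunctor R X).obj X}

/-- Modulo each power of the maximal ideal this is naturality of the block projections along the
Yoneda morphism of `b`; separatedness removes the reduction. -/
theorem mul_comm (hE : IsUniversalProjection p E) {Z X : FinGSet G}
    (b : (permFunctor R X).obj Z) :
    permFunctor.mat (E Z) * permFunctor.mat b = permFunctor.mat b * permFunctor.mat (E X) := by
  rw [← mat_yoneda_app b (E Z), ← mat_yoneda_app (E X) b]
  congr 1
  refine permFunctor_eq_of_redMk fun n => ?_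
  obtain ⟨e, he⟩ := exists_redPerm_isBlockProjection (R := R) p X n
  obtain ⟨e', he'⟩ := exists_redPerm_isBlockProjection (R := R) p Z n
  obtain ⟨g, hg⟩ := exists_redPerm_hom (permFunctor.isCohomological.yoneda b) le_rfl
  rw [← hg, ← hE Z n e' he', ← he'.naturality he g, hg]
  rw [permFunctor.isCohomological.yoneda_one]
  have h1 : (redMk R X n).app Z b =
      (redPerm R X n).act (permFunctor.mat b) ((redMk R X n).app X (permFunctor.one R X)) :=
    Hom.app_permFunctor _ b
  rw [h1, Hom.app_act, hE X n e he, ← Hom.app_act]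
  rfl

theorem mul_self (hE : IsUniversalProjection p E) (X : FinGSet G) :
    permFunctor.mat (E X) * permFunctor.mat (E X) = permFunctor.mat (E X) := by
  rw [← mat_yoneda_app (E X) (E X)]
  congr 1
  refine permFunctor_eq_of_redMk fun n => ?_
  obtain ⟨e, he⟩ := exists_redPerm_isBlockProjection (R := R) p X n
  have h1 : (redMk R X n).app X (E X) =
      (redPerm R X n).act (permFunctor.mat (E X)) ((redMk R X n).app X (permFunctor.one R X)) :=
    Hom.app_permFunctor _ (E X)
  have h2 : e.app X ((redMk R X n).app X (E X)) = (redMk R X n).app X (E X) := by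
    rw [← hE X n e he, he.app_app]
  conv_rhs => rw [← h2, h1, Hom.app_act, hE X n e he, ← Hom.app_act]
  rfl

end IsUniversalProjection

end CohomologicalMackeyFunctor

end

/-! ### Central idempotents and the bijection between blocks. -/

noncomputable section

open FinGSet MackeyFunctor CohomologicalMackeyFunctor

variable {R : Type u} [CommRing R] {G : Type u} [Group G] [Finite G]

/-- On `G/1` the entry at `(a, g)` is the coefficient of `g a⁻¹`, so invariance says that the
coefficients of `z` are constant on conjugacy classes. -/
theorem mem_center_of_isInvariantMatrix {z : MonoidAlgebra R G}
    (h : IsInvariantMatrix (permMatrix z (FinGSet.quot (⊥ : Subgroup G)))) :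
    z ∈ Subring.center (MonoidAlgebra R G) := by
  classical
  have := Fintype.ofFinite G
  have hcoeff : ∀ a g : G, permMatrix z (FinGSet.quot (⊥ : Subgroup G))
      (QuotientGroup.mk a : G ⧸ (⊥ : Subgroup G)) (QuotientGroup.mk g : G ⧸ (⊥ : Subgroup G)) =
        z.coeff (g * a⁻¹) := fun a g => by
    refine (permMatrix_eq_sum z (FinGSet.quot ⊥) _ _).trans ?_
    rw [Finset.sum_eq_single (g * a⁻¹)]
    · exact if_pos (congrArg QuotientGroup.mk (inv_mul_cancel_right g a))
    · intro h _ hh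
      refine if_neg fun he => hh ?_
      have he' : h * a = g := mk_bot_injective he
      rw [← he', mul_inv_cancel_right]
    · exact fun h => absurd (Finset.mem_univ _) h
  have hconj : ∀ a g : G, z.coeff (a * g * a⁻¹) = z.coeff g := fun a g => by
    have h1 := h a (QuotientGroup.mk 1 : G ⧸ (⊥ : Subgroup G)) (QuotientGroup.mk g : G ⧸ (⊥ : Subgroup G))
    have h2 := hcoeff 1 g
    rw [inv_one, mul_one] at h2
    have h3 := hcoeff a (a * g)
    rw [← h2, ← h3, ← h1]
    exact congrArg (fun t => permMatrix z (FinGSet.quot (⊥ : Subgroup G)) t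
      (QuotientGroup.mk (a * g) : G ⧸ (⊥ : Subgroup G))) (congrArg QuotientGroup.mk (mul_one a).symm)
  refine Subring.mem_center_iff.mpr fun w => ?_
  induction w using MonoidAlgebra.induction_linear with
  | zero => rw [zero_mul, mul_zero]
  | add v w hv hw => rw [add_mul, mul_add, hv, hw]
  | single a r =>
    ext g
    have := hconj a (a⁻¹ * g)
    rw [mul_inv_cancel_left] at this
    simp [this, mul_comm r]

theorem ext_permMatrix {z w : MonoidAlgebra R G} (h : permMatrix z (FinGSet.quot (⊥ : Subgroup G)) =
    permMatrix w (FinGSet.quot (⊥ : Subgroup G))) : z = w := by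
  ext g
  rw [← permMatrix_quot_bot, h]
  exact permMatrix_quot_bot w g

namespace CohomologicalMackeyFunctor

variable [IsLocalRing R] [IsNoetherianRing R] [IsAdicComplete (IsLocalRing.maximalIdeal R) R]
  {p : ThevenazWebbBlock R G → Prop}

/-- The coefficients of `z` are read off from the row at `1` of `E` on `G/1`. Commutation with the
matrix of `pointMap x` carries this row to the row `x` of `E X`. -/
theorem IsUniversalProjection.exists_permMatrix_eq {E : ∀ X : FinGSet G, (permFunctor R X).obj X}
    (hE : IsUniversalProjection p E) :
    ∃ z : MonoidAlgebra R G, ∀ X, permMatrix z X = permFunctor.mat (E X) := by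
  classical
  have := Fintype.ofFinite G
  let o : FinGSet.quot (⊥ : Subgroup G) := (QuotientGroup.mk 1 : G ⧸ (⊥ : Subgroup G))
  refine ⟨MonoidAlgebra.ofCoeff (Finsupp.equivFunOnFinite.symm fun g =>
    permFunctor.mat (E (FinGSet.quot ⊥)) o (QuotientGroup.mk g : G ⧸ (⊥ : Subgroup G))), fun X => ?_⟩
  ext x y
  have h1 := congrFun (congrFun (hE.mul_comm (permFunctor.ofMat _
    (isInvariantMatrix_contraMatrix (R := R) (pointMap x)))) o) y
  rw [permFunctor.mat_ofMat, contraMatrix_mul_apply] at h1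
  rw [permMatrix_eq_sum]
  have h2 : pointMap x o = x := pointMap_one x
  rw [h2] at h1
  refine Eq.trans ?_ h1
  rw [Matrix.mul_apply]
  let e : G ≃ FinGSet.quot (⊥ : Subgroup G) := Equiv.ofBijective
    (fun g => (QuotientGroup.mk g : G ⧸ (⊥ : Subgroup G))) ⟨mk_bot_injective, QuotientGroup.mk_surjective⟩
  refine Fintype.sum_equiv e _ _ fun g => ?_
  change _ = permFunctor.mat (E (FinGSet.quot ⊥)) o (QuotientGroup.mk g : G ⧸ (⊥ : Subgroup G)) *
    (if g • x = y then 1 else 0)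
  rw [mul_ite, mul_one, mul_zero]
  rfl

/-- The blocks that satisfy a predicate are cut out by a central idempotent. -/
theorem exists_central_idempotent (p : ThevenazWebbBlock R G → Prop) :
    ∃ z ∈ Subring.center (MonoidAlgebra R G), IsIdempotentElem z ∧
      ∀ (S : CohomologicalMackeyFunctor R G) (hS : S.IsSimple),
        (p (ThevenazWebbBlock.of S hS) → ∀ X, S.rho z X = LinearMap.id) ∧
          (¬ p (ThevenazWebbBlock.of S hS) → ∀ X, S.rho z X = 0) := by
  obtain ⟨E, hE⟩ := exists_isUniversalProjection (R := R) p
  obtain ⟨z, hz⟩ := hE.exists_permMatrix_eq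
  refine ⟨z, mem_center_of_isInvariantMatrix ?_, ext_permMatrix ?_, fun S hS => ⟨fun hp X => ?_,
    fun hp X => ?_⟩⟩
  · rw [hz]
    exact permFunctor.mat_isInvariant _
  · rw [permMatrix_mul, hz, hE.mul_self]
  · rw [rho_eq_act_permMatrix, hz]
    exact LinearMap.ext (hE.act_eq_self hS hp)
  · rw [rho_eq_act_permMatrix, hz]
    exact LinearMap.ext (hE.act_eq_zero hS hp)

/-- Simple functors in the same block of the group algebra are in the same block in the sense of
Thévenaz and Webb. -/
theorem MemBlock.of_eq {S T : CohomologicalMackeyFunctor R G} {b : MonoidAlgebra R G}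
    (hb : IsBlockIdempotent b) (hS : S.IsSimple) (hT : T.IsSimple) (hSb : S.MemBlock b)
    (hTb : T.MemBlock b) : ThevenazWebbBlock.of S hS = ThevenazWebbBlock.of T hT := by
  by_contra hne
  obtain ⟨z, hz, hzi, h⟩ := exists_central_idempotent (R := R) (G := G)
    (fun B => B = ThevenazWebbBlock.of T hT)
  have hTz := (h T hT).1 rfl
  have hSz := (h S hS).2 hne
  have hcomm : ∀ w : MonoidAlgebra R G, b * w = w * b := mul_comm_of_mem_center hb.1
  -- Here `z` isolates the Thévenaz–Webb block of `T`, so `b z` acts as the identity on `T` and `b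
  -- (1 - z)` as the identity on `S`. Neither is zero, against primitivity of `b`.
  rcases hb.2.2.2 (b * z) (b * (1 - z)) (mul_mem hb.1 hz) (mul_mem hb.1 (one_sub_mem_center hz))
    (hb.2.1.mul_of_commute (hcomm z) hzi) (hb.2.1.mul_of_commute (hcomm _) hzi.one_sub)
    (by rw [mul_assoc, ← mul_assoc z, ← hcomm z, mul_assoc b z, mul_sub, mul_one, hzi.eq, sub_self,
      mul_zero, mul_zero]) (by rw [← mul_add, add_sub_cancel, mul_one]) with h0 | h0
  · refine hT.rho_id_ne_zero (e := b * z) (fun X => ?_) fun X => by rw [h0, rho_zero]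
    rw [T.cohomological.rho_mul hb.1 hz, hTb, hTz, LinearMap.id_comp]
  · refine hS.rho_id_ne_zero (e := b * (1 - z)) (fun X => ?_) fun X => by rw [h0, rho_zero]
    rw [S.cohomological.rho_mul hb.1 (one_sub_mem_center hz), hSb, rho_sub, hSz,
      S.cohomological.rho_one, sub_zero, LinearMap.id_comp]

/-- The bijection between the blocks of the group algebra and the blocks of cohomological Mackey
functors. -/
theorem exists_equiv_thevenazWebbBlock (R : Type u) [CommRing R] [IsLocalRing R]
    [IsNoetherianRing R] [IsAdicComplete (IsLocalRing.maximalIdeal R) R] (G : Type u) [Group G]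
    [Finite G] :
    ∃ Φ : {b : MonoidAlgebra R G // IsBlockIdempotent b} ≃ ThevenazWebbBlock R G,
      ∀ (b : {b : MonoidAlgebra R G // IsBlockIdempotent b})
        (S : CohomologicalMackeyFunctor R G) (hS : S.IsSimple),
        S.MemBlock b.1 ↔ ThevenazWebbBlock.of S hS = Φ b := by
  choose S hS hSb using fun b : {b : MonoidAlgebra R G // IsBlockIdempotent b} =>
    exists_isSimple_memBlock b.2
  -- Membership in `b` is constant on each Thévenaz–Webb block, and all simple functors in `b` share
  -- one; hence the class of any chosen simple functor in `b` defines the map.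
  have key : ∀ (b : {b : MonoidAlgebra R G // IsBlockIdempotent b})
      (T : CohomologicalMackeyFunctor R G) (hT : T.IsSimple),
      T.MemBlock b.1 ↔ ThevenazWebbBlock.of T hT = ThevenazWebbBlock.of (S b) (hS b) :=
    fun b T hT => ⟨fun h => h.of_eq b.2 hT (hS b) (hSb b), fun h =>
      (SimpleCohomologicalMackeyFunctor.memBlock_iff_of_eqvGen (Quotient.exact h) b.2.1 b.2.2.1).mpr
        (hSb b)⟩
  refine ⟨Equiv.ofBijective (fun b => ThevenazWebbBlock.of (S b) (hS b)) ⟨fun b b' h => ?_,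
    fun B => ?_⟩, key⟩
  · exact Subtype.ext ((hSb b).eq_of_isSimple (hS b) b.2 b'.2 ((key b' (S b) (hS b)).mpr h))
  · obtain ⟨⟨T, hT⟩, rfl⟩ := Quotient.exists_rep B
    obtain ⟨b, hb, hTb⟩ := exists_memBlock_of_isSimple hT
    exact ⟨⟨b, hb⟩, ((key ⟨b, hb⟩ T hT).mp hTb).symm⟩

end CohomologicalMackeyFunctor

end

theorem mainTheorem9 {p : ℕ} (hp : p.Prime) {R : Type u} [CommRing R]
    (hR : IsModularCoefficientRing p R) {G : Type u} [Group G] [Finite G] :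
    (∀ P : CohomologicalMackeyFunctor R G, P.IsProjective → P.IsIndecomposable →
      ∀ b : MonoidAlgebra R G, IsBlockIdempotent b →
        (P.MemBlock b ↔
          IsIndecomposableModule (MonoidAlgebra R G) P.evalOne.asModule ∧
            IsPermutationProjective P.evalOne ∧
            ∀ v : P.evalOne.asModule, b • v = v)) ∧
    ∃ Φ : {b : MonoidAlgebra R G // IsBlockIdempotent b} ≃ ThevenazWebbBlock R G,
      (∀ (b : {b : MonoidAlgebra R G // IsBlockIdempotent b})
        (S : CohomologicalMackeyFunctor R G) (hS : S.IsSimple),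
        S.MemBlock b.1 ↔ ThevenazWebbBlock.of S hS = Φ b) ∧
      ∀ (b : {b : MonoidAlgebra R G // IsBlockIdempotent b}) (M : CohomologicalMackeyFunctor R G),
        M.MemBlock b.1 ↔ M.MemThevenazWebbBlock (Φ b) := by
  obtain ⟨_, _, _⟩ := hR.exists_isLocalRing
  obtain ⟨Φ, hΦ⟩ := CohomologicalMackeyFunctor.exists_equiv_thevenazWebbBlock R G
  refine ⟨fun P hP hI b hb =>
    CohomologicalMackeyFunctor.memBlock_iff_of_projective_indecomposable hP hI hb, Φ, hΦ,
    fun b M => ⟨fun h S hS hSM => (hΦ b S hS).mp (h.of_isSubquotientOf hSM), fun h => ?_⟩⟩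
  exact CohomologicalMackeyFunctor.memBlock_of_forall_isSubquotientOf b.2.1 b.2.2.1
    fun S hS hSM => (hΦ b S hS).mpr (h S hS hSM)
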